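/- Let $G=Sp(2n)$ over $\mathbb{C}$, $\mathfrak{g}=\mathfrak{sp}(2n)$, let $T\subset G$ be the diagonal maximal torus and $\mathfrak{h}=\{\mathrm{diag}(x_1,\dots,x_n,-x_1,\dots,-x_n)\}$ its Lie algebra, so that $\mathbb{C}[\mathfrak{h}]=\mathbb{C}[x_1,\dots,x_n]$, and identify $\mathfrak{g}^*$ with $\mathfrak{g}$ by the trace form. Let $P\subset G$ be a parabolic subgroup containing $T$, given by a cocharacter $d\in\mathbb{Z}^n$ of $T$, with Lie algebra $\mathfrak{p}$, nilradical $\mathfrak{u}$ and Levi subalgebra $\mathfrak{l}\cong\mathfrak{sp}(2a)\times\prod_{i=1}^k\mathfrak{gl}(b_i)$ (the centralizer of $d$), where $a+b_1+\dots+b_k=n$, and put $c=b_1+\dots+b_k$. Let $\mathfrak{X}(\mathfrak{l})=(\mathfrak{l}/[\mathfrak{l},\mathfrak{l}])^*$. Let $X_{\mathfrak{X}(\mathfrak{l})}=\operatorname{Spec}\mathbb{C}[G\times^P[\mathfrak{p},\mathfrak{p}]^\perp]$, let $X_\eta$ be the scheme-theoretic fibre over $\eta\in\mathfrak{X}(\mathfrak{l})$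 of the map $X_{\mathfrak{X}(\mathfrak{l})}\to\mathfrak{X}(\mathfrak{l})$ induced by $(g,\xi)\mapsto\xi|_{\mathfrak{l}}$, and let $X_\eta^T$ be the scheme of $T$-fixed points of $X_\eta$. The weak flatness condition says that $$\dim\mathbb{C}[X_\eta^T]\ \text{ does not depend on } \eta\in\mathfrak{X}(\mathfrak{l}).\qquad(\spadesuit)$$ 1. If $\mathfrak{l}=\mathfrak{gl}(n)$, then all the algebras $\mathbb{C}[X_\eta^T]$ are finite-dimensional and $(\spadesuit)$ holds. 2. Suppose that $\mathfrak{l}$ has a nontrivial factor $\mathfrak{sp}(2a)$, $a>0$, and that $\mathfrak{l}\neq\mathfrak{g}$. Let $e\in\mathfrak{u}$ be an element of the nilpotent orbit induced from the zero orbit of $\mathfrak{l}$, i.e. $\mathfrak{u}\subset\overline{G.e}$. (a) If $G.e$ is birationally induced from the zero orbit of $\mathfrak{l}$ (i.e. $G\times^P\mathfrak{u}\to\overline{G.e}$ is birational) and $\overline{G.e}$ is normal, then $(\spadesuit)$ fails. (b) Let $I_e\subset\mathbb{C}[\mathfrak{h}]$ be the defining ideal of the scheme-theoretic intersection $\overline{G.e}\cap\mathfrak{h}$.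 Let $x\in\mathfrak{z}(\mathfrak{l})$ be generic (its centralizer in $\mathfrak{g}$ is $\mathfrak{l}$), let $I'\subset\mathbb{C}[\mathfrak{h}]$ be the defining ideal of the scheme-theoretic intersection $G.x\cap\mathfrak{h}$, and let $\operatorname{gr}I'$ be the ideal generated by the top-degree components of the elements of $I'$. Then the product of any $c+1$ distinct coordinates, in particular $x_1x_2\cdots x_{c+1}$, lies in $\operatorname{gr}I'$ but not in $I_e$. -/

import Mathlib

noncomputable section

attribute [local instance] LieRing.ofAssociativeRing

namespace SpFlat

/-- Square matrices of size `2n`, with rows and columns indexed by `Fin n ⊕ Fin n`. -/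
abbrev Mat (n : ℕ) : Type := Matrix (Fin n ⊕ Fin n) (Fin n ⊕ Fin n) ℂ

/-- The group `G = Sp(2n)` of complex points. -/
abbrev Sp (n : ℕ) : Type := Matrix.symplecticGroup (Fin n) ℂ

/-- The Lie algebra `𝔤 = 𝔰𝔭(2n)`. -/
abbrev sp (n : ℕ) : LieSubalgebra ℂ (Mat n) := LieAlgebra.Symplectic.sp (Fin n) ℂ

/-- The element `diag(x₁,…,xₙ,-x₁,…,-xₙ)` of the Cartan subalgebra `𝔥` of diagonal matrices. -/
def cartan {n : ℕ} (x : Fin n → ℂ) : Mat n :=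
  Matrix.diagonal (Sum.elim x fun i => -x i)

/-! ### Parabolic subgroups and Levi subalgebras

A cocharacter `d ∈ ℤⁿ` of the diagonal torus `T` defines a parabolic subgroup `P ⊇ T`, and every
parabolic subgroup of `Sp(2n)` that contains `T` arises in this way (so every parabolic subgroup
does, up to conjugation).  Its Levi factor is the centralizer of `d`, so that
`𝔩 ≅ 𝔰𝔭(2a) × ∏_{r ≥ 1} 𝔤𝔩(b_r)`, with `a = #{i | d i = 0}` and `b_r = #{i | |d i| = r}`. -/

/-- The weights of the cocharacter `d` on the standard basis vectors of `ℂ²ⁿ`. -/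
def wt {n : ℕ} (d : Fin n → ℤ) : Fin n ⊕ Fin n → ℤ := Sum.elim d fun i => -d i

/-- The Levi subalgebra `𝔩`. -/
def levi {n : ℕ} (d : Fin n → ℤ) : LieSubalgebra ℂ (Mat n) where
  carrier := {Y | Y ∈ sp n ∧ ∀ i j, wt d i ≠ wt d j → Y i j = 0}
  add_mem' := by
    rintro A B ⟨hA, hA'⟩ ⟨hB, hB'⟩
    exact ⟨add_mem hA hB, fun i j h => by simp [hA' i j h, hB' i j h]⟩
  zero_mem' := ⟨zero_mem _, fun _ _ _ => rfl⟩
  smul_mem' := by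
    rintro c A ⟨hA, hA'⟩
    exact ⟨(sp n).smul_mem c hA, fun i j h => by simp [hA' i j h]⟩
  lie_mem' := by
    rintro A B ⟨hA, hA'⟩ ⟨hB, hB'⟩
    refine ⟨(sp n).lie_mem hA hB, fun i j h => ?_⟩
    have key : ∀ C D : Mat n, (∀ i j, wt d i ≠ wt d j → C i j = 0) →
        (∀ i j, wt d i ≠ wt d j → D i j = 0) → (C * D) i j = 0 := by
      intro C D hC hD
      rw [Matrix.mul_apply]
      refine Finset.sum_eq_zero fun k _ => ?_
      by_cases hk : wt d i = wt d k
      · rw [hD k j (hk ▸ h), mul_zero]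
      · rw [hC i k hk, zero_mul]
    rw [Ring.lie_def, Matrix.sub_apply, key A B hA' hB', key B A hB' hA', sub_zero]

/-- The parabolic subgroup `P ⊆ G`, as a set. -/
def parabolicGroup {n : ℕ} (d : Fin n → ℤ) : Set (Sp n) :=
  {g | ∀ i j, wt d i < wt d j → (g : Mat n) i j = 0}

/-- The parabolic subalgebra `𝔭 = Lie P`, as a set. -/
def parabolicAlg {n : ℕ} (d : Fin n → ℤ) : Set (Mat n) :=
  {Y | Y ∈ sp n ∧ ∀ i j, wt d i < wt d j → Y i j = 0}

/-- The nilradical `𝔲` of `𝔭`, as a set.  It is `𝔭^⊥` for the trace form. -/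
def nilradical {n : ℕ} (d : Fin n → ℤ) : Set (Mat n) :=
  {Y | Y ∈ sp n ∧ ∀ i j, wt d i ≤ wt d j → Y i j = 0}

/-- `[𝔭,𝔭]^⊥ ⊆ 𝔤^*`, where `𝔤^*` is identified with `𝔤` by the trace form. -/
def commPerp {n : ℕ} (d : Fin n → ℤ) : Set (Mat n) :=
  {Y | Y ∈ sp n ∧ ∀ Z ∈ parabolicAlg d, ∀ Z' ∈ parabolicAlg d, Matrix.trace (Y * ⁅Z, Z'⁆) = 0}

/-! ### The deformation `X_𝔛(𝔩) = Spec ℂ[G ×^P [𝔭,𝔭]^⊥]` -/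

/-- Regularity of a function on the affine variety `G × [𝔭,𝔭]^⊥`: it is given by a polynomial in
the matrix entries of both arguments. -/
def IsRegularFun {n : ℕ} (d : Fin n → ℤ) (f : Sp n × commPerp d → ℂ) : Prop :=
  ∃ F : MvPolynomial
      (((Fin n ⊕ Fin n) × (Fin n ⊕ Fin n)) ⊕ ((Fin n ⊕ Fin n) × (Fin n ⊕ Fin n))) ℂ,
    ∀ (g : Sp n) (Y : commPerp d),
      f (g, Y) = MvPolynomial.eval
        (Sum.elim (fun ij => (g : Mat n) ij.1 ij.2) fun ij => (Y : Mat n) ij.1 ij.2) F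

/-- The algebra `ℂ[T^*_{𝔛(𝔩)} 𝒫]` of regular functions on `G ×^P [𝔭,𝔭]^⊥`: the regular functions
`f` on `G × [𝔭,𝔭]^⊥` with `f (g p, p⁻¹ Y p) = f (g, Y)` for all `p ∈ P`. -/
def coordRing {n : ℕ} (d : Fin n → ℤ) : Subalgebra ℂ (Sp n × commPerp d → ℂ) where
  carrier := {f | IsRegularFun d f ∧
    ∀ (g p : Sp n), p ∈ parabolicGroup d → ∀ Y Y' : commPerp d,
      (p : Mat n) * (Y' : Mat n) = (Y : Mat n) * (p : Mat n) → f (g * p, Y') = f (g, Y)}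
  mul_mem' := by
    rintro f₁ f₂ ⟨⟨F₁, h₁⟩, k₁⟩ ⟨⟨F₂, h₂⟩, k₂⟩
    refine ⟨⟨F₁ * F₂, fun g Y => by simp [h₁, h₂]⟩, fun g p hp Y Y' h => ?_⟩
    simp [k₁ g p hp Y Y' h, k₂ g p hp Y Y' h]
  add_mem' := by
    rintro f₁ f₂ ⟨⟨F₁, h₁⟩, k₁⟩ ⟨⟨F₂, h₂⟩, k₂⟩
    refine ⟨⟨F₁ + F₂, fun g Y => by simp [h₁, h₂]⟩, fun g p hp Y Y' h => ?_⟩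
    simp [k₁ g p hp Y Y' h, k₂ g p hp Y Y' h]
  algebraMap_mem' := fun c => ⟨⟨MvPolynomial.C c, fun g Y => by simp⟩, fun _ _ _ _ _ _ => rfl⟩

/-- The space `𝔛(𝔩) = (𝔩/[𝔩,𝔩])^*` of characters of the Lie algebra `𝔩`. -/
abbrev Char {n : ℕ} (d : Fin n → ℤ) : Type := LieAlgebra.LieCharacter ℂ (levi d)

/-- The ideal of the scheme-theoretic fibre `X_η` of `X_𝔛(𝔩) → 𝔛(𝔩)`, `(g, Y) ↦ Y|_𝔩`: it is
generated by the functions `(g, Y) ↦ tr (Y Z) - η(Z)` with `Z ∈ 𝔩`. -/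
def fibreIdeal {n : ℕ} (d : Fin n → ℤ) (η : Char d) : Ideal (coordRing d) :=
  Ideal.span {f | ∃ Z : levi d, ∀ (g : Sp n) (Y : commPerp d),
    (f : Sp n × commPerp d → ℂ) (g, Y) = Matrix.trace ((Y : Mat n) * (Z : Mat n)) - η Z}

/-- The ideal of the scheme-theoretic fixed points of the diagonal torus `T ⊆ G`, which acts by left
multiplication on `G`: it is generated by all differences `t·f - f`. -/
def fixedIdeal {n : ℕ} (d : Fin n → ℤ) : Ideal (coordRing d) :=
  Ideal.span {f | ∃ t : Sp n, (t : Mat n).IsDiag ∧ ∃ f' : coordRing d,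
    ∀ (g : Sp n) (Y : commPerp d), (f : Sp n × commPerp d → ℂ) (g, Y) =
      (f' : Sp n × commPerp d → ℂ) (t * g, Y) - (f' : Sp n × commPerp d → ℂ) (g, Y)}

/-- The algebra `ℂ[X_η^T]`. -/
abbrev FixedAlg {n : ℕ} (d : Fin n → ℤ) (η : Char d) : Type :=
  coordRing d ⧸ (fibreIdeal d η ⊔ fixedIdeal d)

/-- The weak flatness condition: `dim ℂ[X_η^T]` does not depend on `η ∈ 𝔛(𝔩)`. -/
def WeakFlat {n : ℕ} (d : Fin n → ℤ) : Prop :=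
  ∀ η η₀ : Char d, Module.rank ℂ (FixedAlg d η) = Module.rank ℂ (FixedAlg d η₀)

/-! ### Orbits and their ideals -/

/-- The adjoint orbit `G.x`. -/
def orbit {n : ℕ} (x : Mat n) : Set (Mat n) :=
  {Y | ∃ g : Sp n, Y = (g : Mat n) * x * ((g⁻¹ : Sp n) : Mat n)}

/-- The ideal of all polynomials in the matrix entries that vanish on `S`, i.e. the defining ideal
of the Zariski closure of `S`. -/
def idealOf {n : ℕ} (S : Set (Mat n)) :
    Ideal (MvPolynomial ((Fin n ⊕ Fin n) × (Fin n ⊕ Fin n)) ℂ) :=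
  MvPolynomial.vanishingIdeal ℂ {v | ∃ Y ∈ S, v = fun ij => Y ij.1 ij.2}

/-- Restriction of polynomials to `𝔥`, where `ℂ[𝔥] = ℂ[x₁,…,xₙ]`. -/
def toCartan (n : ℕ) :
    MvPolynomial ((Fin n ⊕ Fin n) × (Fin n ⊕ Fin n)) ℂ →ₐ[ℂ] MvPolynomial (Fin n) ℂ :=
  MvPolynomial.aeval fun ij =>
    if ij.1 = ij.2 then Sum.elim MvPolynomial.X (fun i => -MvPolynomial.X i) ij.1 else 0

/-- The defining ideal in `ℂ[𝔥]` of the scheme-theoretic intersection with `𝔥` of the Zariski closure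
of `S`. -/
def cartanIdeal {n : ℕ} (S : Set (Mat n)) : Ideal (MvPolynomial (Fin n) ℂ) :=
  (idealOf S).map (toCartan n)

/-- The associated graded ideal `gr I`, generated by the top-degree components of the elements of
`I`. -/
def gr {σ : Type} (I : Ideal (MvPolynomial σ ℂ)) : Ideal (MvPolynomial σ ℂ) :=
  Ideal.span {q | ∃ f ∈ I, q = MvPolynomial.homogeneousComponent f.totalDegree f}

/-- `diag(x,-x)` is a generic element of `𝔷(𝔩)`: its centralizer in `𝔤` is `𝔩`. -/
def IsGeneric {n : ℕ} (d : Fin n → ℤ) (x : Fin n → ℂ) : Prop :=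
  ∀ Y ∈ sp n, cartan x * Y = Y * cartan x ↔ Y ∈ levi d

/-- `e ∈ 𝔲` lies in the orbit `Ind_L^G {0}`: the Zariski closure of `G.e` contains `𝔲`, and hence
equals `G.𝔲`. -/
def IsRichardson {n : ℕ} (d : Fin n → ℤ) (e : Mat n) : Prop :=
  e ∈ nilradical d ∧
    ∀ F ∈ idealOf (orbit e), ∀ Y ∈ nilradical d, MvPolynomial.eval (fun ij => Y ij.1 ij.2) F = 0

/-- For `e ∈ 𝔲` in `Ind_L^G {0}`: the orbit of `e` is birationally induced from the zero orbit of
`𝔩`, i.e. the fibre over `e` of `G ×^P 𝔲 → 𝔤`, `(g, Y) ↦ g Y g⁻¹` (which is finite étale over `G.e`)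
is a single point. -/
def IsBirational {n : ℕ} (d : Fin n → ℤ) (e : Mat n) : Prop :=
  ∀ g : Sp n, ((g⁻¹ : Sp n) : Mat n) * e * (g : Mat n) ∈ nilradical d → g ∈ parabolicGroup d

/-- The Zariski closure of `G.e` is a normal variety. -/
def HasNormalClosure {n : ℕ} (e : Mat n) : Prop :=
  IsIntegrallyClosed
    (MvPolynomial ((Fin n ⊕ Fin n) × (Fin n ⊕ Fin n)) ℂ ⧸ idealOf (orbit e))

end SpFlat

end

noncomputable section

attribute [local instance] LieRing.ofAssociativeRing

namespace SpFlat

open Matrix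

/-! ### The symplectic adjoint -/

section Adjoint

variable {n : ℕ} {E : Type*} [CommRing E]

/-! Write A for the matrix g Y g⁻¹ on G × [𝔭,𝔭]^⊥. Its entries and the diagonal entries of Y are
functions on X_𝔛(𝔩), and they generate `entryAlg`. On the torus fixed points A becomes a diagonal
matrix diag(a,-a). It has the characteristic polynomial of Y, and it is annihilated by the product
of the factors X - y, with one diagonal entry y of Y for each weight. The rest of the proof measures
how far `entryAlg` is from the whole coordinate ring.

The case 𝔩 = 𝔤𝔩(n). Here `entryAlg` is everything (`entryAlg_eq_top`). On the big cell, a function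
invariant under the opposite unipotent radical is a polynomial in the 𝔲-part of A and the diagonal
of Y. Complete reducibility (`le_of_fixed_mem`), applied to tensors with their Hermitian form,
reduces the general function to this one. Moreover 𝔛(𝔩) is a line with a coordinate t, and the fixed
points satisfy a_i² = r²t². The squarefree products of the a_i therefore span over ℂ[t], and
evaluation at the 2ⁿ sign changes of diag(d,-d) shows that they are independent. Every fibre has
dimension 2ⁿ.

The case a > 0, part (b). A point of G.x ∩ 𝔥 has at most c nonzero coordinates, and its coordinates
satisfy a separable equation, so a product of c + 1 coordinates lies in I'
(`prod_X_mem_cartanIdeal`); being homogeneous, it lies in gr I'. On the nilpotent side, G.𝔲 contains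
the sum of c + 1 commuting long root vectors (`indicator_mem_saturation`). A quadratic form of rank
c + 1 can be moved so that it vanishes on the a zero-weight directions, since one of these can be
made isotropic with the help of a nonzero-weight direction. Conjugation by SL₂ⁿ gives blocks (αβ,
α²; -β², -αβ). Modulo all α_i² and β_i² they are diagonal, yet the product of the α_iβ_i is not
zero. Hence the monomial is not in I_e (`prod_X_notMem_cartanIdeal`).

Part (a). The Iwasawa decomposition over valuation rings makes the coordinate ring integral over
`entryAlg`, and in fact finite (`exists_finset_span_entryAlg`). The torus fixed points over the line
through d are thus finite over ℂ[t]. If all fibres had the same dimension, a function vanishing on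
every fibre with t ≠ 0 would vanish at t = 0 as well (`mem_span_of_rank_eq`); the product of c + 1
of the a_i is such a function. By birationality and normality, functions on X restrict to
polynomials on the orbit of e (`exists_polynomial_on_orbit`), so the monomial would lie in I_e,
contrary to (b). -/

/-- The adjoint of a matrix with respect to the standard symplectic form. -/
def sadj (M : Matrix (Fin n ⊕ Fin n) (Fin n ⊕ Fin n) E) :
    Matrix (Fin n ⊕ Fin n) (Fin n ⊕ Fin n) E :=
  -(J (Fin n) E) * Mᵀ * J (Fin n) E

/-- The sign `1` on the first half of the basis and `-1` on the second half. -/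
def sg (E : Type*) [CommRing E] {n : ℕ} : Fin n ⊕ Fin n → E := Sum.elim (fun _ => 1) fun _ => -1

lemma sadj_fromBlocks (a b c d : Matrix (Fin n) (Fin n) E) :
    sadj (fromBlocks a b c d) = fromBlocks dᵀ (-bᵀ) (-cᵀ) aᵀ := by
  simp [sadj, J, fromBlocks_transpose, fromBlocks_multiply, fromBlocks_neg]

lemma sadj_apply (M : Matrix (Fin n ⊕ Fin n) (Fin n ⊕ Fin n) E) (i j) :
    sadj M i j = sg E i * sg E j * M j.swap i.swap := by
  rw [← fromBlocks_toBlocks M, sadj_fromBlocks]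
  rcases i with i | i <;> rcases j with j | j <;> simp [sg]

lemma sg_mul_self (i : Fin n ⊕ Fin n) : sg E i * sg E i = 1 := by
  rcases i with i | i <;> simp [sg]

lemma sg_swap (i : Fin n ⊕ Fin n) : sg E i.swap = - sg E i := by
  rcases i with i | i <;> simp [sg]

@[simp] lemma sadj_one : sadj (1 : Matrix (Fin n ⊕ Fin n) (Fin n ⊕ Fin n) E) = 1 := by
  simp [sadj, J_squared]

lemma sadj_mul (A B : Matrix (Fin n ⊕ Fin n) (Fin n ⊕ Fin n) E) :
    sadj (A * B) = sadj B * sadj A := by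
  have h := J_squared (Fin n) E
  calc sadj (A * B) = -(J (Fin n) E) * Bᵀ * (1 : Matrix _ _ E) * Aᵀ * J (Fin n) E := by
        simp [sadj, Matrix.mul_assoc]
    _ = -(J (Fin n) E) * Bᵀ * (J (Fin n) E * -J (Fin n) E) * Aᵀ * J (Fin n) E := by
        rw [Matrix.mul_neg, h, neg_neg]
    _ = _ := by simp only [sadj, Matrix.mul_assoc]

@[simp] lemma sadj_sadj (A : Matrix (Fin n ⊕ Fin n) (Fin n ⊕ Fin n) E) : sadj (sadj A) = A := by
  ext i j
  rw [sadj_apply, sadj_apply, sg_swap, sg_swap, Sum.swap_swap, Sum.swap_swap]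
  linear_combination A i j * (sg_mul_self (E := E) j) + A i j * sg E j ^ 2 * (sg_mul_self (E := E) i)

@[simp] lemma sadj_add (A B : Matrix (Fin n ⊕ Fin n) (Fin n ⊕ Fin n) E) :
    sadj (A + B) = sadj A + sadj B := by
  simp [sadj, Matrix.mul_add, Matrix.add_mul]
  abel

@[simp] lemma sadj_neg (A : Matrix (Fin n ⊕ Fin n) (Fin n ⊕ Fin n) E) : sadj (-A) = -sadj A := by
  simp [sadj]

@[simp] lemma sadj_sub (A B : Matrix (Fin n ⊕ Fin n) (Fin n ⊕ Fin n) E) :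
    sadj (A - B) = sadj A - sadj B := by
  simp [sub_eq_add_neg]

@[simp] lemma sadj_smul (c : E) (A : Matrix (Fin n ⊕ Fin n) (Fin n ⊕ Fin n) E) :
    sadj (c • A) = c • sadj A := by
  simp [sadj]

lemma trace_sadj (A : Matrix (Fin n ⊕ Fin n) (Fin n ⊕ Fin n) E) :
    trace (sadj A) = trace A := by
  rw [sadj, Matrix.trace_mul_comm, ← Matrix.mul_assoc, Matrix.mul_neg, J_squared]
  simp

lemma map_sadj {F : Type*} [CommRing F] (φ : E →+* F)
    (A : Matrix (Fin n ⊕ Fin n) (Fin n ⊕ Fin n) E) : (sadj A).map φ = sadj (A.map φ) := by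
  ext i j
  rw [Matrix.map_apply, sadj_apply, sadj_apply, Matrix.map_apply, map_mul, map_mul]
  rcases i with i | i <;> rcases j with j | j <;> simp [sg]

/-- In this form the group is cut out by equations that make sense over any commutative ring and are
carried along by ring homomorphisms. Points over valuation rings and function fields are needed
later. -/
lemma mem_symplectic_iff (g : Matrix (Fin n ⊕ Fin n) (Fin n ⊕ Fin n) E) :
    g ∈ symplecticGroup (Fin n) E ↔ g * sadj g = 1 := by
  rw [SymplecticGroup.mem_iff]
  have h := J_squared (Fin n) E
  have key : g * sadj g = -(g * J (Fin n) E * gᵀ * J (Fin n) E) := by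
    simp [sadj, Matrix.mul_assoc]
  rw [key]
  constructor
  · intro hg
    rw [hg, h, neg_neg]
  · intro hg
    have := congrArg (· * J (Fin n) E) hg
    simp only [Matrix.neg_mul, Matrix.mul_assoc, h, Matrix.mul_neg, Matrix.mul_one, neg_neg,
      Matrix.one_mul] at this
    simpa only [Matrix.mul_assoc] using this

lemma mul_sadj (g : symplecticGroup (Fin n) E) :
    (g : Matrix (Fin n ⊕ Fin n) (Fin n ⊕ Fin n) E) * sadj g.1 = 1 :=
  (mem_symplectic_iff _).1 g.2

lemma sadj_mul_self (g : symplecticGroup (Fin n) E) :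
    sadj g.1 * (g : Matrix (Fin n ⊕ Fin n) (Fin n ⊕ Fin n) E) = 1 :=
  mul_eq_one_comm.1 (mul_sadj g)

lemma coe_inv_eq_sadj (g : symplecticGroup (Fin n) E) :
    ((g⁻¹ : symplecticGroup (Fin n) E) : Matrix (Fin n ⊕ Fin n) (Fin n ⊕ Fin n) E) = sadj g.1 :=
  rfl

lemma mem_sp_iff (Y : Mat n) : Y ∈ sp n ↔ sadj Y = -Y := by
  have h := J_squared (Fin n) ℂ
  rw [sp, LieAlgebra.Symplectic.sp, mem_skewAdjointMatricesLieSubalgebra,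
    mem_skewAdjointMatricesSubmodule, Matrix.IsSkewAdjoint, Matrix.IsAdjointPair, sadj]
  constructor
  · intro hY
    rw [Matrix.mul_assoc, hY, ← Matrix.mul_assoc, Matrix.neg_mul, h, neg_neg, Matrix.one_mul]
  · intro hY
    have := congrArg (J (Fin n) ℂ * ·) hY
    simp only [← Matrix.mul_assoc, Matrix.mul_neg, h, neg_neg, Matrix.one_mul] at this
    rw [this, Matrix.mul_neg]

end Adjoint

/-! ### The weights -/

section Weights

variable {n : ℕ} (d : Fin n → ℤ)

@[simp] lemma wt_swap (i : Fin n ⊕ Fin n) : wt d i.swap = - wt d i := by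
  rcases i with i | i <;> simp [wt]

/-- The matrices `Y ∈ 𝔲 ⊕ 𝔷(𝔩)` with entries in a ring. -/
structure IsComm {E : Type*} [CommRing E] (Y : Matrix (Fin n ⊕ Fin n) (Fin n ⊕ Fin n) E) : Prop where
  skew : sadj Y = -Y
  zero : ∀ i j, wt d i ≤ wt d j → i ≠ j → Y i j = 0
  diag : ∀ i j, wt d i = wt d j → Y i i = Y j j

/-- Membership in the parabolic subgroup, for matrices with entries in a ring. -/
def IsPar {E : Type*} [CommRing E] (p : Matrix (Fin n ⊕ Fin n) (Fin n ⊕ Fin n) E) : Prop :=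
  ∀ i j, wt d i < wt d j → p i j = 0

variable {d} {E : Type*} [CommRing E]

lemma IsPar.sadj {p : Matrix (Fin n ⊕ Fin n) (Fin n ⊕ Fin n) E} (hp : IsPar d p) :
    IsPar d (sadj p) := by
  intro i j h
  rw [sadj_apply, hp _ _ (by simpa using h), mul_zero]

/-- A nonzero term p_il Y_lk q_kj forces wt l ≤ wt i ≤ wt j ≤ wt k. There Y_lk survives only for l =
k, and then all four weights agree. So Y contributes nothing but the scalar by which it acts in this
weight. -/
lemma IsComm.conj_apply {p q Y : Matrix (Fin n ⊕ Fin n) (Fin n ⊕ Fin n) E} (hY : IsComm d Y)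
    (hp : IsPar d p) (hq : IsPar d q) {i j} (hij : wt d i ≤ wt d j) :
    (p * Y * q) i j = Y i i * (p * q) i j := by
  simp only [Matrix.mul_apply, Finset.mul_sum, Finset.sum_mul]
  refine Finset.sum_congr rfl fun k _ => ?_
  rw [Finset.sum_eq_single k]
  · rcases lt_or_ge (wt d i) (wt d k) with h | h
    · simp [hp i k h]
    rcases lt_or_ge (wt d k) (wt d j) with h' | h'
    · simp [hq k j h']
    rw [hY.diag i k (le_antisymm (hij.trans h') h)]
    ring
  · intro l _ hl
    rcases lt_or_ge (wt d i) (wt d l) with h | h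
    · simp [hp i l h]
    rcases lt_or_ge (wt d k) (wt d j) with h' | h'
    · simp [hq k j h']
    rw [hY.zero l k (h.trans (hij.trans h')) hl]
    simp
  · simp

lemma IsComm.conj {p Y : Matrix (Fin n ⊕ Fin n) (Fin n ⊕ Fin n) E} (hY : IsComm d Y)
    (hp : IsPar d p) (hs : p * sadj p = 1) : IsComm d (p * Y * sadj p) := by
  have key := fun i j (h : wt d i ≤ wt d j) => hY.conj_apply hp hp.sadj h
  refine ⟨?_, fun i j h hij => ?_, fun i j h => ?_⟩
  · rw [sadj_mul, sadj_mul, sadj_sadj, hY.skew]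
    simp [Matrix.mul_assoc]
  · rw [key i j h, hs, Matrix.one_apply_ne hij, mul_zero]
  · rw [key i i le_rfl, key j j le_rfl, hs, hY.diag i j h]
    simp

lemma IsComm.conj_diag {p Y : Matrix (Fin n ⊕ Fin n) (Fin n ⊕ Fin n) E} (hY : IsComm d Y)
    (hp : IsPar d p) (hs : p * SpFlat.sadj p = 1) (i) : (p * Y * SpFlat.sadj p) i i = Y i i := by
  rw [hY.conj_apply hp hp.sadj le_rfl, hs]
  simp

lemma IsComm.map {F : Type*} [CommRing F] (φ : E →+* F)
    {Y : Matrix (Fin n ⊕ Fin n) (Fin n ⊕ Fin n) E} (hY : IsComm d Y) : IsComm d (Y.map φ) := by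
  refine ⟨?_, fun i j h hij => ?_, fun i j h => ?_⟩
  · rw [← map_sadj, hY.skew]
    ext
    simp
  · simp [hY.zero i j h hij]
  · simp [hY.diag i j h]

/-- A matrix of `𝔲 ⊕ 𝔷(𝔩)` is annihilated by the product of its distinct diagonal entries. -/
lemma IsComm.aeval_prod_eq_zero {Y : Matrix (Fin n ⊕ Fin n) (Fin n ⊕ Fin n) E}
    (hY : IsComm d Y) (y : ℤ → E) (hy : ∀ i, Y i i = y (wt d i)) :
    Polynomial.aeval Y (∏ m ∈ Finset.univ.image (wt d), (Polynomial.X - Polynomial.C (y m))) = 0 := by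
  -- Y sends a basis vector to a multiple of itself plus vectors of larger weight. On vectors
  -- supported in an upward closed set W of weights, the factor for the least weight removes that
  -- weight from the support.
  suffices h : ∀ W : Finset ℤ, (∀ i k, wt d i ∈ W → wt d i ≤ wt d k → wt d k ∈ W) →
      ∀ v : Fin n ⊕ Fin n → E, (∀ i, wt d i ∉ W → v i = 0) →
      Polynomial.aeval Y (∏ m ∈ W, (Polynomial.X - Polynomial.C (y m))) *ᵥ v = 0 by
    refine Matrix.ext_of_mulVec_single fun i => ?_
    rw [h, Matrix.zero_mulVec]
    · intro i k _ _
      exact Finset.mem_image_of_mem _ (Finset.mem_univ k)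
    · intro i hi
      exact absurd (Finset.mem_image_of_mem _ (Finset.mem_univ i)) hi
  intro W
  induction W using Finset.induction_on_min with
  | empty =>
    intro _ v hv
    have : v = 0 := funext fun i => hv i (by simp)
    simp [this]
  | insert a s has ih =>
    intro hW v hv
    have ha : a ∉ s := fun h => lt_irrefl _ (has a h)
    rw [Finset.prod_insert ha, mul_comm, map_mul, ← Matrix.mulVec_mulVec]
    refine ih ?_ _ ?_
    · intro i k hi hik
      rcases Finset.mem_insert.1 (hW i k (Finset.mem_insert_of_mem hi) hik) with h | h
      · exact absurd (has _ hi) (by omega)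
      · exact h
    · intro i hi
      rw [map_sub, Polynomial.aeval_X, Polynomial.aeval_C, Matrix.sub_mulVec, Pi.sub_apply]
      rw [Algebra.algebraMap_eq_smul_one, Matrix.smul_mulVec, Matrix.one_mulVec, Pi.smul_apply]
      rw [Matrix.mulVec, dotProduct, Finset.sum_eq_single i]
      · by_cases hia : wt d i = a
        · rw [hy, hia, smul_eq_mul, sub_self]
        · rw [hv i (by simp [hia, hi])]
          simp
      · intro j _ hj
        rcases le_or_gt (wt d i) (wt d j) with h | h
        · rw [hY.zero i j h hj.symm, zero_mul]
        · rw [hv j, mul_zero]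
          intro hj'
          have h1 := hW j i hj' h.le
          rcases Finset.mem_insert.1 h1 with h2 | h2
          · rcases Finset.mem_insert.1 hj' with h3 | h3
            · omega
            · have := has _ h3
              omega
          · exact hi h2
      · simp

/-- Ordered by weight, Y is block triangular, and entries between different basis vectors of equal
weight vanish, so the diagonal blocks are themselves diagonal. -/
lemma IsComm.charpoly_eq {Y : Matrix (Fin n ⊕ Fin n) (Fin n ⊕ Fin n) E}
    (hY : IsComm d Y) : Y.charpoly = ∏ i, (Polynomial.X - Polynomial.C (Y i i)) := by
  have hb : (charmatrix Y).BlockTriangular (fun i => - wt d i) := by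
    intro i j h
    have hij : i ≠ j := fun e => by simp [e] at h
    have h' : wt d i < wt d j := by simpa using h
    rw [charmatrix_apply_ne _ _ _ hij, hY.zero i j h'.le hij]
    simp
  rw [Matrix.charpoly, hb.det, ← Finset.prod_fiberwise_of_maps_to
    (g := fun i => - wt d i) (t := Finset.univ.image fun i => - wt d i)
    (fun i hi => Finset.mem_image_of_mem _ hi)]
  refine Finset.prod_congr rfl fun a _ => ?_
  have : (charmatrix Y).toSquareBlock (fun i => -wt d i) a =
      Matrix.diagonal fun i => Polynomial.X - Polynomial.C (Y i.1 i.1) := by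
    ext1 i j
    by_cases h : i = j
    · subst h
      simp [toSquareBlock_def, charmatrix_apply_eq]
    · have h' : i.1 ≠ j.1 := fun e => h (Subtype.ext e)
      have h1 : - wt d i.1 = a := i.2
      have h2 : - wt d j.1 = a := j.2
      rw [toSquareBlock_def, Matrix.of_apply, charmatrix_apply_ne _ _ _ h',
        hY.zero i.1 j.1 (by omega) h', Matrix.diagonal_apply_ne _ h]
      simp
  rw [this, Matrix.det_diagonal]
  exact (Finset.prod_subtype (p := fun i => - wt d i = a) _ (by simp)
    fun i => Polynomial.X - Polynomial.C (Y i i)).symm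

end Weights

/-! ### Irreducibility of the symplectic group -/

section Irreducible

/-- For a Lagrangian pair `(A, C)` some `A + s C` with `s` symmetric is invertible. -/
lemma exists_isSymm_isUnit_add_mul {m : Type*} [Fintype m] [DecidableEq m] {A C : Matrix m m ℂ}
    (hker : ∀ x, A *ᵥ x = 0 → C *ᵥ x = 0 → x = 0) (hsymm : Aᵀ * C = Cᵀ * A) :
    ∃ s : Matrix m m ℂ, s.IsSymm ∧ IsUnit (A + s * C) := by
  -- Gaussian elimination makes C diagonal. The compatible change of A preserves the symmetry
  -- relation, and it suffices to perturb A' by a scalar multiple of D.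
  obtain ⟨L, L', D, hD⟩ :=
    Matrix.Pivot.exists_list_transvec_mul_mul_list_transvec_eq_diagonal C
  set V := (L.map TransvectionStruct.toMatrix).prod with hV
  set U := (L'.map TransvectionStruct.toMatrix).prod with hU
  have hVu : IsUnit V := by
    rw [Matrix.isUnit_iff_isUnit_det, hV, TransvectionStruct.det_toMatrix_prod]
    exact isUnit_one
  have hUu : IsUnit U := by
    rw [Matrix.isUnit_iff_isUnit_det, hU, TransvectionStruct.det_toMatrix_prod]
    exact isUnit_one
  have hVdet := (Matrix.isUnit_iff_isUnit_det _).1 hVu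
  have hVtdet : IsUnit (Vᵀ).det := by rwa [Matrix.det_transpose]
  set A' := (Vᵀ)⁻¹ * A * U with hA'
  have hA : Vᵀ * A' = A * U := by
    rw [hA', ← Matrix.mul_assoc, ← Matrix.mul_assoc, Matrix.mul_nonsing_inv _ hVtdet,
      Matrix.one_mul]
  have hsym' : diagonal D * A' = A'ᵀ * diagonal D := by
    calc diagonal D * A' = (diagonal D)ᵀ * A' := by rw [diagonal_transpose]
      _ = Uᵀ * Cᵀ * (Vᵀ * A') := by rw [← hD]; simp only [transpose_mul, Matrix.mul_assoc]
      _ = Uᵀ * (Cᵀ * A) * U := by rw [hA]; simp only [Matrix.mul_assoc]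
      _ = (A * U)ᵀ * (C * U) := by rw [← hsymm, transpose_mul]; simp only [Matrix.mul_assoc]
      _ = A'ᵀ * (V * C * U) := by
        rw [← hA, transpose_mul, transpose_transpose]; simp only [Matrix.mul_assoc]
      _ = A'ᵀ * diagonal D := by rw [hD]
  have hentry : ∀ i j, D i * A' i j = A' j i * D j := fun i j => by
    have := congrFun (congrFun hsym' i) j
    simpa [Matrix.diagonal_mul, Matrix.mul_diagonal] using this
  -- Since 0⁻¹ = 0, this matrix acts as D⁻¹A' on the support of D. That subspace splits off, because
  -- A' has no entries in a row with D ≠ 0 and a column with D = 0. Any c outside the finite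
  -- spectrum makes A' - cD injective there; the kernel of D is handled by `hker`.
  obtain ⟨c, hc⟩ : ∃ c : ℂ, c ∉ spectrum ℂ (diagonal (fun i => (D i)⁻¹) * A') := by
    by_contra! h
    have hfin := Matrix.finite_spectrum (R := ℂ) (diagonal (fun i => (D i)⁻¹) * A')
    exact (Set.infinite_univ (α := ℂ)) (hfin.subset fun x _ => h x)
  have hinj : ∀ v, (A' + (-c) • diagonal D) *ᵥ v = 0 → v = 0 := by
    intro v hv
    set v1 : m → ℂ := fun i => if D i = 0 then 0 else v i with hv1
    have h1 : (diagonal (fun i => (D i)⁻¹) * A') *ᵥ v1 = c • v1 := by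
      ext i
      rw [← Matrix.mulVec_mulVec, Matrix.mulVec_diagonal, Pi.smul_apply, smul_eq_mul]
      by_cases hi : D i = 0
      · simp [hv1, hi]
      · have h2 : (A' *ᵥ v1) i = (A' *ᵥ v) i := by
          simp only [Matrix.mulVec, dotProduct]
          refine Finset.sum_congr rfl fun j _ => ?_
          by_cases hj : D j = 0
          · have := hentry i j
            rw [hj, mul_zero] at this
            rw [(mul_eq_zero.1 this).resolve_left hi, zero_mul, zero_mul]
          · simp [hv1, hj]
        have h3 := congrFun hv i
        rw [Matrix.add_mulVec, Pi.add_apply, Matrix.smul_mulVec, Pi.smul_apply,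
          Matrix.mulVec_diagonal, Pi.zero_apply, smul_eq_mul] at h3
        have h4 : v1 i = v i := by simp [hv1, hi]
        rw [h2, h4]
        field_simp
        linear_combination h3
    have h5 : v1 = 0 := by
      by_contra hne
      refine hc ?_
      rw [← Matrix.spectrum_toLin', ← Module.End.hasEigenvalue_iff_mem_spectrum]
      exact Module.End.hasEigenvalue_of_hasEigenvector (x := v1)
        ⟨by rw [Module.End.mem_eigenspace_iff, Matrix.toLin'_apply, h1], hne⟩
    have h6 : diagonal D *ᵥ v = 0 := by
      ext i
      rw [Matrix.mulVec_diagonal]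
      by_cases hi : D i = 0
      · simp [hi]
      · have := congrFun h5 i
        simp only [hv1, hi, if_false, Pi.zero_apply] at this
        simp [this]
    have h7 : A' *ᵥ v = 0 := by
      rw [Matrix.add_mulVec, Matrix.smul_mulVec, h6, smul_zero, add_zero] at hv
      exact hv
    have h8 : U *ᵥ v = 0 := by
      refine hker _ ?_ ?_
      · rw [Matrix.mulVec_mulVec, ← hA, ← Matrix.mulVec_mulVec, h7, Matrix.mulVec_zero]
      · refine Matrix.mulVec_injective_of_isUnit hVu ?_
        simp only [Matrix.mulVec_mulVec, ← Matrix.mul_assoc, hD, h6, Matrix.mulVec_zero]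
    exact Matrix.mulVec_injective_of_isUnit hUu (by rw [h8, Matrix.mulVec_zero])
  refine ⟨(-c) • (Vᵀ * V), ?_, ?_⟩
  · rw [Matrix.IsSymm, transpose_smul, transpose_mul, transpose_transpose]
  · have hu : IsUnit (A' + (-c) • diagonal D) := by
      rw [← Matrix.mulVec_injective_iff_isUnit]
      intro x y hxy
      have := hinj (x - y) (by rw [Matrix.mulVec_sub, sub_eq_zero]; exact hxy)
      exact sub_eq_zero.1 this
    have h9 : (A + (-c) • (Vᵀ * V) * C) * U = Vᵀ * (A' + (-c) • diagonal D) := by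
      rw [Matrix.mul_add, hA, ← hD, Matrix.add_mul]
      simp only [Matrix.mul_assoc, Matrix.smul_mul, Matrix.mul_smul]
    have h10 : IsUnit ((A + (-c) • (Vᵀ * V) * C) * U) := by
      rw [h9]
      exact ((Matrix.isUnit_transpose V).2 hVu).mul hu
    rw [Matrix.isUnit_iff_isUnit_det, Matrix.det_mul] at h10
    rw [Matrix.isUnit_iff_isUnit_det]
    exact isUnit_of_mul_isUnit_left h10

/-! ### Cayley coordinates and rational curves in Sp(2n) -/

variable {n : ℕ}

lemma eval_det_add_smul (A B : Mat n) (t : ℂ) :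
    (Matrix.det (A.map Polynomial.C + (Polynomial.X : Polynomial ℂ) • B.map Polynomial.C)).eval t =
      (A + t • B).det := by
  rw [← Polynomial.coe_evalRingHom, RingHom.map_det]
  congr 1
  ext i j
  simp [mul_comm t]

lemma exists_common_unit (A B A' B' : Mat n) (s s' : ℂ) (h : (A + s • B).det ≠ 0)
    (h' : (A' + s' • B').det ≠ 0) :
    ∃ t : ℂ, (A + t • B).det ≠ 0 ∧ (A' + t • B').det ≠ 0 := by
  set p := Matrix.det (A.map Polynomial.C + (Polynomial.X : Polynomial ℂ) • B.map Polynomial.C)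
  set q := Matrix.det (A'.map Polynomial.C + (Polynomial.X : Polynomial ℂ) • B'.map Polynomial.C)
  have hp : p ≠ 0 := fun e => h (by rw [← eval_det_add_smul]; exact (congrArg _ e).trans Polynomial.eval_zero)
  have hq : q ≠ 0 := fun e => h' (by
    rw [← eval_det_add_smul]; exact (congrArg _ e).trans Polynomial.eval_zero)
  obtain ⟨t, ht⟩ : ∃ t, (p * q).eval t ≠ 0 := by
    by_contra! hc
    exact mul_ne_zero hp hq (Polynomial.funext fun x => by rw [hc, Polynomial.eval_zero])
  rw [Polynomial.eval_mul] at ht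
  exact ⟨t, by rw [← eval_det_add_smul]; exact left_ne_zero_of_mul ht,
    by rw [← eval_det_add_smul]; exact right_ne_zero_of_mul ht⟩

/-- For the Cayley transform k = (1 - X)⁻¹(1 + X), the last determinant is det(1 - X) det(k + g).
Its nonvanishing says that k⁻¹g does not have the eigenvalue -1 and so is again a Cayley transform.
The element X comes from the Lagrangian pair J(1 + g), 1 - g. -/
lemma exists_cayley (g : Sp n) : ∃ X : Mat n, sadj X = -X ∧ (1 - X).det ≠ 0 ∧
    ((1 + X) + (1 - X) * (g : Mat n)).det ≠ 0 := by
  have hg : (g : Mat n)ᵀ * J (Fin n) ℂ * (g : Mat n) = J (Fin n) ℂ := SymplecticGroup.mem_iff'.1 g.2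
  have hJ := J_squared (Fin n) ℂ
  obtain ⟨s, hs, hsu⟩ := exists_isSymm_isUnit_add_mul
    (A := J (Fin n) ℂ * (1 + (g : Mat n))) (C := 1 - (g : Mat n)) (by
      intro x h1 h2
      have h3 : (1 + (g : Mat n)) *ᵥ x = 0 := by
        have := congrArg (J (Fin n) ℂ *ᵥ ·) h1
        simp only [Matrix.mulVec_mulVec, ← Matrix.mul_assoc, hJ] at this
        rw [Matrix.neg_mul, Matrix.one_mul, Matrix.neg_mulVec, Matrix.mulVec_zero] at this
        exact neg_eq_zero.1 this
      have h4 : (2 : ℂ) • x = 0 := by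
        have : ((1 + (g : Mat n)) + (1 - (g : Mat n))) *ᵥ x = 0 := by
          rw [Matrix.add_mulVec, h3, h2, add_zero]
        rw [show (1 + (g : Mat n)) + (1 - (g : Mat n)) = (2 : ℂ) • 1 by rw [two_smul]; abel,
          Matrix.smul_mulVec, Matrix.one_mulVec] at this
        exact this
      exact (smul_eq_zero.1 h4).resolve_left two_ne_zero) (by
      rw [transpose_mul, transpose_add, transpose_sub, J_transpose, transpose_one]
      have : (1 + (g : Mat n)ᵀ) * -J (Fin n) ℂ * (1 - (g : Mat n)) -
          (1 - (g : Mat n)ᵀ) * (J (Fin n) ℂ * (1 + (g : Mat n))) =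
          (2 : ℂ) • ((g : Mat n)ᵀ * J (Fin n) ℂ * (g : Mat n) - J (Fin n) ℂ) := by
        rw [two_smul]
        noncomm_ring
      rw [hg, sub_self, smul_zero] at this
      exact sub_eq_zero.1 this)
  set X0 : Mat n := -J (Fin n) ℂ * s with hX0
  have hX0s : sadj X0 = - X0 := by
    rw [sadj, hX0, transpose_mul, transpose_neg, J_transpose, hs.eq]
    simp only [Matrix.mul_assoc, neg_neg, hJ]
    simp
  have h1 : J (Fin n) ℂ * (1 + (g : Mat n)) + s * (1 - (g : Mat n)) =
      J (Fin n) ℂ * ((1 + (g : Mat n)) + X0 * (1 - (g : Mat n))) := by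
    rw [hX0, Matrix.mul_add (J (Fin n) ℂ) (1 + (g : Mat n)), Matrix.mul_assoc (-J (Fin n) ℂ),
      ← Matrix.mul_assoc (J (Fin n) ℂ) (-J (Fin n) ℂ), Matrix.mul_neg, hJ, neg_neg, Matrix.one_mul]
  rw [h1, Matrix.isUnit_iff_isUnit_det, Matrix.det_mul] at hsu
  have h2 := isUnit_of_mul_isUnit_right hsu
  -- Invertibility of 1 - tX₀ is clear at t = 0 and that of the second matrix was arranged at t = 1.
  -- Two nonzero polynomials in t have a common point of nonvanishing.
  obtain ⟨t, ht, ht'⟩ := exists_common_unit 1 (-X0) (1 + (g : Mat n)) (X0 * (1 - (g : Mat n))) 0 1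
    (by simp) (by rw [one_smul]; exact h2.ne_zero)
  refine ⟨t • X0, by rw [sadj_smul, hX0s, smul_neg], ?_, ?_⟩
  · rwa [sub_eq_add_neg, ← smul_neg]
  · convert! ht' using 2
    simp only [Matrix.sub_mul, Matrix.mul_sub, Matrix.smul_mul, Matrix.one_mul, Matrix.mul_one,
      smul_sub]
    abel

lemma cayley_mem {X : Mat n} (hX : sadj X = -X) (h : (1 - X).det ≠ 0) :
    (1 - X)⁻¹ * (1 + X) ∈ symplecticGroup (Fin n) ℂ := by
  have hu : IsUnit (1 - X).det := h.isUnit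
  rw [mem_symplectic_iff]
  have h1 : sadj (1 - X)⁻¹ * (1 + X) = 1 := by
    have : sadj ((1 - X) * (1 - X)⁻¹) = 1 := by rw [Matrix.mul_nonsing_inv _ hu, sadj_one]
    rwa [sadj_mul, sadj_sub, sadj_one, hX, sub_neg_eq_add] at this
  have h2 := mul_eq_one_comm.1 h1
  rw [sadj_mul, sadj_add, sadj_one, hX, ← sub_eq_add_neg]
  calc (1 - X)⁻¹ * (1 + X) * ((1 - X) * sadj (1 - X)⁻¹)
      = (1 - X)⁻¹ * ((1 + X) * (1 - X)) * sadj (1 - X)⁻¹ := by simp only [Matrix.mul_assoc]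
    _ = (1 - X)⁻¹ * ((1 - X) * (1 + X)) * sadj (1 - X)⁻¹ := by
        congr 2; noncomm_ring
    _ = ((1 - X)⁻¹ * (1 - X)) * ((1 + X) * sadj (1 - X)⁻¹) := by simp only [Matrix.mul_assoc]
    _ = 1 := by rw [h2, Matrix.nonsing_inv_mul _ hu, Matrix.one_mul]

/-- The inverse Cayley transform is X = (k - 1)(k + 1)⁻¹. -/
lemma exists_eq_cayley {k : Mat n} (hk : k * sadj k = 1) (h : (1 + k).det ≠ 0) :
    ∃ X : Mat n, sadj X = -X ∧ (1 - X).det ≠ 0 ∧ (1 - X)⁻¹ * (1 + X) = k := by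
  have hu : IsUnit (1 + k).det := h.isUnit
  have h1 := Matrix.mul_nonsing_inv _ hu
  have h2 := Matrix.nonsing_inv_mul _ hu
  set R := (1 + k)⁻¹
  have e1 : 1 - (k - 1) * R = (2 : ℂ) • R := by
    calc 1 - (k - 1) * R = (1 + k) * R - (k - 1) * R := by rw [h1]
      _ = _ := by rw [two_smul]; noncomm_ring
  have e2 : 1 + (k - 1) * R = (2 : ℂ) • (k * R) := by
    calc 1 + (k - 1) * R = (1 + k) * R + (k - 1) * R := by rw [h1]
      _ = _ := by rw [two_smul]; noncomm_ring
  have hcomm : k * R = R * k := by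
    have : R * ((1 + k) * k) * R = R * (k * (1 + k)) * R := by congr 2; noncomm_ring
    calc k * R = (R * (1 + k)) * k * R := by rw [h2, Matrix.one_mul]
      _ = R * k * ((1 + k) * R) := by simpa only [Matrix.mul_assoc] using this
      _ = R * k := by rw [h1, Matrix.mul_one]
  have hdet : (1 - (k - 1) * R).det ≠ 0 := by
    rw [e1, Matrix.det_smul]
    refine mul_ne_zero (pow_ne_zero _ two_ne_zero) fun h0 => ?_
    have := congrArg Matrix.det h1
    rw [Matrix.det_mul, h0, mul_zero, Matrix.det_one] at this
    exact zero_ne_one this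
  refine ⟨(k - 1) * R, ?_, hdet, ?_⟩
  · have hk' := mul_eq_one_comm.1 hk
    have h3 : sadj R * (1 + sadj k) = 1 := by
      have := congrArg sadj h1
      rwa [sadj_mul, sadj_add, sadj_one] at this
    have h5 : sadj R = k * R := by
      calc sadj R = sadj R * ((1 + k) * R) := by rw [h1, Matrix.mul_one]
        _ = sadj R * ((1 + sadj k) * k * R) := by
            congr 2
            rw [Matrix.add_mul, hk', Matrix.one_mul, add_comm]
        _ = (sadj R * (1 + sadj k)) * (k * R) := by simp only [Matrix.mul_assoc]
        _ = k * R := by rw [h3, Matrix.one_mul]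
    rw [sadj_mul, sadj_sub, sadj_one, h5, Matrix.mul_sub, hcomm, Matrix.mul_assoc, hk,
      Matrix.sub_mul, hcomm]
    simp
  · rw [e1, e2, show (2 : ℂ) • (k * R) = ((2 : ℂ) • R) * k by rw [hcomm, Matrix.smul_mul],
      ← Matrix.mul_assoc, Matrix.nonsing_inv_mul, Matrix.one_mul]
    rw [← e1]
    exact hdet.isUnit

/-- The point of affine space whose coordinates are the entries of two matrices. -/
def pt {E : Type*} (g Y : Matrix (Fin n ⊕ Fin n) (Fin n ⊕ Fin n) E) :
    ((Fin n ⊕ Fin n) × (Fin n ⊕ Fin n)) ⊕ ((Fin n ⊕ Fin n) × (Fin n ⊕ Fin n)) → E :=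
  Sum.elim (fun ij => g ij.1 ij.2) fun ij => Y ij.1 ij.2

/-- Polynomials in the entries of two matrices. -/
abbrev Poly (n : ℕ) : Type := MvPolynomial
  (((Fin n ⊕ Fin n) × (Fin n ⊕ Fin n)) ⊕ ((Fin n ⊕ Fin n) × (Fin n ⊕ Fin n))) ℂ

/-- Along a curve whose coordinates are fractions with denominators powers of D, every polynomial
function is such a fraction. -/
lemma exists_clear_denominator {ι : Type*} (D : Polynomial ℂ) (v : ℂ → ι → ℂ)
    (hv : ∀ i, ∃ (p : Polynomial ℂ) (m : ℕ), ∀ t, D.eval t ≠ 0 → v t i * D.eval t ^ m = p.eval t)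
    (F : MvPolynomial ι ℂ) : ∃ (p : Polynomial ℂ) (m : ℕ), ∀ t, D.eval t ≠ 0 →
      MvPolynomial.eval (v t) F * D.eval t ^ m = p.eval t := by
  induction F using MvPolynomial.induction_on with
  | C a => exact ⟨Polynomial.C a, 0, fun t _ => by simp⟩
  | add F G hF hG =>
    obtain ⟨p, m, hp⟩ := hF
    obtain ⟨q, k, hq⟩ := hG
    refine ⟨p * D ^ k + q * D ^ m, m + k, fun t ht => ?_⟩
    simp only [map_add, Polynomial.eval_add, Polynomial.eval_mul, Polynomial.eval_pow, ← hp t ht,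
      ← hq t ht]
    ring
  | mul_X F i hF =>
    obtain ⟨p, m, hp⟩ := hF
    obtain ⟨q, k, hq⟩ := hv i
    refine ⟨p * q, m + k, fun t ht => ?_⟩
    simp only [map_mul, MvPolynomial.eval_X, Polynomial.eval_mul, ← hp t ht, ← hq t ht]
    ring

/-- The product of `Sp(2n)` with an affine space is irreducible. -/
theorem irreducible_symplectic_prod (W : Set (Mat n))
    (hW : ∀ Y ∈ W, ∀ Y' ∈ W, ∀ t : ℂ, Y + t • (Y' - Y) ∈ W) (F F' : Poly n)
    (h : ∀ g : Sp n, ∀ Y ∈ W, MvPolynomial.eval (pt (g : Mat n) Y) F *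
      MvPolynomial.eval (pt (g : Mat n) Y) F' = 0) :
    (∀ g : Sp n, ∀ Y ∈ W, MvPolynomial.eval (pt (g : Mat n) Y) F = 0) ∨
      (∀ g : Sp n, ∀ Y ∈ W, MvPolynomial.eval (pt (g : Mat n) Y) F' = 0) := by
  by_contra! hc
  obtain ⟨⟨g₁, Y₁, hY₁, h₁⟩, g₂, Y₂, hY₂, h₂⟩ := hc
  -- The choice of k places both g₁ and g₂ in the translate by g₁k of the image of the Cayley map.
  -- There the segment from X₁ to X₂ gives a rational curve in Sp(2n) joining them.
  obtain ⟨X, hX, hXd, hXg⟩ := exists_cayley (g₁⁻¹ * g₂)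
  have hXu : IsUnit (1 - X).det := hXd.isUnit
  set k : Sp n := ⟨_, cayley_mem hX hXd⟩ with hk
  have hkX : (1 - X) * (k : Mat n) = 1 + X := by
    rw [hk, ← Matrix.mul_assoc, Matrix.mul_nonsing_inv _ hXu, Matrix.one_mul]
  have hdet : ∀ g : Sp n, ((1 + X) + (1 - X) * (g : Mat n)).det ≠ 0 →
      (1 + ((k⁻¹ * g : Sp n) : Mat n)).det ≠ 0 := by
    intro g hg h0
    apply hg
    have : (1 + X) + (1 - X) * (g : Mat n) =
        (1 - X) * (k : Mat n) * (1 + ((k⁻¹ * g : Sp n) : Mat n)) := by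
      have e : (k : Mat n) * ((k⁻¹ * g : Sp n) : Mat n) = g := by
        rw [← Submonoid.coe_mul, mul_inv_cancel_left]
      rw [Matrix.mul_add, Matrix.mul_one, hkX, ← hkX, Matrix.mul_assoc, e]
    rw [this, Matrix.det_mul, h0, mul_zero]
  have hc₁ := exists_eq_cayley (mul_sadj (k⁻¹ * 1)) (hdet 1 (by
    rw [Submonoid.coe_one, Matrix.mul_one, show (1 + X) + (1 - X) = (2 : ℂ) • 1 by
      rw [two_smul]; abel, Matrix.det_smul, Matrix.det_one, mul_one]
    exact pow_ne_zero _ two_ne_zero))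
  have hc₂ := exists_eq_cayley (mul_sadj (k⁻¹ * (g₁⁻¹ * g₂))) (hdet _ hXg)
  obtain ⟨X₁, hX₁, hd₁, hX₁k⟩ := hc₁
  obtain ⟨X₂, hX₂, hd₂, hX₂k⟩ := hc₂
  set D : Polynomial ℂ := Matrix.det ((1 - X₁).map Polynomial.C +
    (Polynomial.X : Polynomial ℂ) • (X₁ - X₂).map Polynomial.C) with hDdef
  have hDe : ∀ t, D.eval t = (1 - (X₁ + t • (X₂ - X₁))).det := fun t => by
    rw [hDdef, eval_det_add_smul]
    congr 1
    rw [smul_sub, smul_sub]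
    abel
  have hD0 : D ≠ 0 := fun e => hd₁ (by
    have := hDe 0
    rw [e, Polynomial.eval_zero, zero_smul, add_zero] at this
    exact this.symm)
  set h₀ : Mat n := ((g₁ * k : Sp n) : Mat n) with hh₀
  set v : ℂ → _ → ℂ := fun t =>
    pt (h₀ * ((1 - (X₁ + t • (X₂ - X₁)))⁻¹ * (1 + (X₁ + t • (X₂ - X₁))))) (Y₁ + t • (Y₂ - Y₁))
    with hv
  have hvr : ∀ i, ∃ (p : Polynomial ℂ) (m : ℕ), ∀ t, D.eval t ≠ 0 →
      v t i * D.eval t ^ m = p.eval t := by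
    rintro (ij | ij)
    · set A : Matrix (Fin n ⊕ Fin n) (Fin n ⊕ Fin n) (Polynomial ℂ) :=
        X₁.map Polynomial.C + (Polynomial.X : Polynomial ℂ) • (X₂ - X₁).map Polynomial.C with hA
      have hAe : ∀ t, A.map (Polynomial.evalRingHom t) = X₁ + t • (X₂ - X₁) := fun t => by
        ext i j
        simp [hA, mul_comm t]
      clear_value A
      refine ⟨(h₀.map Polynomial.C * ((1 - A).adjugate * (1 + A))) ij.1 ij.2, 1, fun t ht => ?_⟩
      have e1 : (Polynomial.evalRingHom t).mapMatrix
            (h₀.map Polynomial.C * ((1 - A).adjugate * (1 + A)))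
          = h₀ * ((1 - (X₁ + t • (X₂ - X₁))).adjugate * (1 + (X₁ + t • (X₂ - X₁)))) := by
        have hAe' : (Polynomial.evalRingHom t).mapMatrix A = X₁ + t • (X₂ - X₁) := hAe t
        rw [map_mul, map_mul, RingHom.map_adjugate, map_sub, map_add, map_one, hAe']
        congr 1
        ext i j
        simp
      have e2 := congrFun (congrFun e1 ij.1) ij.2
      rw [RingHom.mapMatrix_apply, Matrix.map_apply, Polynomial.coe_evalRingHom] at e2
      rw [e2, hv]
      simp only [pt, Sum.elim_inl, pow_one]
      rw [Matrix.inv_def, ← hDe, Ring.inverse_eq_inv', Matrix.smul_mul, Matrix.mul_smul,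
        Matrix.smul_apply, smul_eq_mul]
      field_simp
    · refine ⟨Polynomial.C (Y₁ ij.1 ij.2) + Polynomial.X *
        Polynomial.C (Y₂ ij.1 ij.2 - Y₁ ij.1 ij.2), 0, fun t _ => ?_⟩
      simp [hv, pt]
  obtain ⟨p, m, hp⟩ := exists_clear_denominator D v hvr F
  obtain ⟨q, l, hq⟩ := exists_clear_denominator D v hvr F'
  -- The factor D disposes of the parameters at which the curve is undefined. After that, ℂ[t] being
  -- a domain decides which of F, F' vanishes along the curve.
  have hzero : D * (p * q) = 0 := by
    refine Polynomial.funext fun t => ?_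
    rw [Polynomial.eval_mul, Polynomial.eval_mul, Polynomial.eval_zero]
    by_cases ht : D.eval t = 0
    · rw [ht, zero_mul]
    have hmem : (1 - (X₁ + t • (X₂ - X₁)))⁻¹ * (1 + (X₁ + t • (X₂ - X₁))) ∈
        symplecticGroup (Fin n) ℂ := by
      refine cayley_mem ?_ (by rwa [← hDe])
      rw [sadj_add, sadj_smul, sadj_sub, hX₁, hX₂, neg_add, ← smul_neg]
      congr 2
      abel
    have := h (g₁ * k * ⟨_, hmem⟩) _ (hW _ hY₁ _ hY₂ t)
    rw [← hp t ht, ← hq t ht]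
    have hvt : v t = pt ((g₁ * k * ⟨_, hmem⟩ : Sp n) : Mat n) (Y₁ + t • (Y₂ - Y₁)) := rfl
    rw [hvt]
    linear_combination (D.eval t ^ (m + l + 1)) * this
  have hpq := (mul_eq_zero.1 hzero).resolve_left hD0
  have ev₀ : v 0 = pt (g₁ : Mat n) Y₁ := by
    simp only [hv, zero_smul, add_zero]
    rw [hX₁k, hh₀, ← Submonoid.coe_mul, mul_one, mul_inv_cancel_right]
  have ev₁ : v 1 = pt (g₂ : Mat n) Y₂ := by
    simp only [hv, one_smul, add_sub_cancel]
    rw [hX₂k, hh₀, ← Submonoid.coe_mul]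
    congr 2
    group
  rcases mul_eq_zero.1 hpq with h0 | h0
  · have hD₀ : D.eval 0 ≠ 0 := by rw [hDe]; simpa using hd₁
    have := hp 0 hD₀
    rw [h0, Polynomial.eval_zero, ev₀] at this
    exact mul_ne_zero h₁ (pow_ne_zero _ hD₀) this
  · have hD₁ : D.eval 1 ≠ 0 := by rw [hDe]; simpa using hd₂
    have := hq 1 hD₁
    rw [h0, Polynomial.eval_zero, ev₁] at this
    exact mul_ne_zero h₂ (pow_ne_zero _ hD₁) this

end Irreducible

/-! ### Root vectors and the description of `[𝔭,𝔭]^⊥` -/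

section RootVectors

variable {n : ℕ}

/-- Twice the projection of a matrix to `𝔰𝔭(2n)`. -/
def toSp (M : Mat n) : Mat n := M - sadj M

lemma sadj_toSp (M : Mat n) : sadj (toSp M) = -toSp M := by
  simp [toSp]

lemma toSp_mem (M : Mat n) : toSp M ∈ sp n := (mem_sp_iff _).2 (sadj_toSp M)

lemma toSp_smul (c : ℂ) (M : Mat n) : toSp (c • M) = c • toSp M := by
  simp [toSp, smul_sub]

lemma toSp_sum {ι : Type*} (s : Finset ι) (M : ι → Mat n) :
    toSp (∑ i ∈ s, M i) = ∑ i ∈ s, toSp (M i) := by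
  classical
  induction s using Finset.induction_on with
  | empty => simp [toSp, sadj]
  | insert a s ha ih =>
    rw [Finset.sum_insert ha, Finset.sum_insert ha, ← ih]
    simp only [toSp, sadj_add]
    abel

lemma toSp_of_sadj {Y : Mat n} (hY : sadj Y = -Y) : toSp Y = (2 : ℂ) • Y := by
  rw [toSp, hY, sub_neg_eq_add, two_smul]

lemma trace_mul_toSp {Y : Mat n} (hY : sadj Y = -Y) (M : Mat n) :
    trace (Y * toSp M) = 2 * trace (Y * M) := by
  have h : trace (Y * sadj M) = - trace (Y * M) := by
    rw [← trace_sadj, sadj_mul, sadj_sadj, hY, Matrix.mul_neg, trace_neg, Matrix.trace_mul_comm]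
  rw [toSp, Matrix.mul_sub, trace_sub, h]
  ring

lemma lie_toSp {N : Mat n} (hN : sadj N = -N) (M : Mat n) : ⁅toSp M, N⁆ = toSp ⁅M, N⁆ := by
  simp only [Ring.lie_def, toSp, sadj_sub, sadj_mul, hN]
  noncomm_ring

/-- Root vectors (and coroots) of `𝔰𝔭(2n)`. -/
def rootVec (i j : Fin n ⊕ Fin n) : Mat n := toSp (Matrix.single i j 1)

lemma sadj_single (i j : Fin n ⊕ Fin n) :
    sadj (Matrix.single i j (1 : ℂ)) = Matrix.single j.swap i.swap (sg ℂ i * sg ℂ j) := by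
  ext k l
  rw [sadj_apply, Matrix.single_apply, Matrix.single_apply]
  by_cases h1 : j = k.swap
  · by_cases h2 : i = l.swap
    · subst h1 h2
      simp only [Sum.swap_swap, and_self, if_true, sg_swap]
      ring
    · have h3 : ¬ i.swap = l := fun e => h2 (by rw [← e, Sum.swap_swap])
      simp [h2, h3]
  · have h3 : ¬ j.swap = k := fun e => h1 (by rw [← e, Sum.swap_swap])
    simp [h1, h3]

lemma rootVec_apply_eq_zero (d : Fin n → ℤ) {i j k l : Fin n ⊕ Fin n}
    (h : wt d k - wt d l ≠ wt d i - wt d j) : rootVec i j k l = 0 := by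
  rw [rootVec, toSp, sadj_single, Matrix.sub_apply, Matrix.single_apply, Matrix.single_apply,
    if_neg, if_neg, sub_zero]
  · rintro ⟨rfl, rfl⟩
    apply h
    simp only [wt_swap]
    ring
  · rintro ⟨rfl, rfl⟩
    exact h rfl

lemma rootVec_mem_parabolicAlg (d : Fin n → ℤ) {i j : Fin n ⊕ Fin n} (h : wt d j ≤ wt d i) :
    rootVec i j ∈ parabolicAlg d :=
  ⟨toSp_mem _, fun k l hkl => rootVec_apply_eq_zero d (by omega)⟩

lemma rootVec_mem_levi (d : Fin n → ℤ) {i j : Fin n ⊕ Fin n} (h : wt d i = wt d j) :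
    rootVec i j ∈ levi d :=
  ⟨toSp_mem _, fun k l hkl => rootVec_apply_eq_zero d (by omega)⟩

/-- The weights of a diagonal matrix. -/
def cwt (x : Fin n → ℂ) : Fin n ⊕ Fin n → ℂ := Sum.elim x fun i => -x i

lemma cwt_swap (x : Fin n → ℂ) (i : Fin n ⊕ Fin n) : cwt x i.swap = - cwt x i := by
  rcases i with i | i <;> simp [cwt]

lemma sadj_cartan (x : Fin n → ℂ) : sadj (cartan x) = - cartan x := by
  ext i j
  rw [sadj_apply, cartan, Matrix.neg_apply, Matrix.diagonal_apply, Matrix.diagonal_apply]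
  by_cases h : i = j
  · subst h
    rw [if_pos rfl, if_pos rfl, sg_mul_self, one_mul]
    exact cwt_swap x i
  · have h' : j.swap ≠ i.swap := fun e => h (by simpa using (congrArg Sum.swap e).symm)
    rw [if_neg h, if_neg h', mul_zero, neg_zero]

lemma cartan_mem_levi (d : Fin n → ℤ) (x : Fin n → ℂ) : cartan x ∈ levi d :=
  ⟨(mem_sp_iff _).2 (sadj_cartan x), fun i j h =>
    Matrix.diagonal_apply_ne _ fun e => h (by rw [e])⟩

lemma levi_mem_parabolicAlg {d : Fin n → ℤ} {Z : Mat n} (hZ : Z ∈ levi d) : Z ∈ parabolicAlg d :=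
  ⟨hZ.1, fun i j h => hZ.2 i j h.ne⟩

lemma lie_cartan_rootVec (x : Fin n → ℂ) (i j : Fin n ⊕ Fin n) :
    ⁅cartan x, rootVec i j⁆ = (cwt x i - cwt x j) • rootVec i j := by
  rw [← lie_skew, rootVec, lie_toSp (sadj_cartan x), ← toSp_smul]
  have : -⁅(Matrix.single i j (1 : ℂ) : Mat n), cartan x⁆ =
      (cwt x i - cwt x j) • Matrix.single i j (1 : ℂ) := by
    ext k l
    rw [Ring.lie_def, Matrix.neg_apply, Matrix.sub_apply, cartan, Matrix.mul_diagonal,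
      Matrix.diagonal_mul, Matrix.smul_apply, Matrix.single_apply, smul_eq_mul]
    by_cases h : i = k ∧ j = l
    · obtain ⟨rfl, rfl⟩ := h
      simp [cwt]
    · simp [h]
  rw [← this, toSp, toSp, sadj_neg]
  abel

/-- For the long roots, j = i.swap, the two halves of `rootVec` coincide and it equals 2E_ij. This
accounts for the factor 2. -/
lemma lie_rootVec_rootVec {i j : Fin n ⊕ Fin n} (hij : i ≠ j) :
    ⁅rootVec i j, rootVec j i⁆ = (if j = i.swap then (2 : ℂ) else 1) •
      (rootVec i i - rootVec j j) := by
  have h0 : (rootVec i i - rootVec j j : Mat n) =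
      toSp (Matrix.single i i 1 - Matrix.single j j 1) := by
    simp only [rootVec, toSp, sadj_sub]
    abel
  rw [h0, ← toSp_smul, rootVec, lie_toSp (N := rootVec j i) (sadj_toSp _)]
  congr 1
  rw [rootVec, toSp, sadj_single, Ring.lie_def]
  split_ifs with h
  · subst h
    have e : -Matrix.single i.swap i.swap.swap (sg ℂ i.swap * sg ℂ i) =
        (Matrix.single i.swap i 1 : Mat n) := by
      rw [sg_swap, neg_mul, sg_mul_self, Sum.swap_swap, ← Matrix.single_neg, neg_neg]
    rw [sub_eq_add_neg (Matrix.single i.swap i 1), e]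
    simp only [Matrix.mul_add, Matrix.add_mul, Matrix.single_mul_single_same, mul_one, two_smul]
    abel
  · have h' : i.swap ≠ j := fun e => h e.symm
    have h'' : j.swap ≠ i := fun e => h (by rw [← e, Sum.swap_swap])
    rw [Matrix.mul_sub, Matrix.sub_mul, Matrix.single_mul_single_same,
      Matrix.single_mul_single_same, Matrix.single_mul_single_of_ne _ _ _ _ h'.symm,
      Matrix.single_mul_single_of_ne _ _ _ _ h'']
    simp

/-- By invariance the trace is that of [Y,Z]Z'. Modulo 𝔲 the matrix Y acts on each weight space as a
scalar, so [Y,Z] vanishes wherever wt i ≤ wt j and pairs to zero with 𝔭. -/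
lemma IsComm.trace_mul_lie {d : Fin n → ℤ} {Y Z Z' : Mat n} (hY : IsComm d Y)
    (hZ : IsPar d Z) (hZ' : IsPar d Z') : trace (Y * ⁅Z, Z'⁆) = 0 := by
  have h1 : IsPar d (1 : Mat n) := fun i j h => Matrix.one_apply_ne fun e => by simp [e] at h
  have e : trace (Y * ⁅Z, Z'⁆) = trace ((Y * Z - Z * Y) * Z') := by
    rw [Ring.lie_def, Matrix.mul_sub, Matrix.sub_mul, trace_sub, trace_sub, ← Matrix.mul_assoc,
      ← Matrix.mul_assoc Y, Matrix.mul_assoc Z, Matrix.trace_mul_comm Z, Matrix.mul_assoc Y Z' Z]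
  rw [e, Matrix.trace]
  refine Finset.sum_eq_zero fun i _ => ?_
  rw [Matrix.diag_apply, Matrix.mul_apply]
  refine Finset.sum_eq_zero fun j _ => ?_
  rcases le_or_gt (wt d i) (wt d j) with h | h
  · have e1 := hY.conj_apply h1 hZ h
    have e2 := hY.conj_apply hZ h1 h
    rw [Matrix.one_mul, Matrix.one_mul] at e1
    rw [Matrix.mul_one, Matrix.mul_one] at e2
    rw [Matrix.sub_apply, e1, e2, sub_self, zero_mul]
  · rw [hZ' j i h, mul_zero]

/-- A diagonal matrix with distinct eigenvalues. -/
def regularPt (n : ℕ) : Fin n → ℂ := fun i => (i : ℂ) + 1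

lemma cwt_regularPt_injective : Function.Injective (cwt (regularPt n)) := by
  rintro (i | i) (j | j) h <;> simp only [cwt, regularPt, Sum.elim_inl, Sum.elim_inr] at h
  · have : (i : ℂ) = j := by linear_combination h
    exact congrArg _ (Fin.ext (by exact_mod_cast this))
  · have : ((i + j + 2 : ℕ) : ℂ) = 0 := by push_cast; linear_combination h
    exact absurd this (Nat.cast_ne_zero.2 (Nat.succ_ne_zero _))
  · have : ((i + j + 2 : ℕ) : ℂ) = 0 := by push_cast; linear_combination -h
    exact absurd this (Nat.cast_ne_zero.2 (Nat.succ_ne_zero _))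
  · have : (i : ℂ) = j := by linear_combination -h
    exact congrArg _ (Fin.ext (by exact_mod_cast this))

lemma trace_mul_rootVec {Y : Mat n} (hY : sadj Y = -Y) (i j : Fin n ⊕ Fin n) :
    trace (Y * rootVec i j) = 2 * Y j i := by
  rw [rootVec, trace_mul_toSp hY, Matrix.trace_mul_single]
  simp

/-- Testing Y on brackets of a regular element of 𝔥 with root vectors of 𝔭 kills the off-diagonal
entries with wt i ≤ wt j. Testing it on brackets of opposite root vectors of 𝔩 equates the diagonal
entries of equal weight. -/
theorem mem_commPerp_iff {d : Fin n → ℤ} {Y : Mat n} : Y ∈ commPerp d ↔ IsComm d Y := by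
  constructor
  · rintro ⟨hs, h⟩
    have hsk := (mem_sp_iff _).1 hs
    refine ⟨hsk, fun i j hij hne => ?_, fun i j hij => ?_⟩
    · have h1 := h _ (levi_mem_parabolicAlg (cartan_mem_levi d (regularPt n))) _
        (rootVec_mem_parabolicAlg d hij)
      rw [lie_cartan_rootVec, Matrix.mul_smul, trace_smul, trace_mul_rootVec hsk, smul_eq_mul] at h1
      have h2 : cwt (regularPt n) j - cwt (regularPt n) i ≠ 0 :=
        sub_ne_zero.2 fun e => hne (cwt_regularPt_injective e).symm
      simpa [h2] using h1
    · by_cases hne : i = j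
      · rw [hne]
      have h1 := h _ (rootVec_mem_parabolicAlg d hij.ge) _ (rootVec_mem_parabolicAlg d hij.le)
      rw [lie_rootVec_rootVec hne, Matrix.mul_smul, trace_smul, Matrix.mul_sub, trace_sub,
        trace_mul_rootVec hsk, trace_mul_rootVec hsk, smul_eq_mul] at h1
      have h2 : (if j = i.swap then (2 : ℂ) else 1) ≠ 0 := by split_ifs <;> norm_num
      have h3 := (mul_eq_zero.1 h1).resolve_left h2
      linear_combination h3 / 2
  · intro h
    exact ⟨(mem_sp_iff _).2 h.skew, fun Z hZ Z' hZ' => h.trace_mul_lie hZ.2 hZ'.2⟩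

lemma IsComm.add_smul_sub {d : Fin n → ℤ} {Y Y' : Mat n} (hY : IsComm d Y) (hY' : IsComm d Y')
    (t : ℂ) : IsComm d (Y + t • (Y' - Y)) := by
  refine ⟨?_, fun i j h hij => ?_, fun i j h => ?_⟩
  · rw [sadj_add, sadj_smul, sadj_sub, hY.skew, hY'.skew, neg_add, ← smul_neg]
    congr 2
    abel
  · simp [hY.zero i j h hij, hY'.zero i j h hij]
  · simp [hY.diag i j h, hY'.diag i j h]

lemma nilradical_isComm {d : Fin n → ℤ} {Y : Mat n} (hY : Y ∈ nilradical d) : IsComm d Y :=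
  ⟨(mem_sp_iff _).1 hY.1, fun i j h _ => hY.2 i j h, fun i j _ => by
    rw [hY.2 i i le_rfl, hY.2 j j le_rfl]⟩

/-- The identity matrix as a combination of projections: every `Z ∈ 𝔰𝔭` is a combination of
root vectors. -/
lemma two_smul_eq_sum_rootVec {Z : Mat n} (hZ : sadj Z = -Z) :
    (2 : ℂ) • Z = ∑ i, ∑ j, Z i j • rootVec i j := by
  rw [← toSp_of_sadj hZ]
  conv_lhs => rw [Matrix.matrix_eq_sum_single Z]
  rw [toSp_sum]
  refine Finset.sum_congr rfl fun i _ => ?_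
  rw [toSp_sum]
  refine Finset.sum_congr rfl fun j _ => ?_
  rw [rootVec, ← toSp_smul, Matrix.smul_single, smul_eq_mul, mul_one]

end RootVectors

/-! ### Explicit symplectic matrices -/

section Explicit

variable {n : ℕ} {E : Type*} [CommRing E]

/-- The image of `SL₂ⁿ` in `Sp(2n)`. -/
def blockSL (a b c e : Fin n → E) : Matrix (Fin n ⊕ Fin n) (Fin n ⊕ Fin n) E :=
  fromBlocks (diagonal a) (diagonal b) (diagonal c) (diagonal e)

lemma blockSL_mem {a b c e : Fin n → E} (h : ∀ i, a i * e i - b i * c i = 1) :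
    blockSL a b c e ∈ symplecticGroup (Fin n) E := by
  rw [blockSL, SymplecticGroup.fromBlocks_mem_iff]
  simp only [diagonal_transpose, diagonal_mul_diagonal]
  refine ⟨by simp only [mul_comm], by simp only [mul_comm], ?_⟩
  rw [Matrix.diagonal_sub, ← diagonal_one]
  congr 1
  ext i
  linear_combination h i

/-- The image of `GLₙ` in `Sp(2n)`. -/
def blockGL (A B : Matrix (Fin n) (Fin n) E) : Matrix (Fin n ⊕ Fin n) (Fin n ⊕ Fin n) E :=
  fromBlocks A 0 0 Bᵀ

lemma blockGL_mem {A B : Matrix (Fin n) (Fin n) E} (h : A * B = 1) :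
    blockGL A B ∈ symplecticGroup (Fin n) E := by
  rw [blockGL, SymplecticGroup.fromBlocks_mem_iff]
  simp only [mul_zero, zero_mul, transpose_zero, sub_zero, true_and]
  rw [← transpose_mul, mul_eq_one_comm.1 h, transpose_one]

/-- The element of the Weyl group which makes the cocharacter `d` dominant. -/
def signSwap (E : Type*) [CommRing E] (d : Fin n → ℤ) :
    Matrix (Fin n ⊕ Fin n) (Fin n ⊕ Fin n) E :=
  blockSL (fun i => if d i < 0 then 0 else 1) (fun i => if d i < 0 then -1 else 0)
    (fun i => if d i < 0 then 1 else 0) (fun i => if d i < 0 then 0 else 1)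

lemma signSwap_mem (d : Fin n → ℤ) : signSwap E d ∈ symplecticGroup (Fin n) E :=
  blockSL_mem fun i => by split_ifs <;> simp

/-- The permutation of the basis vectors underlying `signSwap`. -/
def swapIdx (d : Fin n → ℤ) : Fin n ⊕ Fin n → Fin n ⊕ Fin n :=
  Sum.elim (fun i => if d i < 0 then Sum.inr i else Sum.inl i)
    (fun i => if d i < 0 then Sum.inl i else Sum.inr i)

lemma wt_abs_swapIdx (d : Fin n → ℤ) (i) : wt (fun i => |d i|) (swapIdx d i) = wt d i := by
  rcases i with i | i <;> by_cases h : d i < 0 <;>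
    simp [swapIdx, wt, h, abs_of_neg, abs_of_nonneg, not_lt.1]

lemma signSwap_apply_eq_zero (d : Fin n → ℤ) {i j : Fin n ⊕ Fin n} (h : j ≠ swapIdx d i) :
    signSwap E d i j = 0 := by
  rcases i with i | i <;> rcases j with j | j <;> by_cases hij : i = j <;>
    by_cases hd : d i < 0 <;>
    simp_all [swapIdx, signSwap, blockSL, not_lt.2]

lemma signSwap_conj_eq_zero {d : Fin n → ℤ}
    {N : Matrix (Fin n ⊕ Fin n) (Fin n ⊕ Fin n) E} {i j : Fin n ⊕ Fin n}
    (h : N (swapIdx d i) (swapIdx d j) = 0) :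
    (signSwap E d * N * sadj (signSwap E d)) i j = 0 := by
  rw [Matrix.mul_apply]
  refine Finset.sum_eq_zero fun k _ => ?_
  by_cases hk : k = swapIdx d j
  · rw [Matrix.mul_apply, Finset.sum_eq_zero, zero_mul]
    intro l _
    by_cases hl : l = swapIdx d i
    · rw [hk, hl, h, mul_zero]
    · rw [signSwap_apply_eq_zero d hl, zero_mul]
  · rw [sadj_apply, signSwap_apply_eq_zero d, mul_zero, mul_zero]
    intro h
    refine hk ?_
    rw [← Sum.swap_swap k, h]
    rcases j with j | j <;> by_cases hd : d j < 0 <;> simp [swapIdx, hd]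

/-- Together with `signSwap_mem`, this reduces questions about P to a cocharacter with nonnegative
entries. -/
lemma isPar_signSwap_conj {d : Fin n → ℤ} {p : Matrix (Fin n ⊕ Fin n) (Fin n ⊕ Fin n) E}
    (hp : IsPar (fun i => |d i|) p) : IsPar d (signSwap E d * p * sadj (signSwap E d)) :=
  fun i j hij => signSwap_conj_eq_zero (hp _ _ (by rwa [wt_abs_swapIdx, wt_abs_swapIdx]))

end Explicit

/-! ### The Iwasawa decomposition over a valuation ring -/

section Iwasawa

variable {n : ℕ} {K : Type*} [Field K] (V : ValuationSubring K)

/-- One of y/x and x/y lies in V, so an elementary step or a rotated one has coefficients in V. -/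
lemma exists_sl2_eliminate (x y : K) : ∃ a b c e : K, a ∈ V ∧ b ∈ V ∧ c ∈ V ∧ e ∈ V ∧
    a * e - b * c = 1 ∧ c * x + e * y = 0 := by
  by_cases hx : x = 0
  · refine ⟨0, 1, -1, 0, V.zero_mem, V.one_mem, V.neg_mem _ V.one_mem, V.zero_mem, by ring, ?_⟩
    rw [hx]; ring
  by_cases hy : y = 0
  · refine ⟨1, 0, 0, 1, V.one_mem, V.zero_mem, V.zero_mem, V.one_mem, by ring, ?_⟩
    rw [hy]; ring
  rcases V.mem_or_inv_mem (y / x) with h | h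
  · refine ⟨1, 0, -(y / x), 1, V.one_mem, V.zero_mem, V.neg_mem _ h, V.one_mem, by ring, ?_⟩
    field_simp
    ring
  · rw [inv_div] at h
    refine ⟨0, 1, -1, x / y, V.zero_mem, V.one_mem, V.neg_mem _ V.one_mem, h, by ring, ?_⟩
    field_simp
    ring

lemma exists_div_mem {ι : Type*} (s : Finset ι) (v : ι → K) (h : ∃ i ∈ s, v i ≠ 0) :
    ∃ m ∈ s, v m ≠ 0 ∧ ∀ i ∈ s, v i / v m ∈ V := by
  obtain ⟨i₀, hi₀, hv⟩ := h
  obtain ⟨m, hm, hmax⟩ := s.exists_max_image (fun i => V.valuation (v i)) ⟨i₀, hi₀⟩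
  have hm0 : v m ≠ 0 := by
    intro e
    have := hmax i₀ hi₀
    rw [e, map_zero, le_zero_iff, map_eq_zero] at this
    exact hv this
  refine ⟨m, hm, hm0, fun i hi => ?_⟩
  rw [← V.valuation_le_one_iff, map_div₀]
  exact div_le_one_of_le₀ (hmax i hi) zero_le

/-- Among the entries outside s, one of maximal valuation is swapped into row a and used as pivot.
The multipliers then lie in V, and coordinates in s are left alone. -/
lemma exists_gl_eliminate (s : Finset (Fin n)) (a : Fin n) (ha : a ∉ s) (v : Fin n → K) :
    ∃ A B : Matrix (Fin n) (Fin n) K, A * B = 1 ∧ (∀ i j, A i j ∈ V) ∧ (∀ i j, B i j ∈ V) ∧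
      (∀ i, ∀ j ∈ s, A i j = if i = j then 1 else 0) ∧ ∀ l, l ∉ insert a s → (A *ᵥ v) l = 0 := by
  by_cases hv : ∃ i ∈ sᶜ, v i ≠ 0
  · obtain ⟨m, hm, hm0, hdiv⟩ := exists_div_mem V sᶜ v hv
    rw [Finset.mem_compl] at hm
    set σ := Equiv.swap a m
    set c : Fin n → K := fun l => if l ∈ insert a s then 0 else v (σ l) / v m with hc
    have hca : c a = 0 := by simp [hc]
    have hσs : ∀ j, σ j ∈ s ↔ j ∈ s := by
      intro j
      by_cases h1 : j = a
      · simp [σ, h1, ha, hm]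
      by_cases h2 : j = m
      · simp [σ, h2, ha, hm]
      rw [Equiv.swap_apply_of_ne_of_ne h1 h2]
    have hcV : ∀ l, c l ∈ V := by
      intro l
      simp only [hc]
      split_ifs with h
      · exact V.zero_mem
      · refine hdiv _ (Finset.mem_compl.2 fun e => h ?_)
        exact Finset.mem_insert_of_mem ((hσs l).1 e)
    set N : Matrix (Fin n) (Fin n) K := Matrix.of fun i j => if j = a then c i else 0 with hN
    have hNN : N * N = 0 := by
      ext i j
      rw [Matrix.mul_apply]
      refine Finset.sum_eq_zero fun k _ => ?_
      by_cases hk : k = a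
      · simp [hN, hk, hca]
      · simp [hN, hk]
    set P : Matrix (Fin n) (Fin n) K := Matrix.of fun i j => if j = σ i then 1 else 0 with hP
    have hPP : P * P = 1 := by
      ext i j
      rw [Matrix.mul_apply, Finset.sum_eq_single (σ i)]
      · simp only [hP, Matrix.of_apply, if_true, one_mul]
        rw [Equiv.swap_apply_self, Matrix.one_apply]
        simp only [eq_comm]
      · intro k _ hk
        simp [hP, hk]
      · simp
    have hPV : ∀ i j, P i j ∈ V := by
      intro i j
      simp only [hP, Matrix.of_apply]
      split_ifs
      · exact V.one_mem
      · exact V.zero_mem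
    have h1V : ∀ i j, (1 : Matrix (Fin n) (Fin n) K) i j ∈ V := by
      intro i j
      rw [Matrix.one_apply]
      split_ifs
      · exact V.one_mem
      · exact V.zero_mem
    have hNV : ∀ i j, N i j ∈ V := by
      intro i j
      simp only [hN, Matrix.of_apply]
      split_ifs
      · exact hcV _
      · exact V.zero_mem
    have hmul : ∀ X Y : Matrix (Fin n) (Fin n) K, (∀ i j, X i j ∈ V) → (∀ i j, Y i j ∈ V) →
        ∀ i j, (X * Y) i j ∈ V := fun X Y hX hY i j => by
      rw [Matrix.mul_apply]
      exact sum_mem fun k _ => mul_mem (hX i k) (hY k j)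
    have hPv : ∀ l, (P *ᵥ v) l = v (σ l) := fun l => by simp [Matrix.mulVec, dotProduct, hP]
    refine ⟨(1 - N) * P, P * (1 + N), ?_, hmul _ _ (fun i j => sub_mem (h1V i j) (hNV i j)) hPV,
      hmul _ _ hPV (fun i j => add_mem (h1V i j) (hNV i j)), ?_, ?_⟩
    · calc (1 - N) * P * (P * (1 + N)) = (1 - N) * (P * P) * (1 + N) := by
            simp only [Matrix.mul_assoc]
        _ = 1 - N * N := by rw [hPP]; noncomm_ring
        _ = 1 := by rw [hNN, sub_zero]
    · intro i j hj
      have hja : j ≠ a := fun e => ha (e ▸ hj)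
      have hjm : j ≠ m := fun e => hm (e ▸ hj)
      have hσj : σ j = j := Equiv.swap_apply_of_ne_of_ne hja hjm
      have hPj : ∀ k, P k j = if k = j then 1 else 0 := by
        intro k
        simp only [hP, Matrix.of_apply]
        congr 1
        rw [eq_iff_iff, eq_comm, ← σ.apply_eq_iff_eq, show σ (σ k) = k from Equiv.swap_apply_self _ _ _,
          hσj]
      rw [Matrix.mul_apply, Finset.sum_eq_single j]
      · simp [hPj, hN, hja, Matrix.one_apply]
      · intro k _ hk
        simp [hPj, hk]
      · simp
    · intro l hl
      rw [← Matrix.mulVec_mulVec, Matrix.sub_mulVec, Matrix.one_mulVec, Pi.sub_apply]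
      have : (N *ᵥ (P *ᵥ v)) l = c l * v m := by
        rw [Matrix.mulVec, dotProduct, Finset.sum_eq_single a]
        · rw [hPv]
          simp [hN, σ]
        · intro k _ hk
          simp [hN, hk]
        · simp
      rw [this, hPv]
      simp only [hc, hl, if_false]
      field_simp
      ring
  · push Not at hv
    refine ⟨1, 1, by simp, ?_, ?_, fun i j _ => Matrix.one_apply, fun l hl => ?_⟩
    iterate 2
      intro i j
      rw [Matrix.one_apply]
      split_ifs
      · exact V.one_mem
      · exact V.zero_mem
    rw [Matrix.one_mulVec]
    exact hv l (Finset.mem_compl.2 fun e => hl (Finset.mem_insert_of_mem e))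

lemma mul_mem_entries {k l : Matrix (Fin n ⊕ Fin n) (Fin n ⊕ Fin n) K} (hk : ∀ i j, k i j ∈ V)
    (hl : ∀ i j, l i j ∈ V) (i j) : (k * l) i j ∈ V := by
  rw [Matrix.mul_apply]
  exact sum_mem fun m _ => mul_mem (hk i m) (hl m j)

lemma sadj_mem_entries {k : Matrix (Fin n ⊕ Fin n) (Fin n ⊕ Fin n) K} (hk : ∀ i j, k i j ∈ V)
    (i j) : sadj k i j ∈ V := by
  have h1 : ∀ i : Fin n ⊕ Fin n, sg K i ∈ V := by
    rintro (i | i)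
    · exact V.one_mem
    · exact V.neg_mem _ V.one_mem
  rw [sadj_apply]
  exact mul_mem (mul_mem (h1 i) (h1 j)) (hk _ _)

lemma signSwap_mem_entries (d : Fin n → ℤ) (i j) : signSwap K d i j ∈ V := by
  have h0 := V.zero_mem
  have h1 := V.one_mem
  have h2 := V.neg_mem _ h1
  rcases i with i | i <;> rcases j with j | j <;>
    simp only [signSwap, blockSL, fromBlocks_apply₁₁, fromBlocks_apply₁₂, fromBlocks_apply₂₁,
      fromBlocks_apply₂₂, Matrix.diagonal_apply] <;> split_ifs <;> assumption

/-- Elimination column by column, taking the columns in increasing order of f. For a new column a,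
elements of SL₂(V) in the coordinate planes clear the lower half, then an element of GLₙ(V) clears
the remaining upper entries outside s and a. Both act trivially on what has been achieved for s. -/
lemma exists_eliminate_columns (f : Fin n → ℤ) {g : Matrix (Fin n ⊕ Fin n) (Fin n ⊕ Fin n) K}
    (hg : g ∈ symplecticGroup (Fin n) K) (s : Finset (Fin n)) :
    ∃ k ∈ symplecticGroup (Fin n) K, (∀ i j, k i j ∈ V) ∧
      (∀ j ∈ s, ∀ i, (k * g) (Sum.inr i) (Sum.inl j) = 0) ∧
      (∀ j ∈ s, ∀ i ∉ s, (k * g) (Sum.inl i) (Sum.inl j) = 0) ∧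
      (∀ j ∈ s, ∀ i ∈ s, f j < f i → (k * g) (Sum.inl i) (Sum.inl j) = 0) := by
  induction s using Finset.induction_on_max_value f with
  | empty =>
    refine ⟨1, one_mem _, fun i j => ?_, by simp, by simp, by simp⟩
    rw [Matrix.one_apply]
    split_ifs
    · exact V.one_mem
    · exact V.zero_mem
  | insert a s ha hmax ih =>
    obtain ⟨k, hk, hkV, h1, h2, h3⟩ := ih
    set h := k * g with hh
    have hhs : h ∈ symplecticGroup (Fin n) K := mul_mem hk hg
    have hdet : IsUnit h.det := SymplecticGroup.symplectic_det hhs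
    -- the column indexed by `a` has no components along `inr l` for `l ∈ s`
    have hva : ∀ l ∈ s, h (Sum.inr l) (Sum.inl a) = 0 := by
      set M : Matrix s s K := Matrix.of fun l j => h (Sum.inl l.1) (Sum.inl j.1) with hM
      have hMinj : Function.Injective M.mulVec := by
        rw [← Matrix.coe_mulVecLin, ← LinearMap.ker_eq_bot, Matrix.ker_mulVecLin_eq_bot_iff]
        intro x hx
        set y : Fin n ⊕ Fin n → K := Sum.elim (fun j => if hj : j ∈ s then x ⟨j, hj⟩ else 0) 0 with hy
        have hsum : ∀ i, (h *ᵥ y) i = ∑ j : s, h i (Sum.inl j.1) * x j := by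
          intro i
          rw [Matrix.mulVec, dotProduct, Fintype.sum_sum_type]
          simp only [hy, Sum.elim_inl, Sum.elim_inr, Pi.zero_apply, mul_zero, Finset.sum_const_zero,
            add_zero]
          rw [← Finset.sum_subset (Finset.subset_univ s) (by intro j _ hj; simp [hj]),
            ← Finset.sum_coe_sort s]
          exact Finset.sum_congr rfl fun j _ => by simp
        have hy0 : h *ᵥ y = 0 := by
          ext i
          rw [hsum]
          rcases i with i | i
          · by_cases hi : i ∈ s
            · exact congrFun hx ⟨i, hi⟩
            · exact Finset.sum_eq_zero fun j _ => by rw [h2 j.1 j.2 i hi, zero_mul]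
          · exact Finset.sum_eq_zero fun j _ => by rw [h1 j.1 j.2 i, zero_mul]
        have hy1 : y = 0 := Matrix.mulVec_injective_of_isUnit
          ((Matrix.isUnit_iff_isUnit_det _).2 hdet) (by rw [hy0, Matrix.mulVec_zero])
        ext j
        have := congrFun hy1 (Sum.inl j.1)
        simpa [hy] using this
      have hMt : Function.Injective Mᵀ.mulVec := by
        rw [Matrix.mulVec_injective_iff_isUnit, Matrix.isUnit_transpose,
          ← Matrix.mulVec_injective_iff_isUnit]
        exact hMinj
      have hz : (fun l : s => h (Sum.inr l.1) (Sum.inl a)) = 0 := by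
        apply hMt
        ext j
        rw [Matrix.mulVec_zero]
        -- Columns j and a are orthogonal for the symplectic form. As column j lives only in the
        -- upper rows of s, this reads Mᵀz = 0 for the vector z of lower entries of column a, and M
        -- is invertible.
        have hsym : (sadj h * h) (Sum.inr j.1) (Sum.inl a) = 0 := by
          rw [mul_eq_one_comm.1 ((mem_symplectic_iff _).1 hhs)]
          simp
        have e1 : ∀ l, sadj h (Sum.inr j.1) (Sum.inl l) = 0 := fun l => by
          rw [sadj_apply]
          simp [h1 j.1 j.2]
        have e2 : ∀ l, sadj h (Sum.inr j.1) (Sum.inr l) = h (Sum.inl l) (Sum.inl j.1) := fun l => by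
          rw [sadj_apply]
          simp [sg]
        rw [Matrix.mul_apply, Fintype.sum_sum_type] at hsym
        simp only [e1, e2, zero_mul, Finset.sum_const_zero, zero_add] at hsym
        rw [← Finset.sum_subset (Finset.subset_univ s)
          (by intro l _ hl; rw [h2 j.1 j.2 l hl, zero_mul]), ← Finset.sum_coe_sort s] at hsym
        exact hsym
      intro l hl
      exact congrFun hz ⟨l, hl⟩
    choose ca cb cc ce hca hcb hcc hce hdet1 hkill using fun i : Fin n =>
      exists_sl2_eliminate V (h (Sum.inl i) (Sum.inl a)) (h (Sum.inr i) (Sum.inl a))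
    set k₁ : Matrix (Fin n ⊕ Fin n) (Fin n ⊕ Fin n) K :=
      blockSL (fun i => if i ∈ s then 1 else ca i) (fun i => if i ∈ s then 0 else cb i)
        (fun i => if i ∈ s then 0 else cc i) (fun i => if i ∈ s then 1 else ce i) with hk₁
    have hk₁s : k₁ ∈ symplecticGroup (Fin n) K := blockSL_mem fun i => by
      split_ifs
      · ring
      · exact hdet1 i
    set w : Fin n → K := fun i => (k₁ * h) (Sum.inl i) (Sum.inl a) with hw
    obtain ⟨A, B, hAB, hAV, hBV, hAs, hAw⟩ := exists_gl_eliminate V s a ha w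
    have hk₁l : ∀ (X : Matrix (Fin n ⊕ Fin n) (Fin n ⊕ Fin n) K) i j,
        (k₁ * X) (Sum.inl i) j = (if i ∈ s then 1 else ca i) * X (Sum.inl i) j +
          (if i ∈ s then 0 else cb i) * X (Sum.inr i) j := by
      intro X i j
      simp [hk₁, blockSL, Matrix.mul_apply, Fintype.sum_sum_type, Matrix.diagonal_apply]
    have hk₁r : ∀ (X : Matrix (Fin n ⊕ Fin n) (Fin n ⊕ Fin n) K) i j,
        (k₁ * X) (Sum.inr i) j = (if i ∈ s then 0 else cc i) * X (Sum.inl i) j +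
          (if i ∈ s then 1 else ce i) * X (Sum.inr i) j := by
      intro X i j
      simp [hk₁, blockSL, Matrix.mul_apply, Fintype.sum_sum_type, Matrix.diagonal_apply]
    have hk₂l : ∀ (X : Matrix (Fin n ⊕ Fin n) (Fin n ⊕ Fin n) K) i j,
        (blockGL A B * X) (Sum.inl i) j = ∑ l, A i l * X (Sum.inl l) j := by
      intro X i j
      simp [blockGL, Matrix.mul_apply, Fintype.sum_sum_type]
    have hk₂r : ∀ (X : Matrix (Fin n ⊕ Fin n) (Fin n ⊕ Fin n) K) i j,
        (blockGL A B * X) (Sum.inr i) j = ∑ l, B l i * X (Sum.inr l) j := by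
      intro X i j
      simp [blockGL, Matrix.mul_apply, Fintype.sum_sum_type]
    have e1 : ∀ j ∈ s, ∀ i, (k₁ * h) (Sum.inl i) (Sum.inl j) = h (Sum.inl i) (Sum.inl j) := by
      intro j hj i
      rw [hk₁l, h1 j hj, mul_zero, add_zero]
      split_ifs with hi
      · rw [one_mul]
      · rw [h2 j hj i hi, mul_zero]
    have e2 : ∀ j ∈ s, ∀ i, (k₁ * h) (Sum.inr i) (Sum.inl j) = 0 := by
      intro j hj i
      rw [hk₁r, h1 j hj, mul_zero, add_zero]
      split_ifs with hi
      · rw [zero_mul]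
      · rw [h2 j hj i hi, mul_zero]
    have e3 : ∀ i, (k₁ * h) (Sum.inr i) (Sum.inl a) = 0 := by
      intro i
      rw [hk₁r]
      split_ifs with hi
      · rw [hva i hi]; ring
      · exact hkill i
    have e4 : ∀ j ∈ s, ∀ i, (blockGL A B * (k₁ * h)) (Sum.inl i) (Sum.inl j) =
        h (Sum.inl i) (Sum.inl j) := by
      intro j hj i
      rw [hk₂l]
      calc ∑ l, A i l * (k₁ * h) (Sum.inl l) (Sum.inl j)
          = ∑ l, (if i = l then 1 else 0) * h (Sum.inl l) (Sum.inl j) := by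
            refine Finset.sum_congr rfl fun l _ => ?_
            rw [e1 j hj]
            by_cases hl : l ∈ s
            · rw [hAs i l hl]
            · rw [h2 j hj l hl, mul_zero, mul_zero]
        _ = _ := by simp
    have hassoc : blockGL A B * k₁ * k * g = blockGL A B * (k₁ * h) := by
      rw [hh]; simp only [Matrix.mul_assoc]
    have hk₁V : ∀ i j, k₁ i j ∈ V := by
      intro i j
      have h0 := V.zero_mem
      have h1' := V.one_mem
      rcases i with i | i <;> rcases j with j | j <;>
        simp only [hk₁, blockSL, fromBlocks_apply₁₁, fromBlocks_apply₁₂, fromBlocks_apply₂₁,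
          fromBlocks_apply₂₂, Matrix.diagonal_apply] <;> split_ifs <;>
        first | assumption | apply_assumption
    have hk₂V : ∀ i j, blockGL A B i j ∈ V := by
      intro i j
      rcases i with i | i <;> rcases j with j | j
      · exact hAV i j
      · exact V.zero_mem
      · exact V.zero_mem
      · exact hBV j i
    refine ⟨blockGL A B * k₁ * k, mul_mem (mul_mem (blockGL_mem hAB) hk₁s) hk,
      mul_mem_entries V (mul_mem_entries V hk₂V hk₁V) hkV, ?_, ?_, ?_⟩
    all_goals rw [hassoc]
    · intro j hj i
      rw [hk₂r]
      refine Finset.sum_eq_zero fun l _ => ?_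
      rcases Finset.mem_insert.1 hj with rfl | hj
      · rw [e3, mul_zero]
      · rw [e2 j hj, mul_zero]
    · intro j hj i hi
      rcases Finset.mem_insert.1 hj with rfl | hj
      · rw [hk₂l]
        exact hAw i hi
      · rw [e4 j hj]
        exact h2 j hj i fun e => hi (Finset.mem_insert_of_mem e)
    · intro j hj' i hi hlt
      rcases Finset.mem_insert.1 hj' with rfl | hj
      · rcases Finset.mem_insert.1 hi with rfl | hi'
        · exact absurd hlt (lt_irrefl _)
        · exact absurd (hmax i hi') (not_le.2 hlt)
      · rw [e4 j hj]
        rcases Finset.mem_insert.1 hi with rfl | hi'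
        · exact h2 j hj _ ha
        · exact h3 j hj i hi' hlt

/-- Elimination in the order of -d makes the lower left block zero and the upper left block
triangular for the weights. The lower right block is the inverse transpose of the latter, so it
inherits triangularity. -/
theorem exists_isPar_mul_of_nonneg {d : Fin n → ℤ} (hd : ∀ i, 0 ≤ d i)
    {g : Matrix (Fin n ⊕ Fin n) (Fin n ⊕ Fin n) K} (hg : g ∈ symplecticGroup (Fin n) K) :
    ∃ k ∈ symplecticGroup (Fin n) K, (∀ i j, k i j ∈ V) ∧ IsPar d (k * g) := by
  obtain ⟨k, hk, hkV, h1, -, h3⟩ := exists_eliminate_columns V (fun i => - d i) hg Finset.univ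
  refine ⟨k, hk, hkV, ?_⟩
  set h := k * g
  have hs : h ∈ symplecticGroup (Fin n) K := mul_mem hk hg
  have hblock := fromBlocks_toBlocks h
  have hC : h.toBlocks₂₁ = 0 := by
    ext i j
    exact h1 j (Finset.mem_univ _) i
  have hAt : h.toBlocks₁₁.BlockTriangular (fun i => - d i) := fun i j hij =>
    h3 j (Finset.mem_univ _) i (Finset.mem_univ _) hij
  have hAD : h.toBlocks₁₁ᵀ * h.toBlocks₂₂ = 1 := by
    rw [← hblock, SymplecticGroup.fromBlocks_mem_iff] at hs
    have := hs.2.2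
    rwa [hC, transpose_zero, Matrix.zero_mul, sub_zero] at this
  have hDA : h.toBlocks₂₂ᵀ * h.toBlocks₁₁ = 1 := by
    rw [← transpose_transpose h.toBlocks₁₁, ← transpose_mul, hAD, transpose_one]
  have hinv : h.toBlocks₁₁⁻¹ = h.toBlocks₂₂ᵀ := Matrix.inv_eq_left_inv hDA
  have : Invertible h.toBlocks₁₁ := ⟨_, hDA, mul_eq_one_comm.1 hDA⟩
  have hDt := Matrix.blockTriangular_inv_of_blockTriangular hAt
  rw [hinv] at hDt
  rintro (i | i) (j | j) hij
  · exact hAt (by simpa [wt] using hij)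
  · have h1 := hd i
    have h2 := hd j
    simp only [wt, Sum.elim_inl, Sum.elim_inr] at hij
    omega
  · exact h1 j (Finset.mem_univ _) i
  · exact hDt (by simpa [wt] using hij)

/-- The Iwasawa decomposition `Sp(K) = Sp(V) P(K)`. -/
theorem exists_isPar_mul (d : Fin n → ℤ) {g : Matrix (Fin n ⊕ Fin n) (Fin n ⊕ Fin n) K}
    (hg : g ∈ symplecticGroup (Fin n) K) :
    ∃ k ∈ symplecticGroup (Fin n) K, (∀ i j, k i j ∈ V) ∧ IsPar d (k * g) := by
  have hsm := signSwap_mem (E := K) d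
  have hs := (mem_symplectic_iff _).1 hsm
  have hs' := mul_eq_one_comm.1 hs
  have hsm' : sadj (signSwap K d) ∈ symplecticGroup (Fin n) K := by
    rw [mem_symplectic_iff, sadj_sadj, hs']
  obtain ⟨k, hk, hkV, hp⟩ := exists_isPar_mul_of_nonneg V (d := fun i => |d i|)
    (fun i => abs_nonneg _) (mul_mem (mul_mem hsm' hg) hsm)
  refine ⟨signSwap K d * k * sadj (signSwap K d), mul_mem (mul_mem hsm hk) hsm',
    mul_mem_entries V (mul_mem_entries V (signSwap_mem_entries V d) hkV)
      (sadj_mem_entries V (signSwap_mem_entries V d)), ?_⟩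
  have key : signSwap K d * k * sadj (signSwap K d) * g =
      signSwap K d * (k * (sadj (signSwap K d) * g * signSwap K d)) * sadj (signSwap K d) := by
    calc _ = signSwap K d * k * sadj (signSwap K d) * g * (signSwap K d * sadj (signSwap K d)) := by
          rw [hs, Matrix.mul_one]
      _ = _ := by simp only [Matrix.mul_assoc]
  rw [key]
  exact isPar_signSwap_conj hp

end Iwasawa

/-! ### Transfer of polynomial identities to field extensions -/

section Transfer

/-- A polynomial which vanishes on the complex points of a variety vanishes on its points over all
extension fields. -/
lemma aeval_eq_zero_of_forall_eval {ι : Type} [Finite ι] (Q : Set (MvPolynomial ι ℂ))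
    (F : MvPolynomial ι ℂ)
    (h : ∀ x : ι → ℂ, (∀ q ∈ Q, MvPolynomial.eval x q = 0) → MvPolynomial.eval x F = 0)
    {E : Type*} [Field E] [Algebra ℂ E] (x : ι → E) (hx : ∀ q ∈ Q, MvPolynomial.aeval x q = 0) :
    MvPolynomial.aeval x F = 0 := by
  have h1 : F ∈ MvPolynomial.vanishingIdeal ℂ (MvPolynomial.zeroLocus ℂ (Ideal.span Q)) := by
    rw [MvPolynomial.mem_vanishingIdeal_iff]
    intro y hy
    rw [MvPolynomial.zeroLocus_span] at hy
    exact h y hy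
  rw [MvPolynomial.vanishingIdeal_zeroLocus_eq_radical] at h1
  obtain ⟨m, hm⟩ := h1
  have h2 : Ideal.span Q ≤ RingHom.ker (MvPolynomial.aeval x : MvPolynomial ι ℂ →ₐ[ℂ] E) :=
    Ideal.span_le.2 fun q hq => hx q hq
  have h3 := h2 hm
  rw [RingHom.mem_ker, map_pow] at h3
  exact eq_zero_of_pow_eq_zero h3

variable {n : ℕ} {d : Fin n → ℤ}

/-- A generic matrix. -/
def genMat {κ : Type} (n : ℕ) (a : κ) : Matrix (Fin n ⊕ Fin n) (Fin n ⊕ Fin n)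
    (MvPolynomial (κ × (Fin n ⊕ Fin n) × (Fin n ⊕ Fin n)) ℂ) :=
  Matrix.of fun i j => MvPolynomial.X (a, i, j)

/-- The point with given matrices as coordinates. -/
def matPt {κ E : Type*} (M : κ → Matrix (Fin n ⊕ Fin n) (Fin n ⊕ Fin n) E) :
    κ × (Fin n ⊕ Fin n) × (Fin n ⊕ Fin n) → E := fun a => M a.1 a.2.1 a.2.2

lemma map_genMat {κ : Type} {E : Type*} [CommRing E] [Algebra ℂ E]
    (x : κ × (Fin n ⊕ Fin n) × (Fin n ⊕ Fin n) → E) (a : κ) :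
    (genMat n a).map (MvPolynomial.aeval x : _ →ₐ[ℂ] E) = Matrix.of fun i j => x (a, i, j) := by
  ext i j
  simp [genMat]

lemma map_sadj_algHom {E F : Type*} [CommRing E] [CommRing F] [Algebra ℂ E] [Algebra ℂ F]
    (φ : E →ₐ[ℂ] F) (A : Matrix (Fin n ⊕ Fin n) (Fin n ⊕ Fin n) E) :
    (sadj A).map φ = sadj (A.map φ) :=
  map_sadj (φ : E →+* F) A

lemma aeval_matrix_apply {ι : Type} {E : Type*} [CommRing E] [Algebra ℂ E] (x : ι → E)
    (M : Matrix (Fin n ⊕ Fin n) (Fin n ⊕ Fin n) (MvPolynomial ι ℂ)) (i j) :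
    MvPolynomial.aeval x (M i j) = M.map (MvPolynomial.aeval x : _ →ₐ[ℂ] E) i j := rfl

lemma map_map_C {ι : Type} {E : Type*} [CommRing E] [Algebra ℂ E] (x : ι → E) (e : Mat n) :
    (e.map (MvPolynomial.C : ℂ →+* MvPolynomial ι ℂ)).map (MvPolynomial.aeval x : _ →ₐ[ℂ] E) =
      e.map (algebraMap ℂ E) := by
  ext i j
  simp

/-- `F` is an invariant function on `G × [𝔭,𝔭]^⊥`. -/
def IsInvariant (d : Fin n → ℤ) (F : Poly n) : Prop :=
  ∀ g p : Sp n, IsPar d (p : Mat n) → ∀ Y : Mat n, IsComm d Y →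
    MvPolynomial.eval (pt ((g : Mat n) * (p : Mat n)) Y) F =
      MvPolynomial.eval (pt (g : Mat n) ((p : Mat n) * Y * sadj (p : Mat n))) F

lemma aeval_pt_comp {E F : Type*} [CommRing E] [CommRing F] [Algebra ℂ E] [Algebra ℂ F]
    (φ : E →ₐ[ℂ] F) (g Y : Matrix (Fin n ⊕ Fin n) (Fin n ⊕ Fin n) E) (P : Poly n) :
    φ (MvPolynomial.aeval (pt g Y) P) = MvPolynomial.aeval (pt (g.map φ) (Y.map φ)) P := by
  rw [← AlgHom.comp_apply, MvPolynomial.comp_aeval]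
  congr 2
  ext (i | i) <;> rfl

/-- Invariance is an identity on the complex points of the variety of triples (g, p, Y), whose
equations are collected in Q. By the Nullstellensatz it persists at points over every field
extension. -/
theorem IsInvariant.aeval_eq {F : Poly n} (hF : IsInvariant d F) {E : Type*} [Field E] [Algebra ℂ E]
    {g p Y : Matrix (Fin n ⊕ Fin n) (Fin n ⊕ Fin n) E} (hg : g * sadj g = 1) (hp : p * sadj p = 1)
    (hpd : IsPar d p) (hY : IsComm d Y) :
    MvPolynomial.aeval (pt (g * p) Y) F = MvPolynomial.aeval (pt g (p * Y * sadj p)) F := by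
  set G := genMat n (0 : Fin 3)
  set P := genMat n (1 : Fin 3)
  set Z := genMat n (2 : Fin 3)
  set Q : Set (MvPolynomial (Fin 3 × (Fin n ⊕ Fin n) × (Fin n ⊕ Fin n)) ℂ) :=
    {q | (∃ i j, q = (G * sadj G - 1) i j) ∨ (∃ i j, q = (P * sadj P - 1) i j) ∨
      (∃ i j, wt d i < wt d j ∧ q = P i j) ∨ (∃ i j, q = (sadj Z + Z) i j) ∨
      (∃ i j, wt d i ≤ wt d j ∧ i ≠ j ∧ q = Z i j) ∨ (∃ i j, wt d i = wt d j ∧ q = Z i i - Z j j)}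
    with hQ
  have key := aeval_eq_zero_of_forall_eval Q
    (MvPolynomial.aeval (pt (G * P) Z) F - MvPolynomial.aeval (pt G (P * Z * sadj P)) F) ?_
    (matPt ![g, p, Y]) ?_
  · rw [map_sub, aeval_pt_comp, aeval_pt_comp] at key
    simp only [Matrix.map_mul, map_sadj_algHom, G, P, Z, map_genMat, matPt] at key
    exact sub_eq_zero.1 key
  · intro x hx
    rw [← MvPolynomial.coe_aeval_eq_eval] at hx ⊢
    simp only [RingHom.coe_coe] at hx ⊢
    set g' := G.map (MvPolynomial.aeval x : _ →ₐ[ℂ] ℂ) with hg'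
    set p' := P.map (MvPolynomial.aeval x : _ →ₐ[ℂ] ℂ) with hp'
    set Y' := Z.map (MvPolynomial.aeval x : _ →ₐ[ℂ] ℂ) with hY'
    have h1 : g' * sadj g' = 1 := by
      ext i j
      have := hx _ (Or.inl ⟨i, j, rfl⟩)
      rw [Matrix.sub_apply, map_sub, aeval_matrix_apply, aeval_matrix_apply, Matrix.map_mul, map_sadj_algHom,
        Matrix.map_one _ (map_zero _) (map_one _)] at this
      exact sub_eq_zero.1 this
    have h2 : p' * sadj p' = 1 := by
      ext i j
      have := hx _ (Or.inr (Or.inl ⟨i, j, rfl⟩))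
      rw [Matrix.sub_apply, map_sub, aeval_matrix_apply, aeval_matrix_apply, Matrix.map_mul, map_sadj_algHom,
        Matrix.map_one _ (map_zero _) (map_one _)] at this
      exact sub_eq_zero.1 this
    have h3 : IsPar d p' := fun i j hij => hx _ (Or.inr (Or.inr (Or.inl ⟨i, j, hij, rfl⟩)))
    have h4 : IsComm d Y' := by
      refine ⟨?_, fun i j hij hne => hx _ (Or.inr (Or.inr (Or.inr (Or.inr
        (Or.inl ⟨i, j, hij, hne, rfl⟩))))), fun i j hij => ?_⟩
      · rw [eq_neg_iff_add_eq_zero]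
        ext i j
        have := hx _ (Or.inr (Or.inr (Or.inr (Or.inl ⟨i, j, rfl⟩))))
        rw [Matrix.add_apply, map_add, aeval_matrix_apply, aeval_matrix_apply, map_sadj_algHom] at this
        exact this
      · have := hx _ (Or.inr (Or.inr (Or.inr (Or.inr (Or.inr ⟨i, j, hij, rfl⟩)))))
        rw [map_sub] at this
        exact sub_eq_zero.1 this
    rw [map_sub, aeval_pt_comp, aeval_pt_comp]
    simp only [Matrix.map_mul, map_sadj_algHom, ← hg', ← hp', ← hY']
    exact sub_eq_zero.2 (hF ⟨g', (mem_symplectic_iff _).2 h1⟩ ⟨p', (mem_symplectic_iff _).2 h2⟩ h3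
      Y' h4)
  · have e0 : G.map (MvPolynomial.aeval (matPt ![g, p, Y]) : _ →ₐ[ℂ] E) = g := map_genMat _ _
    have e1 : P.map (MvPolynomial.aeval (matPt ![g, p, Y]) : _ →ₐ[ℂ] E) = p := map_genMat _ _
    have e2 : Z.map (MvPolynomial.aeval (matPt ![g, p, Y]) : _ →ₐ[ℂ] E) = Y := map_genMat _ _
    rintro q (⟨i, j, rfl⟩ | ⟨i, j, rfl⟩ | ⟨i, j, hij, rfl⟩ | ⟨i, j, rfl⟩ | ⟨i, j, hij, hne, rfl⟩ |
      ⟨i, j, hij, rfl⟩)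
    · rw [Matrix.sub_apply, map_sub, aeval_matrix_apply, aeval_matrix_apply, Matrix.map_mul, map_sadj_algHom,
        Matrix.map_one _ (map_zero _) (map_one _), e0, hg, sub_self]
    · rw [Matrix.sub_apply, map_sub, aeval_matrix_apply, aeval_matrix_apply, Matrix.map_mul, map_sadj_algHom,
        Matrix.map_one _ (map_zero _) (map_one _), e1, hp, sub_self]
    · rw [aeval_matrix_apply, e1, hpd i j hij]
    · rw [Matrix.add_apply, map_add, aeval_matrix_apply, aeval_matrix_apply, map_sadj_algHom, e2, hY.skew]
      simp
    · rw [aeval_matrix_apply, e2, hY.zero i j hij hne]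
    · rw [map_sub, aeval_matrix_apply, aeval_matrix_apply, e2, hY.diag i j hij, sub_self]

/-- The condition that the fibre over e is a single point is transferred in the same way to points
over extension fields. This is how birationality is used at the generic point of the orbit. -/
theorem IsBirational.isPar {e : Mat n} (he : IsBirational d e) (hes : sadj e = -e)
    {E : Type*} [Field E] [Algebra ℂ E]
    {h : Matrix (Fin n ⊕ Fin n) (Fin n ⊕ Fin n) E} (hh : h * sadj h = 1)
    (hu : ∀ i j, wt d i ≤ wt d j → (sadj h * e.map (algebraMap ℂ E) * h) i j = 0) : IsPar d h := by
  set H := genMat n (0 : Fin 1)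
  set C : Matrix (Fin n ⊕ Fin n) (Fin n ⊕ Fin n)
    (MvPolynomial (Fin 1 × (Fin n ⊕ Fin n) × (Fin n ⊕ Fin n)) ℂ) := e.map MvPolynomial.C with hC
  set Q : Set (MvPolynomial (Fin 1 × (Fin n ⊕ Fin n) × (Fin n ⊕ Fin n)) ℂ) :=
    {q | (∃ i j, q = (H * sadj H - 1) i j) ∨
      (∃ i j, wt d i ≤ wt d j ∧ q = (sadj H * C * H) i j)} with hQ
  intro i j hij
  have key := aeval_eq_zero_of_forall_eval Q (H i j) ?_ (matPt ![h]) ?_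
  · rw [aeval_matrix_apply, map_genMat] at key
    exact key
  · intro x hx
    rw [← MvPolynomial.coe_aeval_eq_eval] at hx ⊢
    simp only [RingHom.coe_coe] at hx ⊢
    set h' := H.map (MvPolynomial.aeval x : _ →ₐ[ℂ] ℂ) with hh'
    have h1 : h' * sadj h' = 1 := by
      ext i j
      have := hx _ (Or.inl ⟨i, j, rfl⟩)
      rw [Matrix.sub_apply, map_sub, aeval_matrix_apply, aeval_matrix_apply, Matrix.map_mul, map_sadj_algHom,
        Matrix.map_one _ (map_zero _) (map_one _)] at this
      exact sub_eq_zero.1 this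
    refine he ⟨h', (mem_symplectic_iff _).2 h1⟩ ⟨?_, fun i j hij => ?_⟩ i j hij
    · rw [mem_sp_iff, coe_inv_eq_sadj, sadj_mul, sadj_mul, sadj_sadj, hes]
      simp [Matrix.mul_assoc]
    · have := hx _ (Or.inr ⟨i, j, hij, rfl⟩)
      rw [aeval_matrix_apply, Matrix.map_mul, Matrix.map_mul, map_sadj_algHom, map_map_C] at this
      exact this
  · have e0 : H.map (MvPolynomial.aeval (matPt ![h]) : _ →ₐ[ℂ] E) = h := map_genMat _ _
    rintro q (⟨i, j, rfl⟩ | ⟨i, j, hij, rfl⟩)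
    · rw [Matrix.sub_apply, map_sub, aeval_matrix_apply, aeval_matrix_apply, Matrix.map_mul, map_sadj_algHom,
        Matrix.map_one _ (map_zero _) (map_one _), e0, hh, sub_self]
    · rw [aeval_matrix_apply, Matrix.map_mul, Matrix.map_mul, map_sadj_algHom, map_map_C, e0, hu i j hij]

/-- Invariant functions are integral over the functions of `g Y g⁻¹`. -/
theorem IsInvariant.isIntegral {F : Poly n} (hF : IsInvariant d F) {K : Type*} [Field K]
    [Algebra ℂ K] {g Y : Matrix (Fin n ⊕ Fin n) (Fin n ⊕ Fin n) K} (hg : g * sadj g = 1)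
    (hY : IsComm d Y) (S : Subalgebra ℂ K) (hS : ∀ i j, (g * Y * sadj g) i j ∈ S) :
    IsIntegral S (MvPolynomial.aeval (pt g Y) F) := by
  suffices h : MvPolynomial.aeval (pt g Y) F ∈
      (integralClosure (Subring.closure (S : Set K)) K).toSubring by
    have h' : IsIntegral (Subring.closure (S : Set K)) (MvPolynomial.aeval (pt g Y) F) := h
    have e : Subring.closure (S : Set K) = S.toSubring := Subring.closure_eq S.toSubring
    rw [e] at h'
    exact h'
  -- The integral closure is the intersection of the valuation rings V containing S. For each V, the
  -- Iwasawa decomposition gives k over V with kg ∈ P, and invariance rewrites F(g, Y) as F(k⁻¹,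
  -- k(gYg⁻¹)k⁻¹), all of whose arguments have entries in V. This is the valuative criterion for
  -- G/P.
  rw [← iInf_valuationSubring_superset, Subring.mem_iInf]
  rintro ⟨V, hV⟩
  obtain ⟨k, hk, hkV, hp⟩ := exists_isPar_mul V d ((mem_symplectic_iff g).2 hg)
  have hk1 := (mem_symplectic_iff _).1 hk
  have hk2 := mul_eq_one_comm.1 hk1
  have hgg := mul_eq_one_comm.1 hg
  have hps : (k * g) * sadj (k * g) = 1 := by
    rw [sadj_mul, Matrix.mul_assoc, ← Matrix.mul_assoc g, hg, Matrix.one_mul, hk1]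
  have e1 : sadj k * (k * g) = g := by rw [← Matrix.mul_assoc, hk2, Matrix.one_mul]
  have key := hF.aeval_eq (g := sadj k) (by rw [sadj_sadj, hk2]) hps hp hY
  rw [e1] at key
  rw [key, sadj_mul]
  have hAV : ∀ i j, (g * Y * sadj g) i j ∈ V := fun i j => hV (hS i j)
  have hYV : ∀ i j, (k * g * Y * (sadj g * sadj k)) i j ∈ V := by
    have := mul_mem_entries V (mul_mem_entries V hkV hAV) (sadj_mem_entries V hkV)
    simpa only [Matrix.mul_assoc] using this
  have hCV : ∀ c : ℂ, algebraMap ℂ K c ∈ V := fun c => hV (S.algebraMap_mem c)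
  change _ ∈ V
  rw [MvPolynomial.aeval_def, MvPolynomial.eval₂_eq]
  refine sum_mem fun m _ => mul_mem (hCV _) (prod_mem fun i _ => pow_mem ?_ _)
  rcases i with i | i
  · exact sadj_mem_entries V hkV _ _
  · exact hYV _ _

end Transfer

/-! ### Commutative algebra -/

section CommutativeAlgebra

/-- Two extensions of a field embed into a common extension. -/
lemma exists_amalgam {F L M : Type} [Field F] [Field L] [Field M] (f : F →+* L) (g : F →+* M) :
    ∃ (E : Type) (_ : Field E) (a : L →+* E) (b : M →+* E), a.comp f = b.comp g := by
  let := f.toAlgebra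
  let := g.toAlgebra
  have : Nontrivial (TensorProduct F L M) :=
    Algebra.TensorProduct.nontrivial_of_algebraMap_injective_of_flat_left F L M
      (algebraMap F M).injective
  obtain ⟨m, hm⟩ := Ideal.exists_maximal (TensorProduct F L M)
  let := Ideal.Quotient.field m
  let a : L →ₐ[F] TensorProduct F L M := Algebra.TensorProduct.includeLeft
  let b : M →ₐ[F] TensorProduct F L M := Algebra.TensorProduct.includeRight
  refine ⟨TensorProduct F L M ⧸ m, inferInstance, (Ideal.Quotient.mk m).comp (a : L →+* _),
    (Ideal.Quotient.mk m).comp (b : M →+* _), ?_⟩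
  ext x
  change Ideal.Quotient.mk m (a (algebraMap F L x)) = Ideal.Quotient.mk m (b (algebraMap F M x))
  rw [a.commutes, b.commutes]

/-- An algebraic element on which all pairs of homomorphisms over the base field agree lies in the
base field (in characteristic zero). -/
theorem mem_range_of_forall_ringHom_eq {k K : Type} [Field k] [Field K] [CharZero k] [Algebra k K]
    {φ : K} (hφ : IsIntegral k φ)
    (h : ∀ (E : Type) [Field E] (a b : K →+* E),
      a.comp (algebraMap k K) = b.comp (algebraMap k K) → a φ = b φ) :
    φ ∈ (algebraMap k K).range := by
  classical
  rw [← minpoly.natDegree_eq_one_iff (A := k)]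
  -- For a conjugate β of φ, the inclusion of k(φ) in K and the embedding φ ↦ β are amalgamated in
  -- one field E. The two resulting maps from K to E agree on k, hence on φ, which gives β = φ. With
  -- separability the minimal polynomial has degree one.
  have hroot : ∀ β ∈ (minpoly k φ).rootSet (AlgebraicClosure K), β = algebraMap K _ φ := by
    intro β hβ
    have hβ' : β ∈ (minpoly k φ).aroots (AlgebraicClosure K) := by
      rwa [Polynomial.rootSet_def, Finset.mem_coe, Multiset.mem_toFinset] at hβ
    let σ := (IntermediateField.algHomAdjoinIntegralEquiv k hφ).symm ⟨β, hβ'⟩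
    have hσ : σ (IntermediateField.AdjoinSimple.gen k φ) = β :=
      IntermediateField.algHomAdjoinIntegralEquiv_symm_apply_gen k hφ _
    obtain ⟨E, _, a, b, hab⟩ := exists_amalgam
      (IntermediateField.val (IntermediateField.adjoin k {φ})).toRingHom σ.toRingHom
    have hab' := RingHom.congr_fun hab
    have h1 := h E a (b.comp (algebraMap K (AlgebraicClosure K))) (by
      ext x
      have h0 : a (algebraMap k K x) = b (σ (algebraMap k _ x)) := hab' (algebraMap k _ x)
      rw [RingHom.comp_apply, RingHom.comp_apply, RingHom.comp_apply, h0, σ.commutes,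
        IsScalarTower.algebraMap_apply k K (AlgebraicClosure K)])
    have h3 : a φ = b (σ (IntermediateField.AdjoinSimple.gen k φ)) :=
      hab' (IntermediateField.AdjoinSimple.gen k φ)
    rw [h1, hσ] at h3
    exact (b.injective h3).symm
  have hc := Polynomial.card_rootSet_eq_natDegree (K := AlgebraicClosure K)
    (minpoly.irreducible hφ).separable (IsAlgClosed.splits _)
  have h1 : Fintype.card ((minpoly k φ).rootSet (AlgebraicClosure K)) ≤ 1 :=
    Fintype.card_le_one_iff.2 fun x y => Subtype.ext ((hroot x x.2).trans (hroot y y.2).symm)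
  have h2 := minpoly.natDegree_pos hφ
  omega

set_option maxHeartbeats 1000000 in
/-- A ring of integral elements in the fraction field of a finitely generated algebra is a finite
module. -/
theorem exists_finset_span_of_isIntegral {K : Type} [Field K] [Algebra ℂ K]
    (S R : Subalgebra ℂ K) (hS : S.FG) (hint : ∀ r ∈ R, IsIntegral S r) (hSR : S ≤ R)
    (hfrac : ∀ r ∈ R, ∃ a ∈ S, ∃ b ∈ S, b ≠ 0 ∧ r * b = a) :
    ∃ s : Finset K, (s : Set K) ⊆ R ∧ ∀ r ∈ R, r ∈ Submodule.span S (s : Set K) := by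
  have : Algebra.FiniteType ℂ S := S.fg_iff_finiteType.1 hS
  -- Noether normalization. The polynomial ring A is normal, so its integral closure in the fraction
  -- field L of S is a Noetherian A-module. R is a quotient-field image of the submodule N of it.
  obtain ⟨m, g, hg, hfin⟩ := exists_finite_inj_algHom_of_fg ℂ S
  let : Algebra (MvPolynomial (Fin m) ℂ) S := g.toRingHom.toAlgebra
  have : Module.Finite (MvPolynomial (Fin m) ℂ) S := hfin
  have : FaithfulSMul (MvPolynomial (Fin m) ℂ) S :=
    (faithfulSMul_iff_algebraMap_injective _ _).2 hg
  let A := MvPolynomial (Fin m) ℂ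
  let L := FractionRing S
  let : Algebra (FractionRing A) L := FractionRing.liftAlgebra A L
  have : IsScalarTower A (FractionRing A) L := FractionRing.isScalarTower_liftAlgebra A L
  have : IsNoetherian A (integralClosure A L) :=
    IsIntegralClosure.isNoetherian A (FractionRing A) L (integralClosure A L)
  let ι : L →ₐ[S] K := IsLocalization.liftAlgHom (M := nonZeroDivisors S)
    (f := Algebra.ofId S K) fun y => by
      have : (y : S) ≠ 0 := nonZeroDivisors.ne_zero y.2
      exact IsUnit.mk0 _ fun h => this (Subtype.ext h)
  have hιA : ∀ a : A, ι (algebraMap A L a) = (g a : K) := fun a => ι.commutes (g a)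
  let N : Submodule A (integralClosure A L) :=
    { carrier := {x | ι x ∈ R}
      add_mem' := fun {x y} hx hy => by
        change ι (x + y) ∈ R
        rw [map_add]
        exact add_mem hx hy
      zero_mem' := by
        change ι 0 ∈ R
        rw [map_zero]
        exact zero_mem _
      smul_mem' := fun a x hx => by
        change ι (a • (x : L)) ∈ R
        rw [Algebra.smul_def, map_mul, hιA]
        exact mul_mem (hSR (g a).2) hx }
  obtain ⟨s₀, hs₀⟩ := (IsNoetherian.noetherian N : N.FG)
  classical
  refine ⟨s₀.image fun x : integralClosure A L => ι x, ?_, fun r hr => ?_⟩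
  · intro y hy
    obtain ⟨x, hx, rfl⟩ := Finset.mem_image.1 (Finset.mem_coe.1 hy)
    have : x ∈ N := hs₀ ▸ Submodule.subset_span hx
    exact this
  · obtain ⟨a, ha, b, hb, hb0, hab⟩ := hfrac r hr
    let x : L := algebraMap S L ⟨a, ha⟩ / algebraMap S L ⟨b, hb⟩
    have hx : ι x = r := by
      rw [map_div₀, ι.commutes, ι.commutes]
      change a / b = r
      rw [← hab, mul_div_cancel_right₀ _ hb0]
    have hxS : IsIntegral S x := by
      rw [← isIntegral_algHom_iff ι ι.toRingHom.injective, hx]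
      exact hint r hr
    have hAS : Algebra.IsIntegral A S := inferInstance
    have hAL : IsScalarTower A S L := inferInstance
    have hxA : IsIntegral A x := isIntegral_trans (R := A) (A := S) (B := L) x hxS
    have hmem : (⟨x, hxA⟩ : integralClosure A L) ∈ Submodule.span A (s₀ : Set _) := by
      rw [hs₀]
      change ι x ∈ R
      rwa [hx]
    rw [← hx]
    suffices h : ∀ z ∈ Submodule.span A (s₀ : Set (integralClosure A L)), ι (z : L) ∈
        Submodule.span S ((s₀.image fun x : integralClosure A L => ι x : Finset K) : Set K) from
      h _ hmem
    intro z hz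
    induction hz using Submodule.span_induction with
    | mem y hy => exact Submodule.subset_span (Finset.mem_coe.2 (Finset.mem_image_of_mem _ hy))
    | zero => exact (map_zero ι) ▸ zero_mem _
    | add y z _ _ h₁ h₂ =>
      change ι ((y : L) + z) ∈ _
      rw [map_add]
      exact add_mem h₁ h₂
    | smul c y _ h =>
      change ι (c • (y : L)) ∈ _
      rw [Algebra.smul_def, map_mul, hιA]
      exact Submodule.smul_mem _ (g c) h

/-- A product of `c + 1` variables lies in an ideal all of whose zeros have at most `c` non-zero
coordinates, if the ideal contains a separable polynomial in each variable. -/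
theorem prod_X_mem_of_zeros {n : ℕ} (I : Ideal (MvPolynomial (Fin n) ℂ)) (Λ : Finset ℂ)
    (hΛ : ∀ i, ∏ μ ∈ Λ, (MvPolynomial.X i - MvPolynomial.C μ) ∈ I) (S : Finset (Fin n))
    (hS : ∀ v : Fin n → ℂ, (∀ p ∈ I, MvPolynomial.eval v p = 0) → ∃ i ∈ S, v i = 0) :
    ∏ i ∈ S, (MvPolynomial.X i : MvPolynomial (Fin n) ℂ) ∈ I := by
  by_contra hcon
  -- The colon ideal of I by the product. If it is proper it has a zero v, and v is also a zero of
  -- I.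
  set Q : Ideal (MvPolynomial (Fin n) ℂ) :=
    { carrier := {f | f * ∏ i ∈ S, MvPolynomial.X i ∈ I}
      add_mem' := fun {x y} hx hy => by
        change (x + y) * _ ∈ I
        rw [add_mul]
        exact add_mem hx hy
      zero_mem' := by
        change 0 * _ ∈ I
        rw [zero_mul]
        exact zero_mem _
      smul_mem' := fun a x hx => by
        change (a * x) * _ ∈ I
        rw [mul_assoc]
        exact I.mul_mem_left _ hx } with hQ
  have hQ1 : Q ≠ ⊤ := fun h => hcon (by
    have : (1 : MvPolynomial (Fin n) ℂ) ∈ Q := h ▸ Submodule.mem_top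
    change 1 * _ ∈ I at this
    rwa [one_mul] at this)
  obtain ⟨m, hm, hQm⟩ := Ideal.exists_le_maximal Q hQ1
  obtain ⟨v, rfl⟩ := (MvPolynomial.isMaximal_iff_eq_vanishingIdeal_singleton (K := ℂ)).1 hm
  have hv : ∀ p ∈ Q, MvPolynomial.eval v p = 0 := fun p hp =>
    (MvPolynomial.mem_vanishingIdeal_iff (k := ℂ)).1 (hQm hp) v rfl
  have hIQ : I ≤ Q := fun p hp => I.mul_mem_right _ hp
  obtain ⟨i, hi, hvi⟩ := hS v fun p hp => hv p (hIQ hp)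
  have h0 : (0 : ℂ) ∈ Λ := by
    have := hv _ (hIQ (hΛ i))
    rw [map_prod, Finset.prod_eq_zero_iff] at this
    obtain ⟨μ, hμ, h⟩ := this
    simp only [map_sub, MvPolynomial.eval_X, MvPolynomial.eval_C, hvi, zero_sub, neg_eq_zero] at h
    exact h ▸ hμ
  -- With the simple root 0 absorbed into the product over S, the other factors lie in Q. They do
  -- not vanish at v, because v_i = 0.
  have hg : ∏ μ ∈ Λ.erase 0, (MvPolynomial.X i - MvPolynomial.C μ) ∈ Q := by
    change _ * _ ∈ I
    have h1 := hΛ i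
    rw [← Finset.mul_prod_erase Λ _ h0, map_zero, sub_zero] at h1
    rw [← Finset.mul_prod_erase S _ hi, ← mul_assoc, mul_comm _ (MvPolynomial.X i)]
    exact I.mul_mem_right _ h1
  have h2 := hv _ hg
  rw [map_prod, Finset.prod_eq_zero_iff] at h2
  obtain ⟨μ, hμ, h⟩ := h2
  simp only [map_sub, MvPolynomial.eval_X, MvPolynomial.eval_C, hvi, zero_sub, neg_eq_zero] at h
  exact (Finset.mem_erase.1 hμ).1 h

/-- A finite module over the affine line whose fibres have constant dimension: an element which
vanishes in all fibres except possibly one vanishes in this fibre as well. -/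
theorem mem_span_of_rank_eq {B : Type} [CommRing B] [Algebra ℂ B] (t : B) (s : Finset B)
    (hs : ∀ f : B, ∃ p : B → Polynomial ℂ, f = ∑ r ∈ s, Polynomial.aeval t (p r) * r)
    (hrank : ∀ τ : ℂ, Module.rank ℂ (B ⧸ Ideal.span {t - algebraMap ℂ B τ}) =
      Module.rank ℂ (B ⧸ Ideal.span {t}))
    (x : B) (hx : ∀ τ : ℂ, τ ≠ 0 → x ∈ Ideal.span {t - algebraMap ℂ B τ}) :
    x ∈ Ideal.span {t} := by
  let : Algebra (Polynomial ℂ) B := (Polynomial.aeval t).toRingHom.toAlgebra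
  have hsm : ∀ (p : Polynomial ℂ) (b : B), p • b = Polynomial.aeval t p * b := fun p b => rfl
  have hfin : (⊤ : Submodule (Polynomial ℂ) B).FG := by
    refine ⟨s, eq_top_iff.2 fun f _ => ?_⟩
    obtain ⟨p, rfl⟩ := hs f
    exact sum_mem fun r hr => Submodule.smul_mem _ (p r) (Submodule.subset_span hr)
  let fib : ℂ → Ideal B := fun τ => Ideal.span {t - algebraMap ℂ B τ}
  have hev : ∀ (τ : ℂ) (p : Polynomial ℂ),
      Polynomial.aeval t p - algebraMap ℂ B (p.eval τ) ∈ fib τ := by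
    intro τ p
    obtain ⟨q, hq⟩ := Polynomial.X_sub_C_dvd_sub_C_eval (p := p) (a := τ)
    have := congrArg (Polynomial.aeval t) hq
    simp only [map_sub, map_mul, Polynomial.aeval_X, Polynomial.aeval_C] at this
    rw [this]
    exact Ideal.mul_mem_right _ _ (Ideal.subset_span rfl)
  have hevq : ∀ (τ : ℂ) (p : Polynomial ℂ) (b : B), Ideal.Quotient.mk (fib τ) (p • b) =
      p.eval τ • Ideal.Quotient.mk (fib τ) b := by
    intro τ p b
    rw [hsm, map_mul, Ideal.Quotient.eq.2 (hev τ p), ← map_mul, ← Algebra.smul_def]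
    rfl
  have hfib0 : fib 0 = Ideal.span {t} := by simp [fib]
  -- the fibres are finite-dimensional
  have hff : ∀ τ, Module.Finite ℂ (B ⧸ fib τ) := by
    intro τ
    classical
    refine ⟨⟨s.image (Ideal.Quotient.mk (fib τ)), eq_top_iff.2 fun y _ => ?_⟩⟩
    obtain ⟨f, rfl⟩ := Ideal.Quotient.mk_surjective y
    obtain ⟨p, rfl⟩ := hs f
    rw [map_sum]
    refine sum_mem fun r hr => ?_
    rw [← hsm, hevq]
    exact Submodule.smul_mem _ _ (Submodule.subset_span (by simpa using ⟨r, hr, rfl⟩))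
  have hfr : ∀ τ, Module.finrank ℂ (B ⧸ fib τ) = Module.finrank ℂ (B ⧸ fib 0) := by
    intro τ
    rw [Module.finrank, Module.finrank, hrank τ, hfib0]
  let b := Module.finBasis ℂ (B ⧸ fib 0)
  choose m hm using fun i => Ideal.Quotient.mk_surjective (b i)
  let N : Submodule (Polynomial ℂ) B := Submodule.span _ (Set.range m)
  -- Nakayama: the lifts m of a basis of the fibre at 0 generate B after multiplication by some f
  -- with f(0) = 1.
  obtain ⟨f, hf0, hfN⟩ := Submodule.exists_sub_one_mem_and_smul_le_of_fg_of_le_sup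
    (I := Ideal.span {(Polynomial.X : Polynomial ℂ)}) (N := N) hfin le_rfl (by
      intro y _
      have h1 := b.sum_repr (Ideal.Quotient.mk (fib 0) y)
      have h2 : y - ∑ i, Polynomial.C (b.repr (Ideal.Quotient.mk (fib 0) y) i) • m i ∈ fib 0 := by
        rw [← Ideal.Quotient.eq, map_sum]
        simp only [hevq, Polynomial.eval_C, hm]
        exact h1.symm
      obtain ⟨z, hz⟩ := Ideal.mem_span_singleton.1 h2
      refine Submodule.mem_sup.2 ⟨∑ i, Polynomial.C (b.repr (Ideal.Quotient.mk (fib 0) y) i) • m i,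
        sum_mem fun i _ => Submodule.smul_mem _ _ (Submodule.subset_span ⟨i, rfl⟩),
        (Polynomial.X : Polynomial ℂ) • z,
        Submodule.smul_mem_smul (Ideal.subset_span rfl) Submodule.mem_top, ?_⟩
      rw [hsm Polynomial.X, Polynomial.aeval_X, ← sub_zero t,
        ← map_zero (algebraMap ℂ B), ← hz]
      ring)
  have hfe : f.eval 0 = 1 := by
    obtain ⟨q, hq⟩ := Ideal.mem_span_singleton.1 hf0
    have := congrArg (Polynomial.eval 0) hq
    simp only [Polynomial.eval_sub, Polynomial.eval_one, Polynomial.eval_mul, Polynomial.eval_X,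
      zero_mul] at this
    exact sub_eq_zero.1 this
  have hmemN : ∀ y : B, ∃ p : Fin (Module.finrank ℂ (B ⧸ fib 0)) → Polynomial ℂ,
      f • y = ∑ i, p i • m i := by
    intro y
    have : f • y ∈ N := hfN (Submodule.smul_mem_pointwise_smul y f ⊤ Submodule.mem_top)
    obtain ⟨p, hp⟩ := (Submodule.mem_span_range_iff_exists_fun _).1 this
    exact ⟨p, hp.symm⟩
  obtain ⟨p, hp⟩ := hmemN x
  have hp0 : ∀ i, p i = 0 := by
    intro i
    have hfne : f ≠ 0 := fun h => by simp [h] at hfe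
    -- The factors f and X take care of the finitely many τ that are zero or roots of f.
    suffices h : p i * f * Polynomial.X = 0 by
      simpa [hfne, Polynomial.X_ne_zero] using h
    refine Polynomial.funext fun τ => ?_
    simp only [Polynomial.eval_mul, Polynomial.eval_X, Polynomial.eval_zero]
    by_cases hτ : τ = 0
    · simp [hτ]
    by_cases hfτ : f.eval τ = 0
    · simp [hfτ]
    have hspan : ⊤ ≤ Submodule.span ℂ (Set.range fun i => Ideal.Quotient.mk (fib τ) (m i)) := by
      intro y _
      obtain ⟨y, rfl⟩ := Ideal.Quotient.mk_surjective y
      obtain ⟨q, hq⟩ := hmemN y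
      have h1 := congrArg (Ideal.Quotient.mk (fib τ)) hq
      rw [map_sum, hevq] at h1
      simp only [hevq] at h1
      rw [← inv_smul_smul₀ hfτ (Ideal.Quotient.mk (fib τ) y), h1]
      exact Submodule.smul_mem _ _ (sum_mem fun i _ =>
        Submodule.smul_mem _ _ (Submodule.subset_span ⟨i, rfl⟩))
    -- At the remaining τ the m_i span a fibre whose dimension equals their number, so they form a
    -- basis. The element x vanishes in this fibre, hence so do the values of its coefficients p_i.
    have hli := linearIndependent_of_top_le_span_of_card_eq_finrank hspan (by
      rw [Fintype.card_fin, hfr τ])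
    have h1 := congrArg (Ideal.Quotient.mk (fib τ)) hp
    rw [map_sum, hevq, Ideal.Quotient.eq_zero_iff_mem.2 (hx τ hτ), smul_zero] at h1
    simp only [hevq] at h1
    rw [Fintype.linearIndependent_iff.1 hli _ h1.symm i, zero_mul, zero_mul]
  have hfx : f • x = 0 := by
    rw [hp]
    simp [hp0]
  rw [← hfib0, ← Ideal.Quotient.eq_zero_iff_mem]
  have h1 := hevq 0 f x
  rw [hfx, hfe, one_smul, map_zero] at h1
  exact h1.symm

end CommutativeAlgebra

/-! ### The coordinate ring of `G ×^P [𝔭,𝔭]^⊥` and its generic point -/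

section CoordRing

variable {n : ℕ} {d : Fin n → ℤ}

/-- The generic point of `Sp(2n) × W`, where `W` is an affine space. -/
theorem exists_generic_point (W : Set (Mat n)) (hne : W.Nonempty)
    (hW : ∀ Y ∈ W, ∀ Y' ∈ W, ∀ t : ℂ, Y + t • (Y' - Y) ∈ W) :
    ∃ (K : Type) (_ : Field K) (_ : Algebra ℂ K) (g Y : Matrix (Fin n ⊕ Fin n) (Fin n ⊕ Fin n) K),
      ∀ P : Poly n, MvPolynomial.aeval (pt g Y) P = 0 ↔
        ∀ g₀ : Sp n, ∀ Y₀ ∈ W, MvPolynomial.eval (pt (g₀ : Mat n) Y₀) P = 0 := by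
  let ev : Poly n →ₐ[ℂ] (Sp n × W → ℂ) :=
    AlgHom.pi fun q => MvPolynomial.aeval (pt (q.1 : Mat n) (q.2 : Mat n))
  have hev : ∀ P, ev P = 0 ↔ ∀ g₀ : Sp n, ∀ Y₀ ∈ W, MvPolynomial.eval (pt (g₀ : Mat n) Y₀) P = 0 := by
    intro P
    rw [funext_iff]
    exact ⟨fun h g₀ Y₀ hY₀ => h (g₀, ⟨Y₀, hY₀⟩), fun h q => h q.1 q.2 q.2.2⟩
  have hprime : (RingHom.ker ev).IsPrime := by
    refine ⟨fun h => ?_, fun {F F'} h => ?_⟩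
    · obtain ⟨Y₀, hY₀⟩ := hne
      have h1 := (hev 1).1 ((RingHom.mem_ker).1 (h ▸ Submodule.mem_top)) 1 Y₀ hY₀
      rw [map_one] at h1
      exact one_ne_zero h1
    · rw [RingHom.mem_ker, RingHom.mem_ker, hev, hev]
      refine irreducible_symplectic_prod W hW F F' fun g Y hY => ?_
      rw [← map_mul]
      exact (hev _).1 ((RingHom.mem_ker).1 h) g Y hY
  let A := Poly n ⧸ RingHom.ker ev
  let φ : Poly n →ₐ[ℂ] FractionRing A :=
    (IsScalarTower.toAlgHom ℂ A (FractionRing A)).comp (Ideal.Quotient.mkₐ ℂ (RingHom.ker ev))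
  refine ⟨FractionRing A, inferInstance, inferInstance,
    Matrix.of fun i j => φ (MvPolynomial.X (Sum.inl (i, j))),
    Matrix.of fun i j => φ (MvPolynomial.X (Sum.inr (i, j))), fun P => ?_⟩
  have e : MvPolynomial.aeval (pt (Matrix.of fun i j => φ (MvPolynomial.X (Sum.inl (i, j))))
      (Matrix.of fun i j => φ (MvPolynomial.X (Sum.inr (i, j))))) = φ := by
    refine MvPolynomial.algHom_ext fun i => ?_
    rw [MvPolynomial.aeval_X]
    rcases i with i | i <;> rfl
  rw [e, ← hev, ← RingHom.mem_ker (f := ev), ← Ideal.Quotient.eq_zero_iff_mem]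
  exact map_eq_zero_iff (algebraMap A (FractionRing A)) (IsFractionRing.injective A (FractionRing A))

/-- The generic matrix of the first factor. -/
def polyG (n : ℕ) : Matrix (Fin n ⊕ Fin n) (Fin n ⊕ Fin n) (Poly n) :=
  Matrix.of fun i j => MvPolynomial.X (Sum.inl (i, j))

/-- The generic matrix of the second factor. -/
def polyY (n : ℕ) : Matrix (Fin n ⊕ Fin n) (Fin n ⊕ Fin n) (Poly n) :=
  Matrix.of fun i j => MvPolynomial.X (Sum.inr (i, j))

section
variable {E : Type*} [CommRing E] [Algebra ℂ E] (g Y : Matrix (Fin n ⊕ Fin n) (Fin n ⊕ Fin n) E)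

lemma aeval_polyG : (polyG n).map (MvPolynomial.aeval (pt g Y) : _ →ₐ[ℂ] E) = g := by
  ext i j
  simp [polyG, pt]

lemma aeval_polyY : (polyY n).map (MvPolynomial.aeval (pt g Y) : _ →ₐ[ℂ] E) = Y := by
  ext i j
  simp [polyY, pt]

/-- The polynomials which express the entries of `g Y g⁻¹`. -/
def polyA (n : ℕ) : Matrix (Fin n ⊕ Fin n) (Fin n ⊕ Fin n) (Poly n) :=
  polyG n * polyY n * sadj (polyG n)

lemma aeval_polyA : (polyA n).map (MvPolynomial.aeval (pt g Y) : _ →ₐ[ℂ] E) = g * Y * sadj g := by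
  rw [polyA, Matrix.map_mul, Matrix.map_mul, map_sadj_algHom, aeval_polyG, aeval_polyY]

end

lemma eval_map_apply (M : Matrix (Fin n ⊕ Fin n) (Fin n ⊕ Fin n) (Poly n)) (g Y : Mat n) (i j) :
    MvPolynomial.eval (pt g Y) (M i j) =
      M.map (MvPolynomial.aeval (pt g Y) : _ →ₐ[ℂ] ℂ) i j := by
  rw [Matrix.map_apply, MvPolynomial.aeval_eq_eval]

lemma eval_polyA (g Y : Mat n) (i j) :
    MvPolynomial.eval (pt g Y) (polyA n i j) = (g * Y * sadj g) i j := by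
  rw [eval_map_apply, aeval_polyA]

lemma eval_polyY (g Y : Mat n) (i j) : MvPolynomial.eval (pt g Y) (polyY n i j) = Y i j := by
  rw [eval_map_apply, aeval_polyY]

lemma aeval_apply_polyA {E : Type*} [CommRing E] [Algebra ℂ E]
    (g Y : Matrix (Fin n ⊕ Fin n) (Fin n ⊕ Fin n) E) (i j) :
    MvPolynomial.aeval (pt g Y) (polyA n i j) = (g * Y * sadj g) i j := by
  exact congrFun (congrFun (aeval_polyA g Y) i) j

lemma aeval_apply_polyY {E : Type*} [CommRing E] [Algebra ℂ E]
    (g Y : Matrix (Fin n ⊕ Fin n) (Fin n ⊕ Fin n) E) (i j) :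
    MvPolynomial.aeval (pt g Y) (polyY n i j) = Y i j := by
  exact congrFun (congrFun (aeval_polyY g Y) i) j

lemma isInvariant_polyA (i j) : IsInvariant d (polyA n i j) := by
  intro g p _ Y _
  rw [eval_polyA, eval_polyA, sadj_mul]
  simp only [Matrix.mul_assoc]

lemma isInvariant_polyY_diag (i) : IsInvariant d (polyY n i i) := by
  intro g p hp Y hY
  rw [eval_polyY, eval_polyY, hY.conj_diag hp (mul_sadj p)]

/-- Stability of 𝔲 ⊕ 𝔷(𝔩) under P lets the condition relating Y and Y' be solved for one of them, so
invariance becomes a polynomial identity in g, p and Y. -/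
lemma mem_coordRing_iff (f : Sp n × commPerp d → ℂ) : f ∈ coordRing d ↔
    ∃ F : Poly n, IsInvariant d F ∧
      ∀ g : Sp n, ∀ Y : commPerp d, f (g, Y) = MvPolynomial.eval (pt (g : Mat n) (Y : Mat n)) F := by
  constructor
  · rintro ⟨⟨F, hF⟩, hf⟩
    refine ⟨F, fun g p hp Y hY => ?_, hF⟩
    have h1 := hf g p hp ⟨(p : Mat n) * Y * sadj (p : Mat n), mem_commPerp_iff.2
      (hY.conj hp (mul_sadj p))⟩ ⟨Y, mem_commPerp_iff.2 hY⟩ (by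
        rw [Matrix.mul_assoc _ (sadj _), sadj_mul_self, Matrix.mul_one])
    rw [hF, hF] at h1
    exact h1
  · rintro ⟨F, hFi, hF⟩
    refine ⟨⟨F, hF⟩, fun g p hp Y Y' h => ?_⟩
    have h1 := hFi g p hp Y' (mem_commPerp_iff.1 Y'.2)
    rw [h, Matrix.mul_assoc, mul_sadj, Matrix.mul_one] at h1
    rw [hF, hF]
    exact h1

/-- The element of the coordinate ring defined by an invariant polynomial. -/
def ofPoly (F : Poly n) (hF : IsInvariant d F) : coordRing d :=
  ⟨fun q => MvPolynomial.eval (pt (q.1 : Mat n) (q.2 : Mat n)) F,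
    (mem_coordRing_iff _).2 ⟨F, hF, fun _ _ => rfl⟩⟩

/-- The matrix `g Y g⁻¹` with entries in the coordinate ring. -/
def conjMat (d : Fin n → ℤ) : Matrix (Fin n ⊕ Fin n) (Fin n ⊕ Fin n) (coordRing d) :=
  Matrix.of fun i j => ofPoly (polyA n i j) (isInvariant_polyA i j)

/-- The diagonal entries of `Y`, as elements of the coordinate ring. -/
def diagEntry (d : Fin n → ℤ) (i : Fin n ⊕ Fin n) : coordRing d :=
  ofPoly (polyY n i i) (isInvariant_polyY_diag i)

/-- Evaluation of an element of the coordinate ring. -/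
def evalAt (q : Sp n × commPerp d) : coordRing d →ₐ[ℂ] ℂ :=
  (Pi.evalAlgHom ℂ _ q).comp (coordRing d).val

lemma evalAt_apply (q : Sp n × commPerp d) (f : coordRing d) :
    evalAt q f = (f : Sp n × commPerp d → ℂ) q := rfl

lemma coordRing_ext {f f' : coordRing d} (h : ∀ q, evalAt q f = evalAt q f') : f = f' :=
  Subtype.ext (funext h)

lemma evalAt_conjMat (g : Sp n) (Y : commPerp d) (i j) :
    evalAt (g, Y) (conjMat d i j) = ((g : Mat n) * (Y : Mat n) * sadj (g : Mat n)) i j :=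
  eval_polyA _ _ i j

lemma evalAt_diagEntry (g : Sp n) (Y : commPerp d) (i) :
    evalAt (g, Y) (diagEntry d i) = (Y : Mat n) i i := eval_polyY _ _ i i

lemma conjMat_map (g : Sp n) (Y : commPerp d) :
    (conjMat d).map (evalAt (g, Y)) = (g : Mat n) * (Y : Mat n) * sadj (g : Mat n) := by
  ext i j
  exact evalAt_conjMat g Y i j

lemma diagEntry_eq {i j : Fin n ⊕ Fin n} (h : wt d i = wt d j) : diagEntry d i = diagEntry d j :=
  coordRing_ext fun ⟨g, Y⟩ => by
    rw [evalAt_diagEntry, evalAt_diagEntry, (mem_commPerp_iff.1 Y.2).diag i j h]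

/-- A torus element with distinct eigenvalues. -/
lemma exists_torus (n : ℕ) : ∃ (t : Sp n) (v : Fin n ⊕ Fin n → ℂ), (t : Mat n) = diagonal v ∧
    Function.Injective v ∧ ∀ i, v i * v i.swap = 1 := by
  have hpos : ∀ i : Fin n, ((i : ℂ) + 2) ≠ 0 := fun i => by
    have : ((i + 2 : ℕ) : ℂ) ≠ 0 := Nat.cast_ne_zero.2 (by omega)
    simpa using this
  -- The numbers i + 2 are distinct and at least 2, so no product of two of them is 1 and they
  -- differ from all the inverses.
  let v : Fin n ⊕ Fin n → ℂ := Sum.elim (fun i => (i : ℂ) + 2) fun i => ((i : ℂ) + 2)⁻¹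
  have hv : ∀ i, v i * v i.swap = 1 := by
    rintro (i | i) <;> simp [v, hpos i]
  have hs : sadj (diagonal v) = diagonal fun i => v i.swap := by
    ext i j
    rw [sadj_apply, diagonal_apply, diagonal_apply]
    by_cases h : i = j
    · subst h
      simp [sg_mul_self]
    · rw [if_neg h, if_neg fun e => h (Sum.swap_leftInverse.injective e).symm, mul_zero]
  refine ⟨⟨diagonal v, (mem_symplectic_iff _).2 ?_⟩, v, rfl, ?_, hv⟩
  · rw [hs, diagonal_mul_diagonal]
    simp [hv]
  · have key : ∀ i j : Fin n, ((i : ℂ) + 2) * ((j : ℂ) + 2) ≠ 1 := fun i j h => by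
      have h' : (((i + 2) * (j + 2) : ℕ) : ℂ) = (1 : ℕ) := by push_cast; exact h
      have := Nat.cast_injective h'
      nlinarith
    rintro (i | i) (j | j) h <;> simp only [v, Sum.elim_inl, Sum.elim_inr] at h
    · exact congrArg _ (Fin.ext (by simpa using h))
    · exact absurd (by rw [h, inv_mul_cancel₀ (hpos j)]) (key i j)
    · exact absurd (by rw [← h, inv_mul_cancel₀ (hpos i)]) (key j i)
    · exact congrArg _ (Fin.ext (by simpa using h))

/-- Under a regular torus element t, the (i,j) entry of A is multiplied by v_i v_j⁻¹ ≠ 1. It is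
therefore a scalar multiple of a generator t·f - f. -/
theorem conjMat_mem_fixedIdeal {i j : Fin n ⊕ Fin n} (hij : i ≠ j) :
    conjMat d i j ∈ fixedIdeal d := by
  obtain ⟨t, v, ht, hv, hvs⟩ := exists_torus n
  have h1 : algebraMap ℂ (coordRing d) (v i * v j.swap - 1) * conjMat d i j ∈ fixedIdeal d := by
    refine Ideal.subset_span ⟨t, by rw [ht]; exact isDiag_diagonal v, conjMat d i j, fun g Y => ?_⟩
    have hts : sadj (t : Mat n) = diagonal fun k => v k.swap := by
      have e : (t : Mat n) * diagonal (fun k => v k.swap) = 1 := by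
        rw [ht, diagonal_mul_diagonal]
        simp [hvs]
      calc sadj (t : Mat n) = sadj (t : Mat n) * ((t : Mat n) * diagonal (fun k => v k.swap)) := by
            rw [e, Matrix.mul_one]
        _ = _ := by rw [← Matrix.mul_assoc, sadj_mul_self, Matrix.one_mul]
    rw [← evalAt_apply, ← evalAt_apply, ← evalAt_apply, map_mul, AlgHom.commutes, evalAt_conjMat,
      evalAt_conjMat]
    have e : ((t * g : Sp n) : Mat n) * (Y : Mat n) * sadj ((t * g : Sp n) : Mat n) =
        diagonal v * ((g : Mat n) * (Y : Mat n) * sadj (g : Mat n)) * diagonal fun k => v k.swap := by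
      rw [← hts, ← ht]
      change (t : Mat n) * (g : Mat n) * (Y : Mat n) * sadj ((t : Mat n) * (g : Mat n)) = _
      rw [sadj_mul]
      simp only [Matrix.mul_assoc]
    rw [e, mul_diagonal, diagonal_mul]
    simp only [Algebra.algebraMap_self, RingHom.id_apply]
    ring
  have hne : v i * v j.swap - 1 ≠ 0 := fun h => hij (hv (by
    have h2 := hvs j
    linear_combination v j * h - v i * h2))
  have h2 := Ideal.mul_mem_left _ (algebraMap ℂ (coordRing d) (v i * v j.swap - 1)⁻¹) h1
  rwa [← mul_assoc, ← map_mul, inv_mul_cancel₀ hne, map_one, one_mul] at h2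

/-- A family of elements indexed by the weights from one indexed by the basis. -/
lemma exists_weight_fun {E : Type*} [Zero E] (y : Fin n ⊕ Fin n → E)
    (h : ∀ i j, wt d i = wt d j → y i = y j) : ∃ z : ℤ → E, ∀ i, y i = z (wt d i) := by
  classical
  refine ⟨fun m => if h : ∃ i, wt d i = m then y h.choose else 0, fun i => ?_⟩
  have hi : ∃ j, wt d j = wt d i := ⟨i, rfl⟩
  simp only [dif_pos hi]
  exact h _ _ hi.choose_spec.symm

lemma map_aeval_matrix {R B : Type*} [CommRing R] [CommRing B] (φ : R →+* B)
    (M : Matrix (Fin n ⊕ Fin n) (Fin n ⊕ Fin n) R) (P : Polynomial R) :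
    (Polynomial.aeval M P).map φ = Polynomial.aeval (M.map φ) (P.map φ) := by
  have h := Polynomial.hom_eval₂ P (algebraMap R _) φ.mapMatrix M
  have e : (φ.mapMatrix (m := Fin n ⊕ Fin n)).comp (algebraMap R _) = (algebraMap B _).comp φ := by
    ext r i j
    simp [Matrix.algebraMap_matrix_apply, apply_ite φ]
  rw [e, ← Polynomial.eval₂_map] at h
  exact h

lemma aeval_conj {B : Type*} [CommRing B] (g h Y : Matrix (Fin n ⊕ Fin n) (Fin n ⊕ Fin n) B)
    (hg : g * h = 1) (P : Polynomial B) :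
    Polynomial.aeval (g * Y * h) P = g * Polynomial.aeval Y P * h := by
  have hh := mul_eq_one_comm.1 hg
  have hp : ∀ k : ℕ, (g * Y * h) ^ k = g * Y ^ k * h := by
    intro k
    induction k with
    | zero => rw [pow_zero, pow_zero, Matrix.mul_one, hg]
    | succ k ih =>
      rw [pow_succ, ih, pow_succ, show g * Y ^ k * h * (g * Y * h) = g * Y ^ k * (h * g) * Y * h by
        simp only [Matrix.mul_assoc], hh]
      simp only [Matrix.mul_assoc, Matrix.one_mul]
  induction P using Polynomial.induction_on' with
  | add p q hp hq => rw [map_add, map_add, hp, hq, Matrix.mul_add, Matrix.add_mul]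
  | monomial k c =>
    rw [Polynomial.aeval_monomial, Polynomial.aeval_monomial, hp, ← Algebra.smul_def,
      ← Algebra.smul_def, Matrix.mul_smul, Matrix.smul_mul]

/-- The generic conjugate satisfies the polynomial whose roots are the diagonal entries. -/
theorem aeval_conjMat_prod (z : ℤ → coordRing d) (hz : ∀ i, diagEntry d i = z (wt d i)) :
    Polynomial.aeval (conjMat d) (∏ m ∈ Finset.univ.image (wt d),
      (Polynomial.X - Polynomial.C (z m))) = 0 := by
  ext1 i j
  refine coordRing_ext fun q => ?_
  obtain ⟨g, Y⟩ := q
  have hY := mem_commPerp_iff.1 Y.2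
  have h1 := map_aeval_matrix (evalAt (g, Y) : coordRing d →+* ℂ) (conjMat d)
    (∏ m ∈ Finset.univ.image (wt d), (Polynomial.X - Polynomial.C (z m)))
  have h2 : (conjMat d).map (evalAt (g, Y) : coordRing d →+* ℂ) = _ := conjMat_map g Y
  rw [h2, Polynomial.map_prod, aeval_conj _ _ _ (mul_sadj g)] at h1
  simp only [Polynomial.map_sub, Polynomial.map_X, Polynomial.map_C, RingHom.coe_coe] at h1
  rw [hY.aeval_prod_eq_zero (fun m => evalAt (g, Y) (z m)) fun i => by
    rw [← hz, evalAt_diagEntry], Matrix.mul_zero, Matrix.zero_mul] at h1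
  have h3 := congrFun (congrFun h1 i) j
  rw [Matrix.zero_apply, map_zero]
  exact h3

theorem conjMat_charpoly :
    (conjMat d).charpoly = ∏ i, (Polynomial.X - Polynomial.C (diagEntry d i)) := by
  ext1 k
  refine coordRing_ext fun q => ?_
  obtain ⟨g, Y⟩ := q
  have hY := mem_commPerp_iff.1 Y.2
  have h1 := Matrix.charpoly_map (conjMat d) (evalAt (g, Y) : coordRing d →+* ℂ)
  have h2 : (conjMat d).map (evalAt (g, Y) : coordRing d →+* ℂ) = _ := conjMat_map g Y
  have h3 : ((g : Mat n) * (Y : Mat n) * sadj (g : Mat n)).charpoly = (Y : Mat n).charpoly := by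
    rw [Matrix.charpoly_mul_comm, ← Matrix.mul_assoc, sadj_mul_self, Matrix.one_mul]
  rw [h2, h3, hY.charpoly_eq] at h1
  have h4 : (∏ i, (Polynomial.X - Polynomial.C (diagEntry d i))).map
      (evalAt (g, Y) : coordRing d →+* ℂ) = ∏ i, (Polynomial.X - Polynomial.C ((Y : Mat n) i i)) := by
    rw [Polynomial.map_prod]
    refine Finset.prod_congr rfl fun i _ => ?_
    rw [Polynomial.map_sub, Polynomial.map_X, Polynomial.map_C, ← evalAt_diagEntry g Y]
    rfl
  have h5 := congrArg (fun p => Polynomial.coeff p k) (h1.symm.trans h4.symm)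
  simpa only [Polynomial.coeff_map, RingHom.coe_coe] using h5

lemma aeval_diagonal {B : Type*} [CommRing B] (a : Fin n ⊕ Fin n → B) (P : Polynomial B) :
    Polynomial.aeval (diagonal a) P = diagonal fun i => P.eval (a i) := by
  have h := Polynomial.aeval_algHom_apply (Matrix.diagonalAlgHom (n := Fin n ⊕ Fin n) (α := B) B) a P
  have e : Polynomial.aeval a P = fun i => P.eval (a i) := by
    ext i
    rw [← Polynomial.coe_aeval_eq_eval]
    exact (Polynomial.aeval_algHom_apply (Pi.evalAlgHom B (fun _ => B) i) a P).symm
  rw [e] at h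
  exact h

/-- If `diag(a,-a)` satisfies a separable polynomial, and its characteristic polynomial has at most
`c` pairs of non-zero roots, then products of `c+1` of the `a_i` vanish. -/
theorem prod_eq_zero_of_charpoly {B : Type*} [CommRing B] [Algebra ℂ B] (a : Fin n → B)
    (Λ : Finset ℂ) (hΛ : ∀ i, ∏ μ ∈ Λ, (a i - algebraMap ℂ B μ) = 0) (y : Fin n → ℂ)
    (hy : ∏ i, ((Polynomial.X - Polynomial.C (a i)) * (Polynomial.X + Polynomial.C (a i))) =
      (∏ i, ((Polynomial.X - Polynomial.C (y i)) * (Polynomial.X + Polynomial.C (y i)))).map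
        (algebraMap ℂ B))
    (S : Finset (Fin n)) (hS : (Finset.univ.filter fun i => y i ≠ 0).card < S.card) :
    ∏ i ∈ S, a i = 0 := by
  let φ : MvPolynomial (Fin n) ℂ →ₐ[ℂ] B := MvPolynomial.aeval a
  have hφ : ∀ i, φ (MvPolynomial.X i) = a i := fun i => MvPolynomial.aeval_X _ _
  have key : ∏ i ∈ S, (MvPolynomial.X i : MvPolynomial (Fin n) ℂ) ∈ RingHom.ker φ := by
    refine prod_X_mem_of_zeros _ Λ (fun i => ?_) S fun v hv => ?_
    · rw [RingHom.mem_ker, map_prod, ← hΛ i]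
      refine Finset.prod_congr rfl fun μ _ => ?_
      rw [map_sub, hφ, MvPolynomial.algHom_C]
    · set Q : Polynomial (MvPolynomial (Fin n) ℂ) :=
        ∏ i, ((Polynomial.X - Polynomial.C (MvPolynomial.X i)) *
          (Polynomial.X + Polynomial.C (MvPolynomial.X i))) with hQ
      set Q' := ∏ i, ((Polynomial.X - Polynomial.C (y i)) * (Polynomial.X + Polynomial.C (y i)))
        with hQ'
      have h1 : Q.map (φ : _ →+* B) = (Q'.map (algebraMap ℂ (MvPolynomial (Fin n) ℂ))).map
          (φ : _ →+* B) := by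
        rw [Polynomial.map_map, hQ, Polynomial.map_prod]
        simp only [Polynomial.map_mul, Polynomial.map_sub, Polynomial.map_add, Polynomial.map_X,
          Polynomial.map_C, RingHom.coe_coe, hφ]
        rw [hy]
        congr 1
        exact (φ.comp_algebraMap).symm
      have h2 : Q.map (MvPolynomial.eval v) = Q' := by
        have : Q.map (MvPolynomial.eval v) = (Q'.map (algebraMap ℂ (MvPolynomial (Fin n) ℂ))).map
            (MvPolynomial.eval v) := by
          ext k
          rw [Polynomial.coeff_map, Polynomial.coeff_map, ← sub_eq_zero, ← map_sub]
          refine hv _ ?_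
          rw [RingHom.mem_ker, map_sub, sub_eq_zero]
          have := congrArg (fun p => Polynomial.coeff p k) h1
          simpa only [Polynomial.coeff_map, RingHom.coe_coe] using this
        rw [this, Polynomial.map_map]
        have e : (MvPolynomial.eval v).comp (algebraMap ℂ (MvPolynomial (Fin n) ℂ)) =
            RingHom.id ℂ := RingHom.ext fun c => MvPolynomial.eval_C c
        rw [e, Polynomial.map_id]
      -- At a complex zero v, comparing multiplicities of the root 0 shows that v has as many zero
      -- coordinates as y. With fewer than |S| nonzero ones, some coordinate in S must vanish.
      have h3 := congrArg (Polynomial.rootMultiplicity 0) h2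
      rw [hQ, Polynomial.map_prod] at h3
      simp only [Polynomial.map_mul, Polynomial.map_sub, Polynomial.map_add, Polynomial.map_X,
          Polynomial.map_C, MvPolynomial.eval_X] at h3
      have hrm : ∀ u : Fin n → ℂ, Polynomial.rootMultiplicity 0 (∏ i, ((Polynomial.X -
          Polynomial.C (u i)) * (Polynomial.X + Polynomial.C (u i)))) =
          2 * (Finset.univ.filter fun i => u i = 0).card := by
        intro u
        have hne : ∀ i, ((Polynomial.X - Polynomial.C (u i)) *
            (Polynomial.X + Polynomial.C (u i))) ≠ 0 := fun i =>
          mul_ne_zero (Polynomial.X_sub_C_ne_zero _) (Polynomial.X_add_C_ne_zero _)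
        rw [← Polynomial.count_roots, Polynomial.roots_prod _ _ (Finset.prod_ne_zero_iff.2
          fun i _ => hne i), Multiset.count_bind, Finset.card_filter, Finset.mul_sum]
        change ∑ i, _ = _
        refine Finset.sum_congr rfl fun i _ => ?_
        rw [Polynomial.roots_mul (hne i), Polynomial.roots_X_sub_C, Polynomial.roots_X_add_C,
          Multiset.count_add, Multiset.count_singleton, Multiset.count_singleton]
        by_cases h : u i = 0
        · simp [h]
        · simp [h, Ne.symm h, eq_comm]
      rw [hrm, hQ', hrm] at h3
      by_contra! hc
      have h4 : S ⊆ Finset.univ.filter fun i => v i ≠ 0 := fun i hi => by simpa using hc i hi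
      have h5 := Finset.card_le_card h4
      have h6 := Finset.card_filter_add_card_filter_not (s := Finset.univ) (fun i : Fin n => v i = 0)
      have h7 := Finset.card_filter_add_card_filter_not (s := Finset.univ) (fun i : Fin n => y i = 0)
      simp only [ne_eq] at *
      omega
  rw [RingHom.mem_ker, map_prod] at key
  simpa only [hφ] using key

/-- Intertwiners of generic elements of `[𝔭,𝔭]^⊥` lie in the parabolic subgroup. -/
theorem isPar_of_mul_eq_mul {E : Type*} [Field E] {h Y Y' : Matrix (Fin n ⊕ Fin n) (Fin n ⊕ Fin n) E}
    (hY : IsComm d Y) (hY' : IsComm d Y') (hdiag : ∀ i, Y i i = Y' i i)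
    (hne : ∀ i j, wt d i ≠ wt d j → Y i i ≠ Y j j) (hh : h * Y = Y' * h) : IsPar d h := by
  obtain ⟨b, hb⟩ := (Set.finite_range fun p : (Fin n ⊕ Fin n) × (Fin n ⊕ Fin n) =>
    wt d p.2 - wt d p.1).bddAbove
  have hb' : ∀ i j, wt d j - wt d i ≤ b := fun i j => hb ⟨(i, j), rfl⟩
  -- Induction starting from the largest weight gap. Once the entries of larger gap vanish, the
  -- (i,j) entry of hY = Y'h reduces to (Y_jj - Y_ii)h_ij = 0. The bound b only serves to count
  -- down.
  suffices key : ∀ k : ℕ, ∀ i j, wt d i < wt d j → b - (wt d j - wt d i) < k → h i j = 0 from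
    fun i j hij => key (b - (wt d j - wt d i) + 1).toNat i j hij (by
      have := hb' i j
      omega)
  intro k
  induction k with
  | zero =>
    intro i j _ hk
    have := hb' i j
    omega
  | succ k ih =>
    intro i j hij hk
    have e := congrFun (congrFun hh i) j
    rw [Matrix.mul_apply, Matrix.mul_apply, Finset.sum_eq_single j, Finset.sum_eq_single i] at e
    · have h1 : (Y j j - Y' i i) * h i j = 0 := by linear_combination e
      rw [← hdiag] at h1
      exact (mul_eq_zero.1 h1).resolve_left (sub_ne_zero.2 (hne j i hij.ne'))
    · intro l _ hl
      by_cases hil : wt d i ≤ wt d l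
      · rw [hY'.zero i l hil (Ne.symm hl), zero_mul]
      · rw [ih l j (by omega) (by push_cast at hk; omega), mul_zero]
    · simp
    · intro l _ hl
      by_cases hlj : wt d l ≤ wt d j
      · rw [hY.zero l j hlj hl, mul_zero]
      · rw [ih i l (by omega) (by push_cast at hk; omega), zero_mul]
    · simp

end CoordRing

/-! ### Finiteness of the coordinate ring and its restriction to a Richardson orbit -/

section Finiteness

variable {n : ℕ} {d : Fin n → ℤ}

lemma map_aeval_eq_zero {K : Type} [Field K] [Algebra ℂ K]
    {g Y : Matrix (Fin n ⊕ Fin n) (Fin n ⊕ Fin n) K} {W : Set (Mat n)}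
    (h : ∀ P : Poly n, MvPolynomial.aeval (pt g Y) P = 0 ↔
        ∀ g₀ : Sp n, ∀ Y₀ ∈ W, MvPolynomial.eval (pt (g₀ : Mat n) Y₀) P = 0)
    (M : Matrix (Fin n ⊕ Fin n) (Fin n ⊕ Fin n) (Poly n)) (i j)
    (hM : ∀ g₀ : Sp n, ∀ Y₀ ∈ W,
      M.map (MvPolynomial.aeval (pt (g₀ : Mat n) Y₀) : _ →ₐ[ℂ] ℂ) i j = 0) :
    M.map (MvPolynomial.aeval (pt g Y) : _ →ₐ[ℂ] K) i j = 0 :=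
  (h (M i j)).2 fun g₀ Y₀ hY₀ => by rw [eval_map_apply]; exact hM g₀ Y₀ hY₀

/-- The homomorphism from the coordinate ring to the field of rational functions on `G × W`, where
`W` is an affine subspace of `[𝔭,𝔭]^⊥`. -/
theorem exists_generic_hom (W : Set (Mat n)) (hne : W.Nonempty)
    (hW : ∀ Y ∈ W, ∀ Y' ∈ W, ∀ t : ℂ, Y + t • (Y' - Y) ∈ W) (hWd : W ⊆ commPerp d) :
    ∃ (K : Type) (_ : Field K) (_ : Algebra ℂ K) (g Y : Matrix (Fin n ⊕ Fin n) (Fin n ⊕ Fin n) K)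
      (Φ : coordRing d →ₐ[ℂ] K), g * sadj g = 1 ∧ IsComm d Y ∧
      (∀ P : Poly n, MvPolynomial.aeval (pt g Y) P = 0 ↔
        ∀ g₀ : Sp n, ∀ Y₀ ∈ W, MvPolynomial.eval (pt (g₀ : Mat n) Y₀) P = 0) ∧
      ∀ (f : coordRing d) (P : Poly n), (∀ (g₀ : Sp n) (Y₀ : Mat n) (h : Y₀ ∈ W),
        evalAt (g₀, ⟨Y₀, hWd h⟩) f = MvPolynomial.eval (pt (g₀ : Mat n) Y₀) P) →
        Φ f = MvPolynomial.aeval (pt g Y) P := by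
  obtain ⟨K, _, _, g, Y, h⟩ := exists_generic_point W hne hW
  have hg : g * sadj g = 1 := by
    rw [← sub_eq_zero]
    ext i j
    have := map_aeval_eq_zero h (polyG n * sadj (polyG n) - 1) i j fun g₀ Y₀ _ => by
      rw [Matrix.map_sub _ (map_sub _), Matrix.map_mul, map_sadj_algHom, aeval_polyG,
        Matrix.map_one _ (map_zero _) (map_one _), mul_sadj, sub_self, Matrix.zero_apply]
    rwa [Matrix.map_sub _ (map_sub _), Matrix.map_mul, map_sadj_algHom, aeval_polyG,
        Matrix.map_one _ (map_zero _) (map_one _)] at this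
  have hY : IsComm d Y := by
    refine ⟨?_, fun i j hij hne => ?_, fun i j hij => ?_⟩
    · rw [eq_neg_iff_add_eq_zero]
      ext i j
      have := map_aeval_eq_zero h (sadj (polyY n) + polyY n) i j fun g₀ Y₀ hY₀ => by
        rw [Matrix.map_add _ (map_add _), map_sadj_algHom, aeval_polyY,
          (mem_commPerp_iff.1 (hWd hY₀)).skew]
        simp
      rwa [Matrix.map_add _ (map_add _), map_sadj_algHom, aeval_polyY] at this
    · have := map_aeval_eq_zero h (polyY n) i j fun g₀ Y₀ hY₀ => by
        rw [aeval_polyY, (mem_commPerp_iff.1 (hWd hY₀)).zero i j hij hne]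
      rwa [aeval_polyY] at this
    · have := (h (polyY n i i - polyY n j j)).2 fun g₀ Y₀ hY₀ => by
        rw [map_sub, eval_polyY, eval_polyY, (mem_commPerp_iff.1 (hWd hY₀)).diag i j hij, sub_self]
      rw [map_sub, aeval_apply_polyY, aeval_apply_polyY] at this
      exact sub_eq_zero.1 this
  choose F hFi hF using fun f : coordRing d => (mem_coordRing_iff _).1 f.2
  have key : ∀ (f : coordRing d) (P : Poly n), (∀ (g₀ : Sp n) (Y₀ : Mat n) (h : Y₀ ∈ W),
        evalAt (g₀, ⟨Y₀, hWd h⟩) f = MvPolynomial.eval (pt (g₀ : Mat n) Y₀) P) →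
        MvPolynomial.aeval (pt g Y) (F f) = MvPolynomial.aeval (pt g Y) P := by
    intro f P hP
    rw [← sub_eq_zero, ← map_sub]
    refine (h _).2 fun g₀ Y₀ hY₀ => ?_
    rw [map_sub, ← hP g₀ Y₀ hY₀, sub_eq_zero]
    exact (hF f g₀ ⟨Y₀, hWd hY₀⟩).symm
  have hFe : ∀ f g₀ Y₀ (h : Y₀ ∈ W), evalAt (g₀, ⟨Y₀, hWd h⟩) f =
      MvPolynomial.eval (pt (g₀ : Mat n) Y₀) (F f) := fun f g₀ Y₀ hY₀ => hF f g₀ ⟨Y₀, hWd hY₀⟩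
  let Φ : coordRing d →ₐ[ℂ] K :=
    { toFun := fun f => MvPolynomial.aeval (pt g Y) (F f)
      map_one' := (key 1 1 fun _ _ _ => by rw [map_one, map_one]).trans (map_one _)
      map_zero' := (key 0 0 fun _ _ _ => by rw [map_zero, map_zero]).trans (map_zero _)
      map_mul' := fun f f' => (key (f * f') (F f * F f') fun _ _ hY => by
        rw [map_mul, map_mul, hFe _ _ _ hY, hFe _ _ _ hY]).trans (map_mul _ _ _)
      map_add' := fun f f' => (key (f + f') (F f + F f') fun _ _ hY => by
        rw [map_add, map_add, hFe _ _ _ hY, hFe _ _ _ hY]).trans (map_add _ _ _)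
      commutes' := fun c => (key (algebraMap ℂ _ c) (MvPolynomial.C c) fun _ _ _ => by
        rw [AlgHom.commutes, MvPolynomial.eval_C]; rfl).trans (MvPolynomial.algHom_C _ _) }
  exact ⟨K, _, _, g, Y, Φ, hg, hY, h, key⟩

/-- A criterion for an invariant function to be a rational function of given functions. -/
lemma mem_intermediateField_of_invariant {F : Poly n} (hF : IsInvariant d F) {K : Type} [Field K]
    [Algebra ℂ K] {g Y : Matrix (Fin n ⊕ Fin n) (Fin n ⊕ Fin n) K} (hg : g * sadj g = 1)
    (hY : IsComm d Y) (k : IntermediateField ℂ K) (hk : ∀ i j, (g * Y * sadj g) i j ∈ k)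
    (hpar : ∀ (E : Type) [Field E] [Algebra ℂ E] (a b : K →ₐ[ℂ] E), (∀ x ∈ k, a x = b x) →
      IsPar d (sadj (g.map b) * g.map a) ∧
        sadj (g.map b) * g.map a * Y.map a = Y.map b * (sadj (g.map b) * g.map a)) :
    MvPolynomial.aeval (pt g Y) F ∈ k := by
  have hint : IsIntegral k (MvPolynomial.aeval (pt g Y) F) := hF.isIntegral hg hY k.toSubalgebra hk
  have hchar : CharZero k := charZero_of_injective_algebraMap (algebraMap ℂ k).injective
  -- F is integral over k, so it suffices that two embeddings a, b agreeing on k agree on F. The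
  -- element p = b(g)⁻¹a(g) is a P-point carrying a(Y) to b(Y), and invariance of F under p gives
  -- the equality.
  obtain ⟨x, hx⟩ := mem_range_of_forall_ringHom_eq hint fun E _ a b hab => by
    let : Algebra ℂ E := (a.comp (algebraMap ℂ K)).toAlgebra
    have hab' : ∀ x ∈ k, a x = b x := fun x hx => RingHom.congr_fun hab ⟨x, hx⟩
    let a' : K →ₐ[ℂ] E := { a with commutes' := fun c => rfl }
    let b' : K →ₐ[ℂ] E := { b with commutes' := fun c => (hab' _ (k.algebraMap_mem c)).symm }
    have hmap : ∀ c : K →ₐ[ℂ] E, g.map c * sadj (g.map c) = 1 := fun c => by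
      rw [← map_sadj_algHom, ← Matrix.map_mul, hg, Matrix.map_one _ (map_zero _) (map_one _)]
    obtain ⟨h1, h2⟩ := hpar E a' b' hab'
    set p := sadj (g.map b') * g.map a' with hp
    have hpp : p * sadj p = 1 := by
      rw [hp, sadj_mul, sadj_sadj, Matrix.mul_assoc, ← Matrix.mul_assoc (g.map a'), hmap,
        Matrix.one_mul]
      exact mul_eq_one_comm.1 (hmap b')
    have h3 := hF.aeval_eq (hmap b') hpp h1 (hY.map (a' : K →+* E))
    have h4 : g.map b' * p = g.map a' := by
      rw [hp, ← Matrix.mul_assoc, hmap, Matrix.one_mul]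
    have h5 : p * Y.map a' * sadj p = Y.map b' := by
      rw [h2, Matrix.mul_assoc, hpp, Matrix.mul_one]
    rw [h4] at h3
    change MvPolynomial.aeval (pt (g.map a') (Y.map a')) F =
      MvPolynomial.aeval (pt (g.map b') (p * Y.map a' * sadj p)) F at h3
    rw [h5, ← aeval_pt_comp, ← aeval_pt_comp] at h3
    exact h3
  rw [← hx]
  exact x.2

/-- If two points (g, Y) have the same conjugate g Y g⁻¹, the element relating their first
components intertwines the second components. -/
lemma map_conj_eq {K E : Type} [Field K] [Field E] [Algebra ℂ K] [Algebra ℂ E]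
    {g Y : Matrix (Fin n ⊕ Fin n) (Fin n ⊕ Fin n) K} (hg : g * sadj g = 1)
    (a b : K →ₐ[ℂ] E) (h : ∀ i j, a ((g * Y * sadj g) i j) = b ((g * Y * sadj g) i j)) :
    sadj (g.map b) * g.map a * Y.map a = Y.map b * (sadj (g.map b) * g.map a) := by
  have hmap : ∀ c : K →ₐ[ℂ] E, sadj (g.map c) * g.map c = 1 := fun c => by
    rw [← map_sadj_algHom, ← Matrix.map_mul, mul_eq_one_comm.1 hg,
      Matrix.map_one _ (map_zero _) (map_one _)]
  have h1 : g.map a * Y.map a * sadj (g.map a) = g.map b * Y.map b * sadj (g.map b) := by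
    rw [← map_sadj_algHom, ← map_sadj_algHom, ← Matrix.map_mul, ← Matrix.map_mul, ← Matrix.map_mul,
      ← Matrix.map_mul]
    ext i j
    exact h i j
  calc sadj (g.map b) * g.map a * Y.map a
      = sadj (g.map b) * (g.map a * Y.map a * (sadj (g.map a) * g.map a)) := by
        rw [hmap, Matrix.mul_one, Matrix.mul_assoc]
    _ = sadj (g.map b) * (g.map a * Y.map a * sadj (g.map a)) * g.map a := by
        simp only [Matrix.mul_assoc]
    _ = (sadj (g.map b) * g.map b) * Y.map b * sadj (g.map b) * g.map a := by
        rw [h1]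
        simp only [Matrix.mul_assoc]
    _ = _ := by
        rw [hmap, Matrix.one_mul, Matrix.mul_assoc]

/-- The cocharacter as an element of `𝔷(𝔩)`. -/
lemma isComm_cartan (d : Fin n → ℤ) : IsComm d (cartan fun i => (d i : ℂ)) := by
  have h : ∀ i, cartan (fun i => (d i : ℂ)) i i = wt d i := by
    rintro (i | i) <;> simp [cartan, wt]
  exact ⟨sadj_cartan _, fun i j _ hij => Matrix.diagonal_apply_ne _ hij, fun i j hij => by
    rw [h, h, hij]⟩

lemma cartan_apply_self (d : Fin n → ℤ) (i) : cartan (fun i => (d i : ℂ)) i i = wt d i := by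
  rcases i with i | i <;> simp [cartan, wt]

/-- The subalgebra generated by the entries of `g Y g⁻¹` and the diagonal entries of `Y`. -/
def entryAlg (d : Fin n → ℤ) : Subalgebra ℂ (coordRing d) :=
  Algebra.adjoin ℂ (Set.range (fun p : (Fin n ⊕ Fin n) × (Fin n ⊕ Fin n) => conjMat d p.1 p.2) ∪
    Set.range (diagEntry d))

/-- The coordinate ring is a finite module over the subalgebra generated by the entries of
`g Y g⁻¹` and the diagonal entries of `Y`. -/
theorem exists_finset_span_entryAlg (d : Fin n → ℤ) : ∃ s : Finset (coordRing d),
    ∀ f, f ∈ Submodule.span (entryAlg d) (s : Set (coordRing d)) := by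
  obtain ⟨K, _, _, g, Y, Φ, hg, hY, hK, hΦ⟩ := exists_generic_hom (d := d) (commPerp d)
    ⟨_, mem_commPerp_iff.2 (isComm_cartan d)⟩ (fun Y hY Y' hY' t => mem_commPerp_iff.2
      ((mem_commPerp_iff.1 hY).add_smul_sub (mem_commPerp_iff.1 hY') t)) subset_rfl
  have hinj : Function.Injective Φ := by
    rw [injective_iff_map_eq_zero]
    intro f hf
    obtain ⟨F, _, hF⟩ := (mem_coordRing_iff _).1 f.2
    rw [hΦ f F fun g₀ Y₀ h => hF g₀ ⟨Y₀, h⟩, hK] at hf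
    refine coordRing_ext fun q => ?_
    rw [map_zero, evalAt_apply, hF q.1 q.2]
    exact hf q.1 q.2 q.2.2
  have hΦA : ∀ i j, Φ (conjMat d i j) = (g * Y * sadj g) i j := fun i j => by
    rw [hΦ _ (polyA n i j) fun g₀ Y₀ h => rfl, aeval_apply_polyA]
  have hΦY : ∀ i, Φ (diagEntry d i) = Y i i := fun i => by
    rw [hΦ _ (polyY n i i) fun g₀ Y₀ h => rfl, aeval_apply_polyY]
  set S := (entryAlg d).map Φ with hS
  have hSA : ∀ i j, (g * Y * sadj g) i j ∈ S := fun i j =>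
    ⟨_, Algebra.subset_adjoin (Or.inl ⟨(i, j), rfl⟩), hΦA i j⟩
  have hSY : ∀ i, Y i i ∈ S := fun i => ⟨_, Algebra.subset_adjoin (Or.inr ⟨i, rfl⟩), hΦY i⟩
  obtain ⟨s, hsR, hs⟩ := exists_finset_span_of_isIntegral S Φ.range
    (Subalgebra.FG.map _ (Subalgebra.fg_def.2
      ⟨_, (Set.finite_range _).union (Set.finite_range _), rfl⟩)) (by
      rintro _ ⟨f, rfl⟩
      obtain ⟨F, hFi, hF⟩ := (mem_coordRing_iff _).1 f.2
      change IsIntegral S (Φ f)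
      rw [hΦ f F fun g₀ Y₀ h => hF g₀ ⟨Y₀, h⟩]
      exact hFi.isIntegral hg hY S hSA) (by
      rintro _ ⟨f, _, rfl⟩
      exact ⟨f, rfl⟩) (by
      rintro _ ⟨f, rfl⟩
      obtain ⟨F, hFi, hF⟩ := (mem_coordRing_iff _).1 f.2
      change ∃ a ∈ S, ∃ b ∈ S, b ≠ 0 ∧ Φ f * b = a
      have hmem : Φ f ∈ IntermediateField.adjoin ℂ (S : Set K) := by
        rw [hΦ f F fun g₀ Y₀ h => hF g₀ ⟨Y₀, h⟩]
        have hsub := IntermediateField.subset_adjoin ℂ (S : Set K)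
        refine mem_intermediateField_of_invariant hFi hg hY _ (fun i j => hsub (hSA i j))
          fun E _ _ a b hab => ?_
        have h1 := map_conj_eq hg a b fun i j => hab _ (hsub (hSA i j))
        refine ⟨isPar_of_mul_eq_mul (hY.map (a : K →+* E)) (hY.map (b : K →+* E))
          (fun i => hab _ (hsub (hSY i))) (fun i j hij => ?_) h1, h1⟩
        -- Diagonal entries of different weights differ at the generic point because they do at Y =
        -- diag(d,-d).
        intro h2
        have h3 : Y i i = Y j j := a.toRingHom.injective h2
        rw [← sub_eq_zero, ← aeval_apply_polyY g Y, ← aeval_apply_polyY g Y, ← map_sub, hK] at h3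
        have h4 := h3 1 _ (mem_commPerp_iff.2 (isComm_cartan d))
        rw [map_sub, eval_polyY, eval_polyY, cartan_apply_self, cartan_apply_self, sub_eq_zero] at h4
        exact hij (by exact_mod_cast h4)
      obtain ⟨a, ha, b, hb, hab⟩ := IntermediateField.mem_adjoin_iff_div.1 hmem
      rw [Algebra.adjoin_eq] at ha hb
      by_cases hb0 : b = 0
      · exact ⟨0, zero_mem _, 1, one_mem _, one_ne_zero, by rw [hab, hb0]; simp⟩
      · exact ⟨a, ha, b, hb, hb0, by rw [hab, div_mul_cancel₀ _ hb0]⟩)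
  choose! ψ hψ using fun r (hr : r ∈ s) => hsR hr
  classical
  refine ⟨s.image ψ, fun f => ?_⟩
  obtain ⟨c, -, hc⟩ := Submodule.mem_span_finset.1 (hs (Φ f) ⟨f, rfl⟩)
  choose c' hc' using fun r => (c r).2
  have : f = ∑ r ∈ s, (⟨c' r, (hc' r).1⟩ : entryAlg d) • ψ r := by
    refine hinj ?_
    rw [← hc, map_sum]
    refine Finset.sum_congr rfl fun r hr => ?_
    rw [Subalgebra.smul_def, Subalgebra.smul_def, smul_eq_mul, smul_eq_mul, map_mul]
    exact congrArg₂ (· * ·) (hc' r).2.symm (hψ r hr).symm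
  rw [this]
  exact sum_mem fun r hr => Submodule.smul_mem _ _
    (Submodule.subset_span (Finset.mem_coe.2 (Finset.mem_image_of_mem _ hr)))

open scoped IntermediateField.algebraAdjoinAdjoin in
/-- On a birationally induced orbit with normal closure, every element of the coordinate ring
restricts to a polynomial function of `g e g⁻¹`. -/
theorem exists_polynomial_on_orbit {e : Mat n} (he : e ∈ nilradical d) (hbir : IsBirational d e)
    (hnorm : HasNormalClosure e) (f : coordRing d) :
    ∃ q : MvPolynomial ((Fin n ⊕ Fin n) × (Fin n ⊕ Fin n)) ℂ, ∀ g : Sp n,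
      evalAt (g, ⟨e, mem_commPerp_iff.2 (nilradical_isComm he)⟩) f =
        MvPolynomial.eval (fun ij => ((g : Mat n) * e * sadj (g : Mat n)) ij.1 ij.2) q := by
  -- With W = {e}, the matrix g Y g⁻¹ is the generic point of the orbit of e, and the algebra
  -- generated by its entries is the coordinate ring of the orbit closure.
  obtain ⟨K, _, _, g, Y, Φ, hg, hY, hK, hΦ⟩ := exists_generic_hom (d := d) {e} ⟨e, rfl⟩ (by
    rintro _ rfl _ rfl t
    simp) (by
    rintro _ rfl
    exact mem_commPerp_iff.2 (nilradical_isComm he))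
  obtain ⟨F, hFi, hF⟩ := (mem_coordRing_iff _).1 f.2
  have hYe : Y = e.map (algebraMap ℂ K) := by
    ext i j
    rw [← aeval_apply_polyY g Y, ← sub_eq_zero, Matrix.map_apply,
      ← MvPolynomial.algHom_C (MvPolynomial.aeval (pt g Y) : Poly n →ₐ[ℂ] K), ← map_sub, hK]
    rintro g₀ _ rfl
    rw [map_sub, eval_polyY, MvPolynomial.eval_C, sub_self]
  let A : (Fin n ⊕ Fin n) × (Fin n ⊕ Fin n) → K := fun ij => (g * Y * sadj g) ij.1 ij.2
  have hA : ∀ q : MvPolynomial ((Fin n ⊕ Fin n) × (Fin n ⊕ Fin n)) ℂ,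
      MvPolynomial.aeval A q = MvPolynomial.aeval (pt g Y)
      (MvPolynomial.aeval (fun ij : (Fin n ⊕ Fin n) × (Fin n ⊕ Fin n) => polyA n ij.1 ij.2) q) := by
    intro q
    rw [← AlgHom.comp_apply, MvPolynomial.comp_aeval]
    congr 2
    ext ij
    exact (aeval_apply_polyA g Y ij.1 ij.2).symm
  have hev : ∀ (g₀ : Mat n) (q : MvPolynomial ((Fin n ⊕ Fin n) × (Fin n ⊕ Fin n)) ℂ), MvPolynomial.eval (pt g₀ e) (MvPolynomial.aeval
      (fun ij : (Fin n ⊕ Fin n) × (Fin n ⊕ Fin n) => polyA n ij.1 ij.2) q) =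
      MvPolynomial.eval (fun ij => (g₀ * e * sadj g₀) ij.1 ij.2) q := by
    intro g₀ q
    rw [← MvPolynomial.aeval_eq_eval, ← MvPolynomial.aeval_eq_eval, ← AlgHom.comp_apply,
      MvPolynomial.comp_aeval]
    congr 2
    ext ij
    exact aeval_apply_polyA g₀ e ij.1 ij.2
  have hker : RingHom.ker (MvPolynomial.aeval A : _ →ₐ[ℂ] K) = idealOf (orbit e) := by
    ext q
    rw [RingHom.mem_ker, hA, hK, idealOf, MvPolynomial.mem_vanishingIdeal_iff]
    constructor
    · rintro h _ ⟨_, ⟨g₀, rfl⟩, rfl⟩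
      have := h g₀ e rfl
      rw [hev] at this
      exact this
    · rintro h g₀ _ rfl
      rw [hev]
      exact h _ ⟨_, ⟨g₀, rfl⟩, rfl⟩
  have hcl : IsIntegrallyClosed (Algebra.adjoin ℂ (Set.range A)) := by
    have h1 : IsIntegrallyClosed
        (MvPolynomial ((Fin n ⊕ Fin n) × (Fin n ⊕ Fin n)) ℂ ⧸ idealOf (orbit e)) := hnorm
    rw [← hker] at h1
    rw [Algebra.adjoin_range_eq_range_aeval]
    exact IsIntegrallyClosed.of_equiv
      (Ideal.quotientKerEquivRange (MvPolynomial.aeval A : _ →ₐ[ℂ] K)).toRingEquiv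
  have hsub := IntermediateField.subset_adjoin ℂ (Set.range A)
  have hmem : MvPolynomial.aeval (pt g Y) F ∈ IntermediateField.adjoin ℂ (Set.range A) := by
    refine mem_intermediateField_of_invariant hFi hg hY _ (fun i j => hsub ⟨(i, j), rfl⟩)
      fun E _ _ a b hab => ?_
    have h1 := map_conj_eq hg a b fun i j => hab _ (hsub ⟨(i, j), rfl⟩)
    refine ⟨?_, h1⟩
    have hmap : ∀ c : K →ₐ[ℂ] E, Y.map c = e.map (algebraMap ℂ E) := fun c => by
      rw [hYe]
      ext i j
      simp
    have hmg : ∀ c : K →ₐ[ℂ] E, g.map c * sadj (g.map c) = 1 := fun c => by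
      rw [← map_sadj_algHom, ← Matrix.map_mul, hg, Matrix.map_one _ (map_zero _) (map_one _)]
    rw [hmap, hmap] at h1
    set p := sadj (g.map b) * g.map a with hp
    have hpp : p * sadj p = 1 := by
      rw [hp, sadj_mul, sadj_sadj, Matrix.mul_assoc, ← Matrix.mul_assoc (g.map a), hmg,
        Matrix.one_mul]
      exact mul_eq_one_comm.1 (hmg b)
    -- The element p commutes with e, so p⁻¹ep = e lies in 𝔲 and birationality forces p into P.
    refine hbir.isPar ((mem_sp_iff _).1 he.1) hpp fun i j hij => ?_
    rw [Matrix.mul_assoc, ← h1, ← Matrix.mul_assoc, mul_eq_one_comm.1 hpp, Matrix.one_mul,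
      Matrix.map_apply, he.2 i j hij, map_zero]
  have hint : IsIntegral (Algebra.adjoin ℂ (Set.range A)) (MvPolynomial.aeval (pt g Y) F) :=
    hFi.isIntegral hg hY _ fun i j => Algebra.subset_adjoin ⟨(i, j), rfl⟩
  have hint' : IsIntegral (Algebra.adjoin ℂ (Set.range A))
      (⟨_, hmem⟩ : IntermediateField.adjoin ℂ (Set.range A)) := by
    rw [← isIntegral_algebraMap_iff (B := K) Subtype.val_injective]
    exact hint
  -- Normality of the closure: F is integral over its coordinate ring and lies in the fraction
  -- field, hence is a polynomial in the entries of geg⁻¹.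
  obtain ⟨y, hy⟩ := IsIntegrallyClosed.isIntegral_iff.1 hint'
  have hy' : (y : K) = MvPolynomial.aeval (pt g Y) F := congrArg Subtype.val hy
  obtain ⟨q, hq⟩ := (Algebra.adjoin_range_eq_range_aeval ℂ A).le y.2
  have hq' : MvPolynomial.aeval A q = (y : K) := hq
  refine ⟨q, fun g₀ => ?_⟩
  rw [hy', hA, ← sub_eq_zero, ← map_sub, hK] at hq'
  have := hq' g₀ e rfl
  rw [map_sub, hev, sub_eq_zero] at this
  rw [this]
  exact hF g₀ ⟨e, _⟩

end Finiteness

/-! ### The fibre ideals -/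

section Fibres

variable {n : ℕ} {d : Fin n → ℤ}

/-- A root vector or coroot of the Levi subalgebra. -/
def leviVec (d : Fin n → ℤ) {i j : Fin n ⊕ Fin n} (h : wt d i = wt d j) : levi d :=
  ⟨rootVec i j, rootVec_mem_levi d h⟩

/-- A character kills brackets, and a root vector is an eigenvector with nonzero eigenvalue of a
regular element of 𝔥. -/
lemma char_leviVec_eq_zero (η : Char d) {i j : Fin n ⊕ Fin n} (h : wt d i = wt d j) (hij : i ≠ j) :
    η (leviVec d h) = 0 := by
  let H : levi d := ⟨cartan (regularPt n), cartan_mem_levi d _⟩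
  have h1 : ⁅H, leviVec d h⁆ = (cwt (regularPt n) i - cwt (regularPt n) j) • leviVec d h :=
    Subtype.ext (lie_cartan_rootVec _ i j)
  have h2 := LieAlgebra.lieCharacter_apply_lie η H (leviVec d h)
  rw [h1, map_smul, smul_eq_mul] at h2
  exact (mul_eq_zero.1 h2).resolve_left (sub_ne_zero.2 fun e => hij (cwt_regularPt_injective e))

/-- The difference of the two coroots is a nonzero multiple of a bracket of opposite root vectors in
𝔩. -/
lemma char_leviVec_eq (η : Char d) {i j : Fin n ⊕ Fin n} (h : wt d i = wt d j) :
    η (leviVec d (rfl : wt d i = wt d i)) = η (leviVec d (rfl : wt d j = wt d j)) := by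
  by_cases hij : i = j
  · subst hij; rfl
  have h1 : ⁅leviVec d h, leviVec d h.symm⁆ = (if j = i.swap then (2 : ℂ) else 1) •
      (leviVec d (rfl : wt d i = wt d i) - leviVec d (rfl : wt d j = wt d j)) :=
    Subtype.ext (lie_rootVec_rootVec hij)
  have h2 := LieAlgebra.lieCharacter_apply_lie η (leviVec d h) (leviVec d h.symm)
  rw [h1, map_smul, smul_eq_mul, map_sub] at h2
  refine sub_eq_zero.1 ((mul_eq_zero.1 h2).resolve_left ?_)
  split_ifs <;> norm_num

/-- The value of a character on a diagonal entry. -/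
def charDiag (η : Char d) (i : Fin n ⊕ Fin n) : ℂ :=
  η (leviVec d (rfl : wt d i = wt d i)) / 2

lemma charDiag_eq (η : Char d) {i j : Fin n ⊕ Fin n} (h : wt d i = wt d j) :
    charDiag η i = charDiag η j := by
  rw [charDiag, charDiag, char_leviVec_eq η h]

lemma charDiag_swap (η : Char d) (i : Fin n ⊕ Fin n) : charDiag η i.swap = - charDiag η i := by
  have h1 : leviVec d (rfl : wt d i.swap = wt d i.swap) = - leviVec d (rfl : wt d i = wt d i) := by
    refine Subtype.ext ?_
    change rootVec i.swap i.swap = - rootVec i i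
    rw [rootVec, rootVec, toSp, toSp, sadj_single, sadj_single, sg_mul_self, sg_mul_self,
      Sum.swap_swap, neg_sub]
  rw [charDiag, charDiag, h1, map_neg, neg_div]

/-- Expand Z in root vectors; only the diagonal ones are seen by η. The 2 in the expansion is
cancelled by the one in `charDiag`. -/
theorem char_apply (η : Char d) (Z : levi d) : η Z = ∑ i, (Z : Mat n) i i * charDiag η i := by
  have hZ := (mem_sp_iff _).1 Z.2.1
  classical
  let W : Fin n ⊕ Fin n → Fin n ⊕ Fin n → levi d := fun i j =>
    if h : wt d i = wt d j then (Z : Mat n) i j • leviVec d h else 0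
  have h1 : (2 : ℂ) • Z = ∑ i, ∑ j, W i j := by
    refine Subtype.ext ?_
    have h2 : ((∑ i, ∑ j, W i j : levi d) : Mat n) = ∑ i, ∑ j, (W i j : Mat n) := by
      rw [AddSubmonoidClass.coe_finsetSum]
      refine Finset.sum_congr rfl fun i _ => ?_
      rw [AddSubmonoidClass.coe_finsetSum]
    rw [h2]
    change (2 : ℂ) • (Z : Mat n) = _
    rw [two_smul_eq_sum_rootVec hZ]
    refine Finset.sum_congr rfl fun i _ => Finset.sum_congr rfl fun j _ => ?_
    by_cases h : wt d i = wt d j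
    · simp only [W, dif_pos h]
      rfl
    · simp only [W, dif_neg h]
      rw [Z.2.2 i j h, zero_smul]
      rfl
  have h3 := congrArg η h1
  rw [map_smul, smul_eq_mul, map_sum] at h3
  have h4 : ∀ i, η (∑ j, W i j) = 2 * ((Z : Mat n) i i * charDiag η i) := by
    intro i
    rw [map_sum, Finset.sum_eq_single i]
    · simp only [W, dif_pos]
      rw [map_smul, smul_eq_mul, charDiag]
      ring
    · intro j _ hj
      by_cases h : wt d i = wt d j
      · simp only [W, dif_pos h]
        rw [map_smul, char_leviVec_eq_zero η h (Ne.symm hj), smul_zero]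
      · simp only [W, dif_neg h]
        rw [map_zero]
    · simp
  simp only [h4] at h3
  rw [← Finset.mul_sum] at h3
  exact mul_left_cancel₀ two_ne_zero h3

lemma trace_mul_levi {Y : Mat n} (hY : IsComm d Y) (Z : levi d) :
    trace (Y * (Z : Mat n)) = ∑ i, Y i i * (Z : Mat n) i i := by
  rw [trace]
  refine Finset.sum_congr rfl fun i _ => ?_
  rw [diag_apply, mul_apply]
  refine Finset.sum_eq_single i (fun j _ hj => ?_) (by simp)
  by_cases h : wt d j = wt d i
  · rw [hY.zero i j h.ge (Ne.symm hj), zero_mul]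
  · rw [Z.2.2 j i h, mul_zero]

/-- The fibre ideal is generated by the equations `Y i i = c i`. -/
theorem fibreIdeal_eq (η : Char d) : fibreIdeal d η =
    Ideal.span (Set.range fun i => diagEntry d i - algebraMap ℂ (coordRing d) (charDiag η i)) := by
  refine le_antisymm (Ideal.span_le.2 ?_) (Ideal.span_le.2 ?_)
  · rintro f ⟨Z, hf⟩
    have : f = ∑ i, algebraMap ℂ (coordRing d) ((Z : Mat n) i i) *
        (diagEntry d i - algebraMap ℂ (coordRing d) (charDiag η i)) := by
      refine coordRing_ext fun q => ?_
      obtain ⟨g, Y⟩ := q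
      rw [evalAt_apply, hf, map_sum, trace_mul_levi (mem_commPerp_iff.1 Y.2), char_apply,
        ← Finset.sum_sub_distrib]
      refine Finset.sum_congr rfl fun i _ => ?_
      rw [map_mul, map_sub, AlgHom.commutes, AlgHom.commutes, evalAt_diagEntry]
      simp only [Algebra.algebraMap_self, RingHom.id_apply]
      ring
    rw [this]
    exact sum_mem fun i _ => Ideal.mul_mem_left _ _ (Ideal.subset_span ⟨i, rfl⟩)
  · rintro _ ⟨i, rfl⟩
    have h1 : algebraMap ℂ (coordRing d) 2 *
        (diagEntry d i - algebraMap ℂ (coordRing d) (charDiag η i)) ∈ fibreIdeal d η := by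
      refine Ideal.subset_span ⟨leviVec d (rfl : wt d i = wt d i), fun g Y => ?_⟩
      rw [← evalAt_apply, map_mul, map_sub, AlgHom.commutes, AlgHom.commutes, evalAt_diagEntry]
      change _ = trace ((Y : Mat n) * rootVec i i) - _
      rw [trace_mul_rootVec (mem_commPerp_iff.1 Y.2).skew, charDiag]
      simp only [Algebra.algebraMap_self, RingHom.id_apply]
      ring
    have h2 := Ideal.mul_mem_left _ (algebraMap ℂ (coordRing d) 2⁻¹) h1
    rwa [← mul_assoc, ← map_mul, inv_mul_cancel₀ two_ne_zero, map_one, one_mul] at h2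

/-- The character `Z ↦ τ tr(d Z)`. -/
def scaledChar (d : Fin n → ℤ) (τ : ℂ) : Char d :=
  { toFun := fun Z => τ * trace (cartan (fun i => (d i : ℂ)) * (Z : Mat n))
    map_add' := fun Z Z' => by
      change τ * trace (_ * ((Z : Mat n) + (Z' : Mat n))) = _
      rw [Matrix.mul_add, trace_add, mul_add]
    map_smul' := fun c Z => by
      change τ * trace (_ * (c • (Z : Mat n))) = c • (τ * _)
      rw [Matrix.mul_smul, trace_smul, smul_eq_mul, smul_eq_mul]
      ring
    map_lie' := fun {Z Z'} => by
      change τ * trace (_ * ⁅(Z : Mat n), (Z' : Mat n)⁆) = _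
      rw [(isComm_cartan d).trace_mul_lie (levi_mem_parabolicAlg Z.2).2
        (levi_mem_parabolicAlg Z'.2).2, mul_zero, Ring.lie_def, mul_comm, sub_self] }

lemma charDiag_scaledChar (τ : ℂ) (i : Fin n ⊕ Fin n) :
    charDiag (scaledChar d τ) i = τ * wt d i := by
  change τ * trace (cartan (fun i => (d i : ℂ)) * rootVec i i) / 2 = _
  rw [trace_mul_rootVec (sadj_cartan _), cartan_apply_self]
  ring

/-- A common parameter for the fibres over the line through `d`. -/
def lineParam (d : Fin n → ℤ) (i₀ : Fin n) : coordRing d :=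
  algebraMap ℂ (coordRing d) (d i₀ : ℂ)⁻¹ * diagEntry d (Sum.inl i₀)

/-- The ideal of the torus fixed points of the deformation over the line through `d`. -/
def lineIdeal (d : Fin n → ℤ) (i₀ : Fin n) : Ideal (coordRing d) :=
  fixedIdeal d ⊔ Ideal.span (Set.range fun i =>
    diagEntry d i - algebraMap ℂ (coordRing d) (wt d i : ℂ) * lineParam d i₀)

/-- This separates the equations of the family over the whole line from the single equation t = τ of
a fibre, so the fibres become those of one ℂ[t]-algebra. -/
theorem fibreIdeal_sup_fixedIdeal {i₀ : Fin n} (hi₀ : d i₀ ≠ 0) (τ : ℂ) :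
    fibreIdeal d (scaledChar d τ) ⊔ fixedIdeal d =
      lineIdeal d i₀ ⊔ Ideal.span {lineParam d i₀ - algebraMap ℂ (coordRing d) τ} := by
  have hd : (d i₀ : ℂ) ≠ 0 := Int.cast_ne_zero.2 hi₀
  have hF : ∀ i, diagEntry d i - algebraMap ℂ (coordRing d) (τ * wt d i) ∈
      fibreIdeal d (scaledChar d τ) ⊔ fixedIdeal d := fun i => by
    rw [← charDiag_scaledChar, fibreIdeal_eq]
    exact Ideal.mem_sup_left (Ideal.subset_span ⟨i, rfl⟩)
  have hp : lineParam d i₀ - algebraMap ℂ (coordRing d) τ ∈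
      fibreIdeal d (scaledChar d τ) ⊔ fixedIdeal d := by
    have h1 := Ideal.mul_mem_left _ (algebraMap ℂ (coordRing d) (d i₀ : ℂ)⁻¹) (hF (Sum.inl i₀))
    have e : algebraMap ℂ (coordRing d) τ = algebraMap ℂ (coordRing d) (d i₀ : ℂ)⁻¹ *
        algebraMap ℂ (coordRing d) (τ * wt d (Sum.inl i₀)) := by
      rw [← map_mul]
      congr 1
      change τ = (d i₀ : ℂ)⁻¹ * (τ * (d i₀ : ℂ))
      field_simp
    rwa [mul_sub, ← e] at h1
  refine le_antisymm (sup_le ?_ (le_sup_left.trans le_sup_left)) (sup_le (sup_le le_sup_right ?_) ?_)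
  · rw [fibreIdeal_eq]
    refine Ideal.span_le.2 ?_
    rintro _ ⟨i, rfl⟩
    have e : diagEntry d i - algebraMap ℂ (coordRing d) (charDiag (scaledChar d τ) i) =
        (diagEntry d i - algebraMap ℂ (coordRing d) (wt d i : ℂ) * lineParam d i₀) +
        algebraMap ℂ (coordRing d) (wt d i : ℂ) *
          (lineParam d i₀ - algebraMap ℂ (coordRing d) τ) := by
      rw [charDiag_scaledChar, map_mul]
      ring
    change _ - _ ∈ _
    rw [e]
    exact add_mem (Ideal.mem_sup_left (Ideal.mem_sup_right (Ideal.subset_span ⟨i, rfl⟩)))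
      (Ideal.mul_mem_left _ _ (Ideal.mem_sup_right (Ideal.subset_span rfl)))
  · refine Ideal.span_le.2 ?_
    rintro _ ⟨i, rfl⟩
    have e : diagEntry d i - algebraMap ℂ (coordRing d) (wt d i : ℂ) * lineParam d i₀ =
        (diagEntry d i - algebraMap ℂ (coordRing d) (τ * wt d i)) -
        algebraMap ℂ (coordRing d) (wt d i : ℂ) *
          (lineParam d i₀ - algebraMap ℂ (coordRing d) τ) := by
      rw [map_mul]
      ring
    change _ - _ ∈ _
    rw [e]
    exact sub_mem (hF i) (Ideal.mul_mem_left _ _ hp)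
  · rw [Ideal.span_singleton_le_iff_mem]
    exact hp

/-- The conjugate is diagonal modulo the ideal of torus fixed points. -/
lemma conjMat_map_of_fixedIdeal {B : Type*} [CommRing B] (ψ : coordRing d →+* B)
    (h : fixedIdeal d ≤ RingHom.ker ψ) :
    (conjMat d).map ψ = diagonal fun i => ψ (conjMat d i i) := by
  ext i j
  rw [Matrix.map_apply, diagonal_apply]
  split_ifs with hij
  · rw [hij]
  · exact h (conjMat_mem_fixedIdeal hij)

/-- The diagonal entries of the conjugate on the torus fixed points. -/
lemma prod_sub_of_fixedIdeal {B : Type*} [CommRing B] (ψ : coordRing d →+* B)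
    (h : fixedIdeal d ≤ RingHom.ker ψ) (y : ℤ → B) (hy : ∀ i, ψ (diagEntry d i) = y (wt d i))
    (i : Fin n ⊕ Fin n) :
    ∏ m ∈ Finset.univ.image (wt d), (ψ (conjMat d i i) - y m) = 0 := by
  obtain ⟨z, hz⟩ := exists_weight_fun (diagEntry d) fun i j h => diagEntry_eq h
  have h1 := map_aeval_matrix ψ (conjMat d) (∏ m ∈ Finset.univ.image (wt d),
      (Polynomial.X - Polynomial.C (z m)))
  rw [aeval_conjMat_prod z hz, conjMat_map_of_fixedIdeal ψ h, aeval_diagonal] at h1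
  have h2 := congrFun (congrFun h1 i) i
  rw [Matrix.map_apply, Matrix.zero_apply, map_zero, diagonal_apply_eq, Polynomial.map_prod,
    Polynomial.eval_prod] at h2
  rw [h2]
  refine Finset.prod_congr rfl fun m hm => ?_
  obtain ⟨k, -, rfl⟩ := Finset.mem_image.1 hm
  rw [← hy, hz]
  simp

/-- A and Y have the same characteristic polynomial, and on the torus fixed points A is diagonal. -/
lemma charpoly_of_fixedIdeal {B : Type*} [CommRing B] (ψ : coordRing d →+* B)
    (h : fixedIdeal d ≤ RingHom.ker ψ) :
    ∏ i, (Polynomial.X - Polynomial.C (ψ (conjMat d i i))) =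
      ∏ i, (Polynomial.X - Polynomial.C (ψ (diagEntry d i))) := by
  have h1 := Matrix.charpoly_map (conjMat d) ψ
  rw [conjMat_map_of_fixedIdeal ψ h, Matrix.charpoly_diagonal, conjMat_charpoly,
    Polynomial.map_prod] at h1
  rw [h1]
  simp

lemma sadj_conjMat : sadj (conjMat d) = - conjMat d := by
  ext1 i j
  refine coordRing_ext fun q => ?_
  obtain ⟨g, Y⟩ := q
  have h1 := map_sadj_algHom (evalAt (g, Y)) (conjMat d)
  rw [conjMat_map, sadj_mul, sadj_mul, sadj_sadj, (mem_commPerp_iff.1 Y.2).skew] at h1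
  have h2 := congrFun (congrFun h1 i) j
  have h3 : (-conjMat d) i j = -(conjMat d i j) := rfl
  rw [h3, map_neg, evalAt_conjMat]
  simpa [Matrix.mul_assoc] using h2

lemma conjMat_swap (i : Fin n ⊕ Fin n) : conjMat d i.swap i.swap = - conjMat d i i := by
  have h := congrFun (congrFun (sadj_conjMat (d := d)) i) i
  rw [sadj_apply, sg_mul_self, one_mul] at h
  exact h

end Fibres

/-! ### Failure of weak flatness -/

section NotWeakFlat

variable {n : ℕ} {d : Fin n → ℤ}

lemma lineParam_sub_mem {i₀ : Fin n} (i : Fin n ⊕ Fin n) :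
    diagEntry d i - algebraMap ℂ (coordRing d) (wt d i : ℂ) * lineParam d i₀ ∈ lineIdeal d i₀ :=
  Ideal.mem_sup_right (Ideal.subset_span ⟨i, rfl⟩)

/-- The torus fixed points of the deformation over a line are finite over this line. -/
theorem exists_finset_lineIdeal {i₀ : Fin n} {B : Type} [CommRing B] [Algebra ℂ B]
    (π : coordRing d →ₐ[ℂ] B) (hπ : Function.Surjective π)
    (hπk : lineIdeal d i₀ ≤ RingHom.ker (π : coordRing d →+* B)) :
    ∃ s : Finset B, ∀ f, ∃ p : B → Polynomial ℂ,
      f = ∑ r ∈ s, Polynomial.aeval (π (lineParam d i₀)) (p r) * r := by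
  have hker : fixedIdeal d ≤ RingHom.ker (π : coordRing d →+* B) := fun x hx =>
    hπk (Ideal.mem_sup_left hx)
  let : Algebra (Polynomial ℂ) B := (Polynomial.aeval (π (lineParam d i₀))).toRingHom.toAlgebra
  have hsm : ∀ p : Polynomial ℂ, algebraMap (Polynomial ℂ) B p =
    Polynomial.aeval (π (lineParam d i₀)) p := fun p => rfl
  have hdiag : ∀ i, π (diagEntry d i) = algebraMap (Polynomial ℂ) B
      (Polynomial.C (wt d i : ℂ) * Polynomial.X) := by
    intro i
    rw [hsm, map_mul, Polynomial.aeval_C, Polynomial.aeval_X, ← sub_eq_zero,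
      ← π.commutes, ← map_mul, ← map_sub]
    exact hπk (lineParam_sub_mem i)
  -- Modulo the ideal, the diagonal entries of A are roots of the monic polynomial with roots mt, m
  -- running over the weights, and the other entries are zero. Finiteness over `entryAlg` then gives
  -- finiteness over ℂ[t].
  have hint : ∀ i j, IsIntegral (Polynomial ℂ) (π (conjMat d i j)) := by
    intro i j
    by_cases hij : i = j
    · subst hij
      refine ⟨∏ m ∈ Finset.univ.image (wt d), (Polynomial.X - Polynomial.C
        (Polynomial.C (m : ℂ) * Polynomial.X)), Polynomial.monic_prod_of_monic _ _
          fun m _ => Polynomial.monic_X_sub_C _, ?_⟩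
      have h1 := prod_sub_of_fixedIdeal (π : coordRing d →+* B) hker
        (fun m => algebraMap (Polynomial ℂ) B (Polynomial.C (m : ℂ) * Polynomial.X)) hdiag i
      rw [Polynomial.eval₂_finsetProd, ← h1]
      refine Finset.prod_congr rfl fun m _ => ?_
      rw [Polynomial.eval₂_sub, Polynomial.eval₂_X, Polynomial.eval₂_C]
      rfl
    · have h0 : π (conjMat d i j) = 0 := hker (conjMat_mem_fixedIdeal hij)
      rw [h0]
      exact isIntegral_zero
  let M : Subalgebra (Polynomial ℂ) B := Algebra.adjoin (Polynomial ℂ)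
    (Set.range fun p : (Fin n ⊕ Fin n) × (Fin n ⊕ Fin n) => π (conjMat d p.1 p.2))
  have hMfin : Module.Finite (Polynomial ℂ) M := Algebra.finite_adjoin_of_finite_of_isIntegral
    (Set.finite_range _) (by
      rintro _ ⟨p, rfl⟩
      exact hint _ _)
  have hsub : ∀ a ∈ entryAlg d, π a ∈ M := by
    intro a ha
    induction ha using Algebra.adjoin_induction with
    | mem x hx =>
      rcases hx with ⟨p, rfl⟩ | ⟨i, rfl⟩
      · exact Algebra.subset_adjoin ⟨p, rfl⟩
      · rw [hdiag]
        exact M.algebraMap_mem _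
    | algebraMap c =>
      have : π (algebraMap ℂ _ c) = algebraMap (Polynomial ℂ) B (Polynomial.C c) := by
        rw [hsm, Polynomial.aeval_C, π.commutes]
      rw [this]
      exact M.algebraMap_mem _
    | add x y _ _ h₁ h₂ => rw [map_add]; exact add_mem h₁ h₂
    | mul x y _ _ h₁ h₂ => rw [map_mul]; exact mul_mem h₁ h₂
  obtain ⟨s, hs⟩ := exists_finset_span_entryAlg d
  classical
  have hBfin : Module.Finite M B := by
    refine ⟨⟨s.image π, eq_top_iff.2 fun y _ => ?_⟩⟩
    obtain ⟨f, rfl⟩ := hπ y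
    have hf := hs f
    induction hf using Submodule.span_induction with
    | mem x hx => exact Submodule.subset_span (Finset.mem_coe.2 (Finset.mem_image_of_mem _ hx))
    | zero => rw [map_zero]; exact zero_mem _
    | add x y _ _ h₁ h₂ => rw [map_add]; exact add_mem (h₁ trivial) (h₂ trivial)
    | smul a x _ h =>
      rw [Subalgebra.smul_def, smul_eq_mul, map_mul]
      exact Submodule.smul_mem _ (⟨π a, hsub a a.2⟩ : M) (h trivial)
  have hfin : Module.Finite (Polynomial ℂ) B := Module.Finite.trans M B
  obtain ⟨s', hs'⟩ := hfin.fg_top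
  refine ⟨s', fun f => ?_⟩
  obtain ⟨p, -, hp⟩ := Submodule.mem_span_finset.1 (hs' ▸ Submodule.mem_top : f ∈ _)
  refine ⟨p, hp.symm.trans (Finset.sum_congr rfl fun r _ => ?_)⟩
  rw [Algebra.smul_def]
  rfl

lemma prod_sum_swap {B : Type*} [CommRing B] (a : Fin n ⊕ Fin n → B) (ha : ∀ i, a i.swap = - a i) :
    ∏ i, (Polynomial.X - Polynomial.C (a i)) =
      ∏ i : Fin n, ((Polynomial.X - Polynomial.C (a (Sum.inl i))) *
        (Polynomial.X + Polynomial.C (a (Sum.inl i)))) := by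
  rw [Fintype.prod_sum_type, ← Finset.prod_mul_distrib]
  refine Finset.prod_congr rfl fun i _ => ?_
  rw [show a (Sum.inr i) = - a (Sum.inl i) from ha (Sum.inl i), map_neg, sub_neg_eq_add]

/-- On the torus fixed points of a generic fibre, products of too many coordinates vanish. -/
theorem prod_conjMat_eq_zero {B : Type*} [CommRing B] [Algebra ℂ B] (π : coordRing d →ₐ[ℂ] B)
    (hker : fixedIdeal d ≤ RingHom.ker (π : coordRing d →+* B)) {τ : ℂ} (hτ : τ ≠ 0)
    (hdiag : ∀ i, π (diagEntry d i) = algebraMap ℂ B (τ * (wt d i : ℂ))) (S : Finset (Fin n))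
    (hS : (Finset.univ.filter fun i => d i ≠ 0).card < S.card) :
    ∏ i ∈ S, π (conjMat d (Sum.inl i) (Sum.inl i)) = 0 := by
  refine prod_eq_zero_of_charpoly (fun i => π (conjMat d (Sum.inl i) (Sum.inl i)))
    ((Finset.univ.image (wt d)).image fun m : ℤ => τ * (m : ℂ)) (fun i => ?_)
    (fun i => τ * (d i : ℂ)) ?_ S ?_
  -- For τ ≠ 0 the values τm are distinct, so the equation for the diagonal entries is separable.
  -- This is exactly what is lost at τ = 0.
  · rw [Finset.prod_image fun m _ m' _ h => by
      have := mul_left_cancel₀ hτ h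
      exact_mod_cast this]
    exact prod_sub_of_fixedIdeal (π : coordRing d →+* B) hker
      (fun m => algebraMap ℂ B (τ * (m : ℂ))) hdiag (Sum.inl i)
  · have h1 := charpoly_of_fixedIdeal (π : coordRing d →+* B) hker
    rw [prod_sum_swap _ fun i => by rw [conjMat_swap, map_neg]] at h1
    refine h1.trans ?_
    simp only [RingHom.coe_coe, hdiag]
    rw [prod_sum_swap (fun i => algebraMap ℂ B (τ * (wt d i : ℂ))) fun i => by
      rw [wt_swap, Int.cast_neg, mul_neg, map_neg]]
    rw [Polynomial.map_prod]
    simp only [Polynomial.map_mul, Polynomial.map_sub, Polynomial.map_add, Polynomial.map_X,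
      Polynomial.map_C]
    rfl
  · simpa [hτ] using hS

lemma le_ker_mkₐ {R : Type*} [CommRing R] [Algebra ℂ R] (I : Ideal R) :
    I ≤ RingHom.ker (Ideal.Quotient.mkₐ ℂ I : R →+* R ⧸ I) := fun _ hx =>
  Ideal.Quotient.eq_zero_iff_mem.2 hx

/-- Membership is tested by arbitrary homomorphisms to an abstract algebra, so that arguments can be
made in B and not in a concrete quotient. -/
lemma mem_of_forall_quotient {R : Type} [CommRing R] [Algebra ℂ R] {I : Ideal R} {x : R}
    (h : ∀ (B : Type) [CommRing B] [Algebra ℂ B] (π : R →ₐ[ℂ] B),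
      I ≤ RingHom.ker (π : R →+* B) → π x = 0) : x ∈ I :=
  Ideal.Quotient.eq_zero_iff_mem.1 (h (R ⧸ I) (Ideal.Quotient.mkₐ ℂ I) (le_ker_mkₐ I))

lemma mem_sup_of_mk_mem {R : Type*} [CommRing R] {I : Ideal R} {r s : R} :
    Ideal.Quotient.mk I r ∈ Ideal.span {Ideal.Quotient.mk I s} ↔ r ∈ I ⊔ Ideal.span {s} := by
  have h1 : Ideal.span {Ideal.Quotient.mk I s} = (Ideal.span {s}).map (Ideal.Quotient.mk I) := by
    rw [Ideal.map_span, Set.image_singleton]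
  rw [h1, ← Ideal.mem_comap, Ideal.comap_map_of_surjective' _ Ideal.Quotient.mk_surjective,
    Ideal.mk_ker, sup_comm]

/-- A quotient ring which is finite over the affine line and has fibres of constant dimension. -/
theorem mem_sup_span_of_rank_eq {R : Type} [CommRing R] [Algebra ℂ R] (J : Ideal R) (t : R)
    (hfin : ∀ (B : Type) [CommRing B] [Algebra ℂ B] (π : R →ₐ[ℂ] B), Function.Surjective π →
      J ≤ RingHom.ker (π : R →+* B) → ∃ s : Finset B, ∀ f, ∃ p : B → Polynomial ℂ,
        f = ∑ r ∈ s, Polynomial.aeval (π t) (p r) * r)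
    (hrank : ∀ τ : ℂ, Module.rank ℂ (R ⧸ J ⊔ Ideal.span {t - algebraMap ℂ R τ}) =
      Module.rank ℂ (R ⧸ J ⊔ Ideal.span {t - algebraMap ℂ R 0})) (x : R)
    (hx : ∀ τ : ℂ, τ ≠ 0 → x ∈ J ⊔ Ideal.span {t - algebraMap ℂ R τ}) :
    x ∈ J ⊔ Ideal.span {t - algebraMap ℂ R 0} := by
  obtain ⟨s, hs⟩ := hfin (R ⧸ J) (Ideal.Quotient.mkₐ ℂ J) (Ideal.Quotient.mkₐ_surjective ℂ J)
    (le_ker_mkₐ J)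
  have hmk : ∀ τ : ℂ, Ideal.span {Ideal.Quotient.mk J t - algebraMap ℂ (R ⧸ J) τ} =
      Ideal.map (Ideal.Quotient.mkₐ ℂ J) (Ideal.span {t - algebraMap ℂ R τ}) := by
    intro τ
    rw [Ideal.map_span, Set.image_singleton]
    rfl
  have hr : ∀ τ : ℂ, Module.rank ℂ ((R ⧸ J) ⧸
      Ideal.span {Ideal.Quotient.mk J t - algebraMap ℂ (R ⧸ J) τ}) =
      Module.rank ℂ (R ⧸ J ⊔ Ideal.span {t - algebraMap ℂ R τ}) := fun τ =>
    (Ideal.quotientEquivAlgOfEq ℂ (hmk τ)).toLinearEquiv.rank_eq.trans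
      (DoubleQuot.quotQuotEquivQuotSupₐ ℂ J
        (Ideal.span {t - algebraMap ℂ R τ})).toLinearEquiv.rank_eq
  have key := mem_span_of_rank_eq (Ideal.Quotient.mk J t) s hs (fun τ => by
      have h0 := hr 0
      rw [map_zero, sub_zero] at h0
      rw [hr τ, h0, hrank τ]) (Ideal.Quotient.mk J x) fun τ hτ => mem_sup_of_mk_mem.2 (hx τ hτ)
  rw [mem_sup_of_mk_mem] at key
  rwa [map_zero, sub_zero]

/-- If weak flatness holds, then products of too many coordinates vanish on the torus fixed points of
the zero fibre. -/
theorem WeakFlat.prod_conjMat_mem (h : WeakFlat d) {i₀ : Fin n} (hi₀ : d i₀ ≠ 0)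
    (S : Finset (Fin n)) (hS : (Finset.univ.filter fun i => d i ≠ 0).card < S.card) :
    ∏ i ∈ S, conjMat d (Sum.inl i) (Sum.inl i) ∈ fibreIdeal d (scaledChar d 0) ⊔ fixedIdeal d := by
  have hrank : ∀ τ : ℂ, Module.rank ℂ (coordRing d ⧸ lineIdeal d i₀ ⊔
      Ideal.span {lineParam d i₀ - algebraMap ℂ (coordRing d) τ}) =
      Module.rank ℂ (FixedAlg d (scaledChar d τ)) := fun τ =>
    ((Ideal.quotientEquivAlgOfEq ℂ (fibreIdeal_sup_fixedIdeal hi₀ τ)).toLinearEquiv.rank_eq).symm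
  rw [fibreIdeal_sup_fixedIdeal hi₀]
  refine mem_sup_span_of_rank_eq (lineIdeal d i₀) (lineParam d i₀)
    (fun B _ _ π h₁ h₂ => exists_finset_lineIdeal π h₁ h₂)
    (fun τ => ((hrank τ).trans (h _ _)).trans (hrank 0).symm) _ fun τ hτ => ?_
  rw [← fibreIdeal_sup_fixedIdeal hi₀]
  refine mem_of_forall_quotient fun B _ _ π hπ => ?_
  rw [map_prod]
  refine prod_conjMat_eq_zero π (le_sup_right.trans hπ) hτ (fun i => ?_) S hS
  rw [← π.commutes, ← charDiag_scaledChar, ← sub_eq_zero, ← map_sub]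
  refine hπ (Ideal.mem_sup_left ?_)
  rw [fibreIdeal_eq]
  exact Ideal.subset_span ⟨i, rfl⟩

lemma toCartan_X (i j : Fin n ⊕ Fin n) : toCartan n (MvPolynomial.X (i, j)) =
    if i = j then Sum.elim MvPolynomial.X (fun i => -MvPolynomial.X i) i else 0 :=
  MvPolynomial.aeval_X _ _

lemma sadj_of_isDiag {t : Mat n} (ht : t.IsDiag) : sadj t = diagonal fun i => t i.swap i.swap := by
  ext i j
  rw [sadj_apply, diagonal_apply]
  split_ifs with h
  · rw [h, sg_mul_self, one_mul]
  · rw [ht fun e => h (Sum.swap_leftInverse.injective e).symm, mul_zero]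

/-- The restriction of the torus fixed points of the zero fibre to a Richardson orbit. -/
theorem toCartan_mem_of_mem {e : Mat n} (he : e ∈ nilradical d) (hbir : IsBirational d e)
    (hnorm : HasNormalClosure e) {f : coordRing d}
    (hf : f ∈ fibreIdeal d (scaledChar d 0) ⊔ fixedIdeal d) :
    ∃ q : MvPolynomial ((Fin n ⊕ Fin n) × (Fin n ⊕ Fin n)) ℂ, (∀ g : Sp n,
      evalAt (g, ⟨e, mem_commPerp_iff.2 (nilradical_isComm he)⟩) f =
        MvPolynomial.eval (fun ij => ((g : Mat n) * e * sadj (g : Mat n)) ij.1 ij.2) q) ∧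
      toCartan n q ∈ cartanIdeal (orbit e) := by
  -- T is an ideal since every function restricts to some polynomial on the orbit and the membership
  -- condition on toCartan is stable under multiplication. It remains to check the generators.
  let T : Ideal (coordRing d) :=
    { carrier := {f | ∃ q : MvPolynomial ((Fin n ⊕ Fin n) × (Fin n ⊕ Fin n)) ℂ, (∀ g : Sp n,
        evalAt (g, ⟨e, mem_commPerp_iff.2 (nilradical_isComm he)⟩) f =
        MvPolynomial.eval (fun ij => ((g : Mat n) * e * sadj (g : Mat n)) ij.1 ij.2) q) ∧
        toCartan n q ∈ cartanIdeal (orbit e)}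
      add_mem' := by
        rintro f f' ⟨q, hq, hqe⟩ ⟨q', hq', hqe'⟩
        exact ⟨q + q', fun g => by rw [map_add, map_add, hq, hq'], by
          rw [map_add]; exact add_mem hqe hqe'⟩
      zero_mem' := ⟨0, fun g => by rw [map_zero, map_zero], by rw [map_zero]; exact zero_mem _⟩
      smul_mem' := by
        rintro a f ⟨q, hq, hqe⟩
        obtain ⟨q', hq'⟩ := exists_polynomial_on_orbit he hbir hnorm a
        exact ⟨q' * q, fun g => by rw [smul_eq_mul, map_mul, map_mul, hq, hq'], by
          rw [map_mul]; exact Ideal.mul_mem_left _ _ hqe⟩ }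
  suffices hT : fibreIdeal d (scaledChar d 0) ⊔ fixedIdeal d ≤ T from hT hf
  refine sup_le ?_ ?_
  · rw [fibreIdeal_eq]
    refine Ideal.span_le.2 ?_
    rintro _ ⟨i, rfl⟩
    refine ⟨0, fun g => ?_, by rw [map_zero]; exact zero_mem _⟩
    change evalAt _ (diagEntry d i - algebraMap ℂ _ (charDiag (scaledChar d 0) i)) = _
    rw [charDiag_scaledChar, zero_mul, map_zero, sub_zero, map_zero, evalAt_diagEntry]
    exact he.2 i i le_rfl
  · refine Ideal.span_le.2 ?_
    rintro f ⟨t, ht, f', hf'⟩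
    obtain ⟨q, hq⟩ := exists_polynomial_on_orbit he hbir hnorm f'
    let c : Fin n ⊕ Fin n → ℂ := fun i => (t : Mat n) i i
    have hts : (t : Mat n) = diagonal c := (ht.diagonal_diag).symm
    have hts' : sadj (t : Mat n) = diagonal fun i => c i.swap := sadj_of_isDiag ht
    have hc : ∀ i, c i * c i.swap = 1 := fun i => by
      have h1 := mul_sadj t
      rw [hts', hts, diagonal_mul_diagonal] at h1
      simpa using congrFun (congrFun h1 i) i
    -- q' is q precomposed with conjugation by t. Diagonal matrices commute with t, so q' and q have
    -- the same restriction to 𝔥.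
    let q' := MvPolynomial.aeval (fun ij : (Fin n ⊕ Fin n) × (Fin n ⊕ Fin n) =>
      (MvPolynomial.C (c ij.1 * c ij.2.swap) * MvPolynomial.X ij :
        MvPolynomial ((Fin n ⊕ Fin n) × (Fin n ⊕ Fin n)) ℂ)) q
    refine ⟨q' - q, fun g => ?_, ?_⟩
    · have e1 : ((t * g : Sp n) : Mat n) * e * sadj ((t * g : Sp n) : Mat n) =
          diagonal c * ((g : Mat n) * e * sadj (g : Mat n)) * diagonal fun k => c k.swap := by
        rw [← hts', ← hts]
        change (t : Mat n) * (g : Mat n) * e * sadj ((t : Mat n) * (g : Mat n)) = _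
        rw [sadj_mul]
        simp only [Matrix.mul_assoc]
      rw [evalAt_apply, hf', ← evalAt_apply, ← evalAt_apply, hq, hq, map_sub, e1]
      congr 1
      rw [← MvPolynomial.aeval_eq_eval, ← MvPolynomial.aeval_eq_eval, ← AlgHom.comp_apply,
        MvPolynomial.comp_aeval]
      congr 2
      ext ij
      rw [mul_diagonal, diagonal_mul, map_mul, MvPolynomial.algHom_C, MvPolynomial.aeval_X]
      simp only [Algebra.algebraMap_self, RingHom.id_apply]
      ring
    · have e2 : toCartan n q' = toCartan n q := by
        change toCartan n (MvPolynomial.aeval _ q) = _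
        rw [← AlgHom.comp_apply, MvPolynomial.comp_aeval]
        conv_rhs => rw [toCartan]
        congr 2
        ext1 ij
        obtain ⟨i, j⟩ := ij
        rw [map_mul, MvPolynomial.algHom_C, toCartan_X]
        simp only
        split_ifs with h
        · subst h
          rw [hc, map_one, one_mul]
        · rw [mul_zero]
      rw [map_sub, e2, sub_self]
      exact zero_mem _

/-- The main step in the failure of weak flatness. -/
theorem not_weakFlat {e : Mat n} (he : e ∈ nilradical d) (hbir : IsBirational d e)
    (hnorm : HasNormalClosure e) {i₀ : Fin n} (hi₀ : d i₀ ≠ 0) (S : Finset (Fin n))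
    (hS : (Finset.univ.filter fun i => d i ≠ 0).card < S.card)
    (hSe : (∏ i ∈ S, (MvPolynomial.X i : MvPolynomial (Fin n) ℂ)) ∉ cartanIdeal (orbit e)) :
    ¬ WeakFlat d := by
  intro h
  obtain ⟨q, hq, hqe⟩ := toCartan_mem_of_mem he hbir hnorm (h.prod_conjMat_mem hi₀ S hS)
  refine hSe ?_
  -- The polynomial q provided above is not the monomial itself, but the two agree on the orbit.
  have h1 : ∏ i ∈ S, MvPolynomial.X (Sum.inl i, Sum.inl i) - q ∈ idealOf (orbit e) := by
    rw [idealOf, MvPolynomial.mem_vanishingIdeal_iff]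
    rintro _ ⟨_, ⟨g, rfl⟩, rfl⟩
    have := hq g
    rw [map_prod] at this
    simp only [evalAt_conjMat] at this
    rw [MvPolynomial.aeval_eq_eval, map_sub, map_prod, sub_eq_zero]
    simp only [MvPolynomial.eval_X]
    exact this
  have h2 := Ideal.mem_map_of_mem (toCartan n) h1
  rw [map_sub, map_prod] at h2
  simp only [toCartan_X, if_true, Sum.elim_inl] at h2
  have h3 := add_mem h2 hqe
  rwa [sub_add_cancel] at h3

end NotWeakFlat

/-! ### The ideals of the intersections of orbits with the Cartan subalgebra -/

section CartanIdeals

variable {n : ℕ} {d : Fin n → ℤ}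

lemma toCartan_surjective (n : ℕ) : Function.Surjective (toCartan n) := by
  intro p
  refine ⟨MvPolynomial.aeval (fun i => MvPolynomial.X (Sum.inl i, Sum.inl i)) p, ?_⟩
  rw [← AlgHom.comp_apply, MvPolynomial.comp_aeval]
  simp only [toCartan_X, if_true, Sum.elim_inl]
  rw [MvPolynomial.aeval_X_left, AlgHom.id_apply]

/-- The generic matrix. -/
def genericMat (n : ℕ) : Matrix (Fin n ⊕ Fin n) (Fin n ⊕ Fin n)
    (MvPolynomial ((Fin n ⊕ Fin n) × (Fin n ⊕ Fin n)) ℂ) :=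
  Matrix.of fun i j => MvPolynomial.X (i, j)

lemma genericMat_map_eval (Y : Mat n) :
    (genericMat n).map (MvPolynomial.eval fun ij : (Fin n ⊕ Fin n) × (Fin n ⊕ Fin n) =>
      Y ij.1 ij.2) = Y := by
  ext i j
  simp [genericMat]

lemma mem_idealOf_iff {S : Set (Mat n)} {F : MvPolynomial ((Fin n ⊕ Fin n) × (Fin n ⊕ Fin n)) ℂ} :
    F ∈ idealOf S ↔ ∀ Y ∈ S, MvPolynomial.eval (fun ij => Y ij.1 ij.2) F = 0 := by
  rw [idealOf, MvPolynomial.mem_vanishingIdeal_iff]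
  constructor
  · intro h Y hY
    exact h _ ⟨Y, hY, rfl⟩
  · rintro h _ ⟨Y, hY, rfl⟩
    exact h Y hY

lemma cartan_eq_diagonal (x : Fin n → ℂ) : cartan x = diagonal (cwt x) := rfl

/-- If d_i = 0, the root vector of the long root 2x_i lies in 𝔩 and so commutes with diag(x,-x),
which forces 2x_i = 0. -/
lemma IsGeneric.eq_zero {x : Fin n → ℂ} (hx : IsGeneric d x) {i : Fin n} (hi : d i = 0) :
    x i = 0 := by
  have hwt : wt d (Sum.inl i) = wt d (Sum.inr i) := by simp [wt, hi]
  have h1 := (hx _ (toSp_mem _)).2 (rootVec_mem_levi d hwt)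
  have h2 := lie_cartan_rootVec x (Sum.inl i) (Sum.inr i)
  change cartan x * rootVec _ _ = rootVec _ _ * cartan x at h1
  rw [Ring.lie_def, h1, sub_self] at h2
  have h3 := congrFun (congrFun h2 (Sum.inl i)) (Sum.inr i)
  have h4 : rootVec (Sum.inl i : Fin n ⊕ Fin n) (Sum.inr i) (Sum.inl i) (Sum.inr i) = 2 := by
    rw [rootVec, toSp, sadj_single]
    simp [sg]
    norm_num
  rw [Matrix.smul_apply, h4] at h3
  simp only [cwt, Sum.elim_inl, Sum.elim_inr, Matrix.zero_apply, smul_eq_mul] at h3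
  have h5 : 4 * x i = 0 := by linear_combination -h3
  simpa using h5

/-- The matrices in the quotient of `ℂ[𝔥]` by the defining ideal of an orbit. -/
lemma genericMat_map_toCartan {B : Type*} [CommRing B] [Algebra ℂ B]
    (π : MvPolynomial (Fin n) ℂ →ₐ[ℂ] B) :
    (genericMat n).map (π.comp (toCartan n)) =
      diagonal (Sum.elim (fun i => π (MvPolynomial.X i)) fun i => - π (MvPolynomial.X i)) := by
  ext i j
  rw [Matrix.map_apply, genericMat, Matrix.of_apply, AlgHom.comp_apply, toCartan_X, diagonal_apply]
  split_ifs with h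
  · rcases i with i | i <;> simp
  · rw [map_zero]

/-- Products of too many coordinates vanish on the intersection of a semisimple orbit with the
Cartan subalgebra. -/
theorem prod_X_mem_cartanIdeal (x : Fin n → ℂ) (S : Finset (Fin n))
    (hS : (Finset.univ.filter fun i => x i ≠ 0).card < S.card) :
    ∏ i ∈ S, (MvPolynomial.X i : MvPolynomial (Fin n) ℂ) ∈ cartanIdeal (orbit (cartan x)) := by
  refine mem_of_forall_quotient fun B _ _ π hπ => ?_
  rw [map_prod]
  set a : Fin n ⊕ Fin n → B :=
    Sum.elim (fun i => π (MvPolynomial.X i)) fun i => - π (MvPolynomial.X i) with ha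
  let ψ := π.comp (toCartan n)
  have hψ : ∀ F ∈ idealOf (orbit (cartan x)), ψ F = 0 := fun F hF =>
    hπ (Ideal.mem_map_of_mem _ hF)
  have hmap : (genericMat n).map (ψ : _ →+* B) = diagonal a := genericMat_map_toCartan π
  have hC : (ψ : MvPolynomial ((Fin n ⊕ Fin n) × (Fin n ⊕ Fin n)) ℂ →+* B).comp
      MvPolynomial.C = algebraMap ℂ B := ψ.comp_algebraMap
  -- The minimal and the characteristic equation of diag(x,-x) hold at every point of its orbit,
  -- hence modulo the ideal of the orbit. The former has simple roots because the element is
  -- semisimple.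
  refine prod_eq_zero_of_charpoly _ (Finset.univ.image (cwt x)) (fun i => ?_) x ?_ S hS
  · have h1 := map_aeval_matrix (ψ : _ →+* B) (genericMat n)
      ((∏ μ ∈ Finset.univ.image (cwt x), (Polynomial.X - Polynomial.C μ)).map MvPolynomial.C)
    rw [hmap, aeval_diagonal, Polynomial.map_map, hC] at h1
    have h2 := congrFun (congrFun h1 (Sum.inl i)) (Sum.inl i)
    have hev : Polynomial.eval (a (Sum.inl i)) ((∏ μ ∈ Finset.univ.image (cwt x),
        (Polynomial.X - Polynomial.C μ)).map (algebraMap ℂ B)) = ∏ μ ∈ Finset.univ.image (cwt x),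
          (π (MvPolynomial.X i) - algebraMap ℂ B μ) := by
      rw [Polynomial.map_prod, Polynomial.eval_prod]
      simp [ha]
    rw [Matrix.map_apply, diagonal_apply_eq, hev] at h2
    rw [← h2]
    refine hψ _ (mem_idealOf_iff.2 ?_)
    rintro _ ⟨g, rfl⟩
    have h3 := map_aeval_matrix (MvPolynomial.eval fun ij : (Fin n ⊕ Fin n) × (Fin n ⊕ Fin n) =>
      ((g : Mat n) * cartan x * ((g⁻¹ : Sp n) : Mat n)) ij.1 ij.2) (genericMat n)
      ((∏ μ ∈ Finset.univ.image (cwt x), (Polynomial.X - Polynomial.C μ)).map MvPolynomial.C)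
    have hCe : ∀ v : (Fin n ⊕ Fin n) × (Fin n ⊕ Fin n) → ℂ,
        (MvPolynomial.eval v).comp MvPolynomial.C = RingHom.id ℂ := fun v =>
      RingHom.ext fun c => MvPolynomial.eval_C c
    rw [genericMat_map_eval, Polynomial.map_map, hCe, Polynomial.map_id, coe_inv_eq_sadj,
      aeval_conj _ _ _ (mul_sadj g), cartan_eq_diagonal, aeval_diagonal] at h3
    have h4 : (fun i => Polynomial.eval (cwt x i)
        (∏ μ ∈ Finset.univ.image (cwt x), (Polynomial.X - Polynomial.C μ))) = 0 := by
      ext i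
      rw [Polynomial.eval_prod, Pi.zero_apply]
      exact Finset.prod_eq_zero (Finset.mem_image_of_mem _ (Finset.mem_univ i)) (by simp)
    rw [h4] at h3
    have h5 := congrFun (congrFun h3 (Sum.inl i)) (Sum.inl i)
    rw [Matrix.map_apply] at h5
    refine h5.trans ?_
    simp
  · have h1 : ∏ i, (Polynomial.X - Polynomial.C (a i)) =
        (∏ i, (Polynomial.X - Polynomial.C (cwt x i))).map (algebraMap ℂ B) := by
      rw [← Matrix.charpoly_diagonal, ← hmap, Matrix.charpoly_map]
      have e : ∀ k, ψ ((genericMat n).charpoly.coeff k - MvPolynomial.C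
          ((∏ i, (Polynomial.X - Polynomial.C (cwt x i))).coeff k)) = 0 := by
        intro k
        refine hψ _ (mem_idealOf_iff.2 ?_)
        rintro _ ⟨g, rfl⟩
        rw [map_sub, MvPolynomial.eval_C, ← Polynomial.coeff_map, ← Matrix.charpoly_map,
          genericMat_map_eval, coe_inv_eq_sadj, Matrix.charpoly_mul_comm, ← Matrix.mul_assoc,
          sadj_mul_self, Matrix.one_mul, cartan_eq_diagonal, Matrix.charpoly_diagonal, sub_self]
      ext k
      rw [Polynomial.coeff_map, Polynomial.coeff_map]
      have := e k
      rw [map_sub, sub_eq_zero] at this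
      refine this.trans ?_
      exact ψ.commutes _
    rw [prod_sum_swap a (by rintro (i | i) <;> simp [ha]),
      prod_sum_swap (cwt x) (cwt_swap x)] at h1
    exact h1

/-- A monomial is its own top-degree component. -/
lemma prod_X_mem_gr {I : Ideal (MvPolynomial (Fin n) ℂ)} {S : Finset (Fin n)}
    (h : ∏ i ∈ S, (MvPolynomial.X i : MvPolynomial (Fin n) ℂ) ∈ I) :
    ∏ i ∈ S, (MvPolynomial.X i : MvPolynomial (Fin n) ℂ) ∈ gr I := by
  have h1 : (∏ i ∈ S, (MvPolynomial.X i : MvPolynomial (Fin n) ℂ)).IsHomogeneous (∑ _i ∈ S, 1) :=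
    MvPolynomial.IsHomogeneous.prod _ _ _ fun i _ => MvPolynomial.isHomogeneous_X _ _
  have h2 : ∏ i ∈ S, (MvPolynomial.X i : MvPolynomial (Fin n) ℂ) ≠ 0 :=
    Finset.prod_ne_zero_iff.2 fun i _ => MvPolynomial.X_ne_zero i
  refine Ideal.subset_span ⟨_, h, ?_⟩
  rw [h1.totalDegree h2, MvPolynomial.homogeneousComponent_of_mem h1, if_pos rfl]

/-- The polynomial `F` vanishes on `G.𝔲`. -/
def VanishesOnSaturation (d : Fin n → ℤ)
    (F : MvPolynomial ((Fin n ⊕ Fin n) × (Fin n ⊕ Fin n)) ℂ) : Prop :=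
  ∀ g : Sp n, ∀ Y ∈ nilradical d,
    MvPolynomial.eval (fun ij => ((g : Mat n) * Y * sadj (g : Mat n)) ij.1 ij.2) F = 0

/-- The ideal of G.e is stable under G, so vanishing on 𝔲 spreads to G.𝔲 by translating F. -/
lemma IsRichardson.vanishesOnSaturation {e : Mat n} (he : IsRichardson d e)
    {F : MvPolynomial ((Fin n ⊕ Fin n) × (Fin n ⊕ Fin n)) ℂ} (hF : F ∈ idealOf (orbit e)) :
    VanishesOnSaturation d F := by
  intro g Y hY
  let F' := MvPolynomial.aeval (fun ij : (Fin n ⊕ Fin n) × (Fin n ⊕ Fin n) =>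
    (((g : Mat n).map MvPolynomial.C * genericMat n * (sadj (g : Mat n)).map MvPolynomial.C :
      Matrix (Fin n ⊕ Fin n) (Fin n ⊕ Fin n) _) ij.1 ij.2)) F
  have hF' : ∀ Z : Mat n, MvPolynomial.eval (fun ij => Z ij.1 ij.2) F' =
      MvPolynomial.eval (fun ij => ((g : Mat n) * Z * sadj (g : Mat n)) ij.1 ij.2) F := by
    intro Z
    rw [← MvPolynomial.aeval_eq_eval, ← MvPolynomial.aeval_eq_eval, ← AlgHom.comp_apply,
      MvPolynomial.comp_aeval]
    congr 2
    ext ij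
    have h1 : ∀ M : Mat n, (M.map MvPolynomial.C).map (MvPolynomial.aeval
        (fun ij : (Fin n ⊕ Fin n) × (Fin n ⊕ Fin n) => Z ij.1 ij.2) : _ →ₐ[ℂ] ℂ) = M := by
      intro M
      ext i j
      simp
    have h2 : (genericMat n).map (MvPolynomial.aeval
        (fun ij : (Fin n ⊕ Fin n) × (Fin n ⊕ Fin n) => Z ij.1 ij.2) : _ →ₐ[ℂ] ℂ) = Z := by
      ext i j
      simp [genericMat]
    rw [aeval_matrix_apply, Matrix.map_mul, Matrix.map_mul, h1, h1, h2]
  rw [← hF']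
  refine he.2 F' (mem_idealOf_iff.2 ?_) Y hY
  rintro _ ⟨h, rfl⟩
  rw [hF']
  refine mem_idealOf_iff.1 hF _ ⟨g * h, ?_⟩
  rw [coe_inv_eq_sadj, coe_inv_eq_sadj]
  change _ = (g : Mat n) * (h : Mat n) * e * sadj ((g : Mat n) * (h : Mat n))
  rw [sadj_mul]
  simp only [Matrix.mul_assoc]

/-- The saturation `G.𝔲` of the nilradical. -/
def saturation (d : Fin n → ℤ) : Set (Mat n) :=
  {N | ∃ g : Sp n, ∃ Y ∈ nilradical d, N = (g : Mat n) * Y * sadj (g : Mat n)}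

lemma mem_saturation_of_conj {h N : Mat n} (hh : h * sadj h = 1)
    (hN : h * N * sadj h ∈ saturation d) : N ∈ saturation d := by
  obtain ⟨g, Y, hY, e⟩ := hN
  have hh' := mul_eq_one_comm.1 hh
  have hs : sadj h ∈ symplecticGroup (Fin n) ℂ := (mem_symplectic_iff _).2 (by rw [sadj_sadj, hh'])
  refine ⟨⟨_, hs⟩ * g, Y, hY, ?_⟩
  change _ = sadj h * (g : Mat n) * Y * sadj (sadj h * (g : Mat n))
  rw [sadj_mul, sadj_sadj, show sadj h * (g : Mat n) * Y * (sadj (g : Mat n) * h) =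
    sadj h * ((g : Mat n) * Y * sadj (g : Mat n)) * h by simp only [Matrix.mul_assoc], ← e,
    show sadj h * (h * N * sadj h) * h = sadj h * h * N * (sadj h * h) by
      simp only [Matrix.mul_assoc], hh', Matrix.one_mul, Matrix.mul_one]

/-- Symmetric matrices with suitable support define elements of the saturation of the nilradical. -/
lemma fromBlocks_mem_saturation {B : Matrix (Fin n) (Fin n) ℂ} (hB : Bᵀ = B)
    (h0 : ∀ i j, d i = 0 → d j = 0 → B i j = 0) : fromBlocks 0 B 0 0 ∈ saturation d := by
  have hs := (mem_symplectic_iff _).1 (signSwap_mem (E := ℂ) d)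
  set N : Mat n := fromBlocks 0 B 0 0 with hN
  have hNs : sadj N = -N := by
    rw [hN, sadj_fromBlocks, hB, fromBlocks_neg]
    simp
  -- With |d| in place of d, an entry of B has weight gap |d i| + |d j|. It belongs to 𝔲 unless both
  -- terms are zero, and those entries vanish by hypothesis.
  have hN0 : ∀ i j, wt (fun i => |d i|) i ≤ wt (fun i => |d i|) j → N i j = 0 := by
    rintro (i | i) (j | j) hij
    · rfl
    · simp only [wt, Sum.elim_inl, Sum.elim_inr] at hij
      have h1 := abs_nonneg (d i)
      have h2 := abs_nonneg (d j)
      exact h0 i j (abs_eq_zero.1 (by omega)) (abs_eq_zero.1 (by omega))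
    · rfl
    · rfl
  refine mem_saturation_of_conj hs ⟨1, signSwap ℂ d * N * sadj (signSwap ℂ d), ⟨?_, ?_⟩, by
    simp⟩
  · rw [mem_sp_iff, sadj_mul, sadj_mul, sadj_sadj, hNs]
    simp [Matrix.mul_assoc]
  · exact fun i j hij =>
      signSwap_conj_eq_zero (hN0 _ _ (by rwa [wt_abs_swapIdx, wt_abs_swapIdx]))

lemma blockGL_conj {A A' : Matrix (Fin n) (Fin n) ℂ} (B : Matrix (Fin n) (Fin n) ℂ) :
    blockGL A A' * fromBlocks 0 B 0 0 * sadj (blockGL A A') = fromBlocks 0 (A * B * Aᵀ) 0 0 := by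
  rw [blockGL, sadj_fromBlocks, fromBlocks_multiply, fromBlocks_multiply]
  simp

/-- Sums of `c + 1` commuting long root vectors lie in the saturation of the nilradical. -/
theorem indicator_mem_saturation {i₀ i₁ : Fin n} (h₀ : d i₀ = 0) (h₁ : d i₁ ≠ 0)
    (S : Finset (Fin n)) (hS : S.card = (Finset.univ.filter fun i => d i ≠ 0).card + 1) :
    (fromBlocks 0 (diagonal fun i => if i ∈ S then 1 else 0) 0 0 : Mat n) ∈ saturation d := by
  have hne : i₀ ≠ i₁ := fun e => h₁ (e ▸ h₀)
  set D : Finset (Fin n) := insert i₀ (Finset.univ.filter fun i => d i ≠ 0) with hD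
  have hDS : D.card = S.card := by
    rw [hS, hD, Finset.card_insert_of_notMem (by simp [h₀])]
  -- A permutation moves S to D, which contains just one index of weight zero.
  let σ : Equiv.Perm (Fin n) := (Finset.equivOfCardEq hDS).extendSubtype
  have hσ : ∀ i, σ i ∈ S ↔ i ∈ D := fun i =>
    ⟨fun h => by_contra fun hi => Equiv.extendSubtype_not_mem (Finset.equivOfCardEq hDS) i hi h,
      fun h => Equiv.extendSubtype_mem (Finset.equivOfCardEq hDS) i h⟩
  let P : Matrix (Fin n) (Fin n) ℂ := (1 : Matrix (Fin n) (Fin n) ℂ).submatrix σ id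
  have hP : ∀ M : Matrix (Fin n) (Fin n) ℂ, P * M * Pᵀ = M.submatrix σ σ := by
    intro M
    ext i j
    simp [P, Matrix.mul_apply, Matrix.one_apply]
  have hPP : P * Pᵀ = 1 := by
    have := hP 1
    rw [Matrix.mul_one] at this
    rw [this]
    exact Matrix.submatrix_one_equiv σ
  -- Congruence by T changes the (i₀,i₀) entry of the form to 1 + I² = 0, and thus clears the whole
  -- zero-weight block. This step needs an index i₁ with d i₁ ≠ 0.
  let T : Matrix (Fin n) (Fin n) ℂ := 1 + Matrix.single i₀ i₁ Complex.I
  let T' : Matrix (Fin n) (Fin n) ℂ := 1 - Matrix.single i₀ i₁ Complex.I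
  have hTT : T * T' = 1 := by
    have : Matrix.single i₀ i₁ Complex.I * Matrix.single i₀ i₁ Complex.I = 0 :=
      Matrix.single_mul_single_of_ne _ _ _ _ (Ne.symm hne) _
    simp only [T, T', Matrix.add_mul, Matrix.mul_sub, Matrix.one_mul, Matrix.mul_one, this]
    abel
  refine mem_saturation_of_conj ((mem_symplectic_iff _).1 (blockGL_mem hPP)) ?_
  rw [blockGL_conj, hP]
  refine mem_saturation_of_conj ((mem_symplectic_iff _).1 (blockGL_mem hTT)) ?_
  rw [blockGL_conj]
  refine fromBlocks_mem_saturation ?_ fun k l hk hl => ?_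
  · rw [transpose_mul, transpose_mul, transpose_transpose, Matrix.submatrix_diagonal_equiv,
      diagonal_transpose, Matrix.mul_assoc]
  · rw [Matrix.submatrix_diagonal_equiv, Matrix.mul_apply]
    simp only [mul_diagonal, transpose_apply, Function.comp_apply, hσ]
    have hk1 : k ≠ i₁ := fun e => h₁ (e ▸ hk)
    have hl1 : l ≠ i₁ := fun e => h₁ (e ▸ hl)
    have hT : ∀ m j, d m = 0 → T m j = (if m = j then 1 else 0) +
        if m = i₀ ∧ j = i₁ then Complex.I else 0 := by
      intro m j _
      simp only [T, Matrix.add_apply, Matrix.one_apply, Matrix.single_apply]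
      congr 1
      simp only [eq_comm]
    simp only [hT k _ hk, hT l _ hl]
    have hsub : ∀ j, j ≠ i₀ → j ≠ i₁ → ((if k = j then 1 else 0) +
        if k = i₀ ∧ j = i₁ then Complex.I else 0) * (if j ∈ D then 1 else 0) *
        ((if l = j then 1 else 0) + if l = i₀ ∧ j = i₁ then Complex.I else 0) = 0 := by
      intro j hj0 hj1
      simp only [hj1, and_false, if_false, add_zero]
      by_cases hkj : k = j
      · have : j ∉ D := by
          rw [hD, Finset.mem_insert, Finset.mem_filter]
          simp [← hkj, hk, show k ≠ i₀ from hkj ▸ hj0]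
        simp [this]
      · simp [hkj]
    rw [← Finset.sum_subset (Finset.subset_univ {i₀, i₁}) fun j _ hj => by
      rw [Finset.mem_insert, Finset.mem_singleton, not_or] at hj
      exact hsub j hj.1 hj.2, Finset.sum_pair hne]
    have hi0 : i₀ ∈ D := Finset.mem_insert_self _ _
    have hi1 : i₁ ∈ D := by simp [hD, h₁]
    by_cases hk0 : k = i₀ <;> by_cases hl0 : l = i₀ <;>
      simp [hk0, hl0, hi0, hi1, hk1, hl1, hne]

/-- A family of nilpotent elements of `𝔰𝔩(2)ⁿ ⊆ 𝔰𝔭(2n)`. -/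
def sl2Nilp {E : Type*} [CommRing E] (S : Finset (Fin n)) (α β : Fin n → E) :
    Matrix (Fin n ⊕ Fin n) (Fin n ⊕ Fin n) E :=
  fromBlocks (diagonal fun i => if i ∈ S then α i * β i else 0)
    (diagonal fun i => if i ∈ S then α i ^ 2 else 0)
    (diagonal fun i => if i ∈ S then -β i ^ 2 else 0)
    (diagonal fun i => if i ∈ S then -(α i * β i) else 0)

/-- In each plane, the nilpotent is the conjugate of the standard one by the matrix (α, 0; -β, α⁻¹)
of SL₂. -/
lemma sl2Nilp_mem_saturation {S : Finset (Fin n)}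
    (hS : (fromBlocks 0 (diagonal fun i => if i ∈ S then 1 else 0) 0 0 : Mat n) ∈ saturation d)
    {α β : Fin n → ℂ} (hα : ∀ i, α i ≠ 0) : sl2Nilp S α β ∈ saturation d := by
  have hb := (mem_symplectic_iff _).1 (blockSL_mem (E := ℂ) (a := α) (b := 0) (c := -β)
    (e := α⁻¹) fun i => by simp [hα i])
  have hb' := mul_eq_one_comm.1 hb
  set b := blockSL α 0 (-β) α⁻¹ with hbd
  refine mem_saturation_of_conj (h := sadj b) (by rw [sadj_sadj, hb']) ?_
  have e : sl2Nilp S α β =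
      b * fromBlocks 0 (diagonal fun i => if i ∈ S then 1 else 0) 0 0 * sadj b := by
    rw [hbd, blockSL, sadj_fromBlocks, fromBlocks_multiply, fromBlocks_multiply, sl2Nilp]
    simp only [diagonal_transpose, diagonal_mul_diagonal, Matrix.mul_zero, Matrix.zero_mul,
      add_zero, zero_add, Pi.zero_apply, diagonal_neg, Pi.neg_apply, neg_neg]
    congr 2 <;> ext i <;> split_ifs <;> ring
  rw [e, sadj_sadj, show sadj b * (b * fromBlocks 0 (diagonal fun i => if i ∈ S then 1 else 0) 0 0 *
    sadj b) * b = (sadj b * b) * fromBlocks 0 (diagonal fun i => if i ∈ S then 1 else 0) 0 0 *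
    (sadj b * b) by simp only [Matrix.mul_assoc], hb', Matrix.one_mul, Matrix.mul_one]
  exact hS

/-- Products of `c + 1` coordinates do not vanish on the scheme-theoretic intersection of the closure
of a Richardson orbit with the Cartan subalgebra. -/
theorem prod_X_notMem_cartanIdeal {e : Mat n} (he : IsRichardson d e) {S : Finset (Fin n)}
    (hS : (fromBlocks 0 (diagonal fun i => if i ∈ S then 1 else 0) 0 0 : Mat n) ∈ saturation d) :
    ∏ i ∈ S, (MvPolynomial.X i : MvPolynomial (Fin n) ℂ) ∉ cartanIdeal (orbit e) := by
  intro hmem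
  obtain ⟨F, hF, hFX⟩ := (Ideal.mem_map_iff_of_surjective _ (toCartan_surjective n)).1 hmem
  have hvan := he.vanishesOnSaturation hF
  let R := MvPolynomial (Fin n ⊕ Fin n) ℂ
  let α : Fin n → R := fun i => MvPolynomial.X (Sum.inl i)
  let β : Fin n → R := fun i => MvPolynomial.X (Sum.inr i)
  let Q : R := MvPolynomial.aeval (fun ij : (Fin n ⊕ Fin n) × (Fin n ⊕ Fin n) =>
    sl2Nilp S α β ij.1 ij.2) F
  have hQ : Q = 0 := by
    -- The case of vanishing α_i, where the conjugating matrix is undefined, is absorbed by an extra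
    -- factor.
    suffices h : Q * ∏ i, α i = 0 from
      (mul_eq_zero.1 h).resolve_right (Finset.prod_ne_zero_iff.2 fun i _ => MvPolynomial.X_ne_zero _)
    refine MvPolynomial.funext fun v => ?_
    rw [map_mul, map_prod, map_zero]
    by_cases hv : ∀ i, v (Sum.inl i) ≠ 0
    · obtain ⟨g, Y, hY, e⟩ := sl2Nilp_mem_saturation hS (β := fun i => v (Sum.inr i)) hv
      have h1 := hvan g Y hY
      rw [← e] at h1
      have h2 : MvPolynomial.eval v Q = 0 := by
        rw [← h1, ← MvPolynomial.aeval_eq_eval, ← MvPolynomial.aeval_eq_eval]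
        change MvPolynomial.aeval v (MvPolynomial.aeval _ F) = _
        rw [← AlgHom.comp_apply, MvPolynomial.comp_aeval]
        congr 2
        ext ij
        obtain ⟨i | i, j | j⟩ := ij <;>
          simp only [sl2Nilp, fromBlocks_apply₁₁, fromBlocks_apply₁₂, fromBlocks_apply₂₁,
            fromBlocks_apply₂₂, diagonal_apply] <;> split_ifs <;> simp [α, β]
      rw [h2, zero_mul]
    · push Not at hv
      obtain ⟨i, hi⟩ := hv
      rw [Finset.prod_eq_zero (Finset.mem_univ i) (by simpa [α] using hi), mul_zero]
  -- Modulo the squares of the variables, the off-diagonal entries of the nilpotent family vanish.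
  -- It becomes the point diag(αβ,-αβ) of 𝔥 with nilpotent coordinates, and F restricts there to the
  -- monomial.
  set I : Ideal R := Ideal.span ((fun s => MvPolynomial.monomial s (1 : ℂ)) ''
    (Set.range fun j : Fin n ⊕ Fin n => Finsupp.single j 2)) with hI
  have hsq : ∀ j, (MvPolynomial.X j : R) ^ 2 ∈ I := fun j =>
    Ideal.subset_span ⟨_, ⟨j, rfl⟩, by rw [MvPolynomial.X_pow_eq_monomial]⟩
  have hprod : ∏ i ∈ S, (α i * β i) ∈ I := by
    refine mem_of_forall_quotient fun B _ _ π hπ => ?_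
    have hπ2 : ∀ j, π (MvPolynomial.X j) ^ 2 = 0 := fun j => by
      rw [← map_pow]
      exact hπ (hsq j)
    let χ : MvPolynomial (Fin n) ℂ →ₐ[ℂ] B :=
      MvPolynomial.aeval fun i => if i ∈ S then π (α i * β i) else 0
    have h1 : π Q = χ (toCartan n F) := by
      change π (MvPolynomial.aeval _ F) = _
      rw [toCartan, ← AlgHom.comp_apply, ← AlgHom.comp_apply, MvPolynomial.comp_aeval,
        MvPolynomial.comp_aeval]
      congr 2
      ext ij
      obtain ⟨i | i, j | j⟩ := ij <;>
        simp only [sl2Nilp, fromBlocks_apply₁₁, fromBlocks_apply₁₂, fromBlocks_apply₂₁,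
          fromBlocks_apply₂₂, diagonal_apply, Sum.inl.injEq, Sum.inr.injEq, Sum.elim_inl,
          Sum.elim_inr, reduceCtorEq, if_false, map_zero] <;> split_ifs <;>
        simp_all [α, β, χ]
    rw [hQ, map_zero, hFX, map_prod] at h1
    rw [map_prod, h1]
    refine Finset.prod_congr rfl fun i hi => ?_
    simp [χ, hi]
  have hmon : ∏ i ∈ S, (α i * β i) = MvPolynomial.monomial
      (∑ i ∈ S, (Finsupp.single (Sum.inl i) 1 + Finsupp.single (Sum.inr i) 1)) (1 : ℂ) := by
    rw [MvPolynomial.monomial_sum_one]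
    refine Finset.prod_congr rfl fun i _ => ?_
    exact MvPolynomial.monomial_mul.trans (by rw [one_mul])
  -- I is a monomial ideal generated by squares, whereas each variable occurs at most once in the
  -- product.
  rw [hmon, hI, MvPolynomial.mem_ideal_span_monomial_image] at hprod
  obtain ⟨_, ⟨j, rfl⟩, hj⟩ := hprod _ (by
    rw [MvPolynomial.support_monomial, if_neg one_ne_zero, Finset.mem_singleton])
  have h2 := hj j
  simp only [Finsupp.single_eq_same, Finsupp.coe_finsetSum, Finset.sum_apply, Finsupp.add_apply] at h2
  rcases j with j | j
  · simp [Finsupp.single_apply, Finset.sum_ite_eq'] at h2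
    split_ifs at h2 <;> omega
  · simp [Finsupp.single_apply, Finset.sum_ite_eq'] at h2
    split_ifs at h2 <;> omega

end CartanIdeals

/-! ### Functions fixed by the opposite unipotent radical -/

section OppositeUnipotent

variable {n : ℕ} {d : Fin n → ℤ}

/-- Elements of the unipotent radical of the opposite parabolic subgroup, for a Siegel parabolic. -/
def IsOppUnip (d : Fin n → ℤ) (u : Mat n) : Prop :=
  ∀ i j, ¬ (wt d i < 0 ∧ 0 < wt d j) → u i j = (1 : Mat n) i j

/-- The minor whose non-vanishing defines the big cell. -/
def cellMinor {E : Type*} [CommRing E] (d : Fin n → ℤ)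
    (g : Matrix (Fin n ⊕ Fin n) (Fin n ⊕ Fin n) E) : E :=
  (sadj (signSwap E d) * g * signSwap E d).toBlocks₁₁.det

lemma map_signSwap {E F : Type*} [CommRing E] [CommRing F] (φ : E →+* F) :
    (signSwap E d).map φ = signSwap F d := by
  rw [signSwap, signSwap, blockSL, blockSL, fromBlocks_map]
  simp only [diagonal_map (map_zero φ)]
  congr 2 <;> ext i <;> split_ifs <;> simp

lemma map_cellMinor {E F : Type*} [CommRing E] [CommRing F] (φ : E →+* F)
    (g : Matrix (Fin n ⊕ Fin n) (Fin n ⊕ Fin n) E) :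
    φ (cellMinor d g) = cellMinor d (g.map φ) := by
  rw [cellMinor, cellMinor, RingHom.map_det, ← map_signSwap φ, ← map_sadj, ← Matrix.map_mul,
    ← Matrix.map_mul]
  rfl

lemma cellMinor_one : cellMinor d (1 : Mat n) = 1 := by
  rw [cellMinor, Matrix.mul_one, mul_eq_one_comm.1 ((mem_symplectic_iff _).1 (signSwap_mem d)),
    ← fromBlocks_one, toBlocks_fromBlocks₁₁, det_one]

/-- After making d dominant this is block elimination: for an invertible upper left block a, the
factor (1, 0; ca⁻¹, 1) splits off on the left, and it is symplectic because ca⁻¹ is symmetric. -/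
theorem exists_oppUnip_mul_par {r : ℤ} (hr : 0 < r) (hd : ∀ i, |d i| = r) (g : Sp n)
    (hg : cellMinor d (g : Mat n) ≠ 0) :
    ∃ u p : Sp n, IsOppUnip d (u : Mat n) ∧ IsPar d (p : Mat n) ∧ u * p = g := by
  let s : Sp n := ⟨signSwap ℂ d, signSwap_mem d⟩
  let g' : Sp n := s⁻¹ * g * s
  set a := (g' : Mat n).toBlocks₁₁ with ha
  set b := (g' : Mat n).toBlocks₁₂ with hb
  set c := (g' : Mat n).toBlocks₂₁ with hc
  set e := (g' : Mat n).toBlocks₂₂ with he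
  have hg' : (g' : Mat n) = fromBlocks a b c e := (fromBlocks_toBlocks _).symm
  have hdet : IsUnit a.det := IsUnit.mk0 _ hg
  have hmem := g'.2
  rw [hg', SymplecticGroup.fromBlocks_mem_iff] at hmem
  have hX : (c * a⁻¹)ᵀ = c * a⁻¹ := by
    have h1 : aᵀ * c = cᵀ * a := hmem.1
    calc (c * a⁻¹)ᵀ = (a⁻¹)ᵀ * (cᵀ * a) * a⁻¹ := by
          rw [transpose_mul, Matrix.mul_assoc, Matrix.mul_assoc, mul_nonsing_inv _ hdet,
            Matrix.mul_one]
      _ = (a * a⁻¹)ᵀ * (c * a⁻¹) := by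
          rw [← h1, transpose_mul]
          simp only [Matrix.mul_assoc]
      _ = _ := by rw [mul_nonsing_inv _ hdet, transpose_one, Matrix.one_mul]
  let u' : Sp n := ⟨fromBlocks 1 0 (c * a⁻¹) 1, by
    rw [SymplecticGroup.fromBlocks_mem_iff]
    refine ⟨?_, ?_, ?_⟩ <;> simp [hX]⟩
  let p' : Sp n := u'⁻¹ * g'
  have hp' : (p' : Mat n) = fromBlocks a b 0 (-(c * a⁻¹ * b) + e) := by
    change sadj (fromBlocks 1 0 (c * a⁻¹) 1) * (g' : Mat n) = _
    rw [sadj_fromBlocks, hX, hg', fromBlocks_multiply]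
    congr 1
    · simp
    · simp
    · rw [Matrix.neg_mul, Matrix.mul_assoc, nonsing_inv_mul _ hdet]
      simp
    · simp
  refine ⟨s * u' * s⁻¹, s * p' * s⁻¹, ?_, ?_, ?_⟩
  · intro i j hij
    have h1 : ((s * u' * s⁻¹ : Sp n) : Mat n) - 1 =
        signSwap ℂ d * ((u' : Mat n) - 1) * sadj (signSwap ℂ d) := by
      rw [Matrix.mul_sub, Matrix.sub_mul, Matrix.mul_one, (mem_symplectic_iff _).1 (signSwap_mem d)]
      rfl
    rw [← sub_eq_zero, ← Matrix.sub_apply, h1]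
    refine signSwap_conj_eq_zero ?_
    have h2 : (u' : Mat n) - 1 = fromBlocks 0 0 (c * a⁻¹) 0 := by
      change fromBlocks 1 0 (c * a⁻¹) 1 - 1 = _
      rw [← fromBlocks_one, sub_eq_add_neg, fromBlocks_neg, fromBlocks_add]
      simp
    rw [h2]
    have h3 := wt_abs_swapIdx d i
    have h4 := wt_abs_swapIdx d j
    rcases hi : swapIdx d i with k | k <;> rcases hj : swapIdx d j with l | l <;> try rfl
    exfalso
    rw [hi] at h3
    rw [hj] at h4
    simp only [wt, Sum.elim_inl, Sum.elim_inr, hd] at h3 h4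
    exact hij ⟨by simp only [wt]; omega, by simp only [wt]; omega⟩
  · refine isPar_signSwap_conj fun i j hij => ?_
    rw [hp']
    rcases i with i | i <;> rcases j with j | j <;>
      simp only [wt, Sum.elim_inl, Sum.elim_inr, hd] at hij
    · omega
    · omega
    · rfl
    · omega
  · simp only [p', g']
    group

lemma IsOppUnip.sadj_apply {u : Mat n} (hu : IsOppUnip d u) (i j)
    (hij : ¬ (wt d i < 0 ∧ 0 < wt d j)) : sadj u i j = (1 : Mat n) i j := by
  rw [SpFlat.sadj_apply, hu, ← SpFlat.sadj_apply, sadj_one]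
  rw [wt_swap, wt_swap]
  omega

/-- The part of `g Y g⁻¹` which determines functions fixed by the opposite unipotent radical. -/
def upperPart {E : Type*} [Zero E] (d : Fin n → ℤ) (A : Matrix (Fin n ⊕ Fin n) (Fin n ⊕ Fin n) E)
    (y : Fin n ⊕ Fin n → E) : Matrix (Fin n ⊕ Fin n) (Fin n ⊕ Fin n) E :=
  Matrix.of fun i j => if i = j then y i else if wt d j < wt d i then A i j else 0

lemma map_upperPart {E F : Type*} [CommRing E] [CommRing F] (φ : E →+* F)
    (A : Matrix (Fin n ⊕ Fin n) (Fin n ⊕ Fin n) E) (y : Fin n ⊕ Fin n → E) :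
    (upperPart d A y).map φ = upperPart d (A.map φ) fun i => φ (y i) := by
  ext i j
  simp only [upperPart, Matrix.map_apply, Matrix.of_apply]
  split_ifs <;> simp

/-- The only weights are r and -r. For wt j < wt i, row i of u and column j of u⁻¹ are those of the
identity, so conjugation by u does not change the 𝔲-part of Y. -/
lemma upperPart_conj {r : ℤ} (hd : ∀ i, |d i| = r) {u Y : Mat n}
    (hu : IsOppUnip d u) (hY : IsComm d Y) :
    upperPart d (u * Y * sadj u) (fun i => Y i i) = Y := by
  have hwt : ∀ i, wt d i = r ∨ wt d i = -r := by
    rintro (i | i) <;> have := hd i <;> simp only [wt, Sum.elim_inl, Sum.elim_inr] <;>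
      rcases abs_cases (d i) with h | h <;> omega
  ext i j
  simp only [upperPart, Matrix.of_apply]
  split_ifs with h1 h2
  · rw [h1]
  · have h3 : ∀ k, u i k = (1 : Mat n) i k := fun k => hu i k (by
      have := hwt i; have := hwt j; omega)
    have h4 : ∀ k, sadj u k j = (1 : Mat n) k j := fun k => hu.sadj_apply k j (by
      have := hwt i; have := hwt j; omega)
    simp only [Matrix.mul_apply, h3, h4, Matrix.one_apply]
    simp
  · exact (hY.zero i j (not_lt.1 h2) h1).symm

lemma aeval_mem_subalgebra {ι : Type*} {A : Type*} [CommRing A] [Algebra ℂ A] (S : Subalgebra ℂ A)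
    (x : ι → A) (hx : ∀ i, x i ∈ S) (F : MvPolynomial ι ℂ) : MvPolynomial.aeval x F ∈ S := by
  rw [MvPolynomial.aeval_def, MvPolynomial.eval₂_eq]
  exact sum_mem fun m _ => mul_mem (S.algebraMap_mem _) (prod_mem fun i _ => pow_mem (hx i) _)

/-- Elements of the coordinate ring fixed by the opposite unipotent radical of a Siegel parabolic are
polynomials in the entries of `g Y g⁻¹` and the diagonal entries of `Y`. -/
theorem mem_entryAlg_of_fixed {r : ℤ} (hr : 0 < r) (hd : ∀ i, |d i| = r) (f : coordRing d)
    (hf : ∀ u : Sp n, IsOppUnip d (u : Mat n) → ∀ (g : Sp n) (Y : commPerp d),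
      evalAt (u * g, Y) f = evalAt (g, Y) f) : f ∈ entryAlg d := by
  obtain ⟨F, hFi, hF⟩ := (mem_coordRing_iff _).1 f.2
  let D := upperPart d (conjMat d) (diagEntry d)
  have hD : ∀ i j, D i j ∈ entryAlg d := by
    intro i j
    simp only [D, upperPart, Matrix.of_apply]
    split_ifs
    · exact Algebra.subset_adjoin (Or.inr ⟨i, rfl⟩)
    · exact Algebra.subset_adjoin (Or.inl ⟨(i, j), rfl⟩)
    · exact zero_mem _
  have key : f = MvPolynomial.aeval (pt 1 D) F := by
    let D' := upperPart d (polyA n) fun i => polyY n i i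
    have hD' : ∀ g Y : Mat n, D'.map (MvPolynomial.aeval (pt g Y) : Poly n →ₐ[ℂ] ℂ) =
        upperPart d (g * Y * sadj g) fun i => Y i i := by
      intro g Y
      have h1 := map_upperPart (d := d) ((MvPolynomial.aeval (pt g Y) : Poly n →ₐ[ℂ] ℂ) : _ →+* ℂ)
        (polyA n) fun i => polyY n i i
      have h2 : (polyA n).map ((MvPolynomial.aeval (pt g Y) : Poly n →ₐ[ℂ] ℂ) : _ →+* ℂ) = _ :=
        aeval_polyA g Y
      rw [h2] at h1
      refine h1.trans ?_
      congr 1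
      ext i
      exact aeval_apply_polyY g Y i i
    have hF' : ∀ g Y : Mat n, MvPolynomial.eval (pt g Y) (MvPolynomial.aeval (pt 1 D') F) =
        MvPolynomial.eval (pt 1 (upperPart d (g * Y * sadj g) fun i => Y i i)) F := by
      intro g Y
      rw [← MvPolynomial.aeval_eq_eval, ← MvPolynomial.aeval_eq_eval, ← hD']
      have := aeval_pt_comp (MvPolynomial.aeval (pt g Y) : Poly n →ₐ[ℂ] ℂ) 1 D' F
      rw [Matrix.map_one _ (map_zero _) (map_one _)] at this
      exact this
    have hδ : ∀ g Y : Mat n, MvPolynomial.eval (pt g Y) (cellMinor d (polyG n)) =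
        cellMinor d g := by
      intro g Y
      have := map_cellMinor (d := d) ((MvPolynomial.aeval (pt g Y) : Poly n →ₐ[ℂ] ℂ) : _ →+* ℂ)
        (polyG n)
      have h2 : (polyG n).map ((MvPolynomial.aeval (pt g Y) : Poly n →ₐ[ℂ] ℂ) : _ →+* ℂ) = _ :=
        aeval_polyG g Y
      rw [h2] at this
      rw [← MvPolynomial.aeval_eq_eval]
      exact this
    -- On the big cell g = up, invariance gives f(g, Y) = f(p, Y) = F(1, pYp⁻¹), and pYp⁻¹ is
    -- recovered from A and the diagonal of Y. Irreducibility extends the identity off the cell.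
    have hirr := irreducible_symplectic_prod (commPerp d) (fun Y hY Y' hY' t => mem_commPerp_iff.2
      ((mem_commPerp_iff.1 hY).add_smul_sub (mem_commPerp_iff.1 hY') t)) (cellMinor d (polyG n))
      (F - MvPolynomial.aeval (pt 1 D') F) fun g Y hYd => by
        have hY := mem_commPerp_iff.1 hYd
        rw [hδ, map_sub, hF']
        by_cases hg : cellMinor d (g : Mat n) = 0
        · rw [hg, zero_mul]
        obtain ⟨u, p, hu, hp, rfl⟩ := exists_oppUnip_mul_par hr hd g hg
        have h1 := hf u hu p ⟨Y, hYd⟩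
        rw [evalAt_apply, evalAt_apply, hF, hF] at h1
        have h2 := hFi 1 p hp Y hY
        have hY' := hY.conj hp (mul_sadj p)
        have h3 := upperPart_conj hd hu hY'
        have h4 : (fun i => Y i i) = fun i => ((p : Mat n) * Y * sadj (p : Mat n)) i i := by
          ext i
          exact (hY.conj_diag hp (mul_sadj p) i).symm
        have h5 : ((u * p : Sp n) : Mat n) * Y * sadj ((u * p : Sp n) : Mat n) =
            (u : Mat n) * ((p : Mat n) * Y * sadj (p : Mat n)) * sadj (u : Mat n) := by
          change (u : Mat n) * (p : Mat n) * Y * sadj ((u : Mat n) * (p : Mat n)) = _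
          rw [sadj_mul]
          simp only [Matrix.mul_assoc]
        rw [h4, h5, h3, h1]
        change _ * (MvPolynomial.eval (pt (p : Mat n) Y) F - _) = 0
        have h6 : ((1 : Sp n) : Mat n) = 1 := rfl
        rw [h6, Matrix.one_mul] at h2
        rw [h2, sub_self, mul_zero]
    rcases hirr with h | h
    · have := h 1 _ (mem_commPerp_iff.2 (isComm_cartan d))
      rw [hδ] at this
      exact absurd (this.symm.trans cellMinor_one) zero_ne_one
    · refine coordRing_ext fun q => ?_
      obtain ⟨g, Y⟩ := q
      have h1 := h g Y Y.2
      rw [map_sub, sub_eq_zero, hF'] at h1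
      rw [evalAt_apply, hF, h1, aeval_pt_comp, Matrix.map_one _ (map_zero _) (map_one _),
        MvPolynomial.aeval_eq_eval]
      have h2 := map_upperPart (d := d) (evalAt (g, Y) : coordRing d →+* ℂ) (conjMat d) (diagEntry d)
      have h3 : (conjMat d).map (evalAt (g, Y) : coordRing d →+* ℂ) = _ := conjMat_map g Y
      rw [h3] at h2
      have h4 : D.map (evalAt (g, Y)) = upperPart d ((g : Mat n) * (Y : Mat n) * sadj (g : Mat n))
          fun i => (Y : Mat n) i i := by
        refine h2.trans ?_
        congr 1
        funext i
        exact evalAt_diagEntry g Y i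
      rw [h4]
  rw [key]
  refine aeval_mem_subalgebra _ _ (fun i => ?_) F
  rcases i with ⟨i, j⟩ | ⟨i, j⟩
  · change (1 : Matrix (Fin n ⊕ Fin n) (Fin n ⊕ Fin n) (coordRing d)) i j ∈ _
    rw [Matrix.one_apply]
    split_ifs
    · exact one_mem _
    · exact zero_mem _
  · exact hD i j

end OppositeUnipotent

/-! ### Complete reducibility -/

section Reducibility

/-- Let a group act on a Hilbert space through operators whose adjoints belong to the image of the
action.  If a set of elements acts unipotently, and every vector of `R` fixed by it lies in the stable
subspace `S`, then `R ≤ S`. -/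
theorem le_of_fixed_mem {E Γ : Type*} [NormedAddCommGroup E] [InnerProductSpace ℂ E]
    [FiniteDimensional ℂ E] (ρ : Γ → E →ₗ[ℂ] E) (hρ : ∀ g, ∃ g', LinearMap.adjoint (ρ g) = ρ g')
    (U : Set Γ) (R S : Submodule ℂ E) (hSR : S ≤ R) (hR : ∀ g, ∀ v ∈ R, ρ g v ∈ R)
    (hS : ∀ g, ∀ v ∈ S, ρ g v ∈ S) (F : ℕ → Submodule ℂ E) (hF₀ : F 0 = ⊥) (hF : ∃ m, F m = ⊤)
    (hFU : ∀ u ∈ U, ∀ k, ∀ v ∈ F (k + 1), ρ u v - v ∈ F k)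
    (hfix : ∀ v ∈ R, (∀ u ∈ U, ρ u v = v) → v ∈ S) : R ≤ S := by
  -- The image of the action being closed under adjoints, the orthogonal complement of a stable
  -- subspace is stable. This is the unitarian trick without a compact group.
  have horth : ∀ g, ∀ v ∈ Sᗮ, ρ g v ∈ Sᗮ := by
    intro g v hv
    obtain ⟨g', hg'⟩ := hρ g
    rw [Submodule.mem_orthogonal]
    intro s hs
    rw [← LinearMap.adjoint_inner_left, hg']
    exact (Submodule.mem_orthogonal _ _).1 hv _ (hS g' s hs)
  -- By induction, the differences ρ(u)v - v of a vector v of R ∩ Sᗮ vanish. Then v is fixed by U,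
  -- so it lies in S as well as in Sᗮ.
  have key : ∀ k, ∀ v ∈ F k, v ∈ R → v ∈ Sᗮ → v = 0 := by
    intro k
    induction k with
    | zero =>
      intro v hv _ _
      rw [hF₀] at hv
      exact (Submodule.mem_bot _).1 hv
    | succ k ih =>
      intro v hv hvR hvS
      have h1 : v ∈ S := hfix v hvR fun u hu => sub_eq_zero.1
        (ih _ (hFU u hu k v hv) (sub_mem (hR u v hvR) hvR) (sub_mem (horth u v hvS) hvS))
      exact inner_self_eq_zero.1 ((Submodule.mem_orthogonal _ _).1 hvS v h1)
  obtain ⟨m, hm⟩ := hF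
  intro v hv
  obtain ⟨s, hs, z, hz, rfl⟩ := Submodule.exists_add_mem_mem_orthogonal (K := S) v
  have hz0 : z = 0 := key m z (hm ▸ Submodule.mem_top) ((add_mem_cancel_left (hSR hs)).1 hv) hz
  rw [hz0, add_zero]
  exact hs

end Reducibility

/-! ### Translations of the coordinate ring -/

section Translation

variable {n : ℕ} {d : Fin n → ℤ}

/-- Translation of functions by an element of the group. -/
def translateFun (d : Fin n → ℤ) (h : Sp n) :
    (Sp n × commPerp d → ℂ) →ₐ[ℂ] (Sp n × commPerp d → ℂ) :=
  AlgHom.pi fun q => Pi.evalAlgHom ℂ (fun _ => ℂ) (h * q.1, q.2)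

lemma translateFun_apply (h : Sp n) (f : Sp n × commPerp d → ℂ) (q) :
    translateFun d h f q = f (h * q.1, q.2) := rfl

lemma translateFun_mem (h : Sp n) {f : Sp n × commPerp d → ℂ} (hf : f ∈ coordRing d) :
    translateFun d h f ∈ coordRing d := by
  obtain ⟨F, hFi, hF⟩ := (mem_coordRing_iff _).1 hf
  refine ⟨⟨MvPolynomial.aeval (pt ((h : Mat n).map (algebraMap ℂ (Poly n)) * polyG n) (polyY n)) F,
    fun g Y => ?_⟩, fun g p hp Y Y' hY => ?_⟩
  · have h1 : ∀ Q : Poly n, MvPolynomial.eval (pt (g : Mat n) (Y : Mat n)) Q =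
        (MvPolynomial.aeval (pt (g : Mat n) (Y : Mat n)) : Poly n →ₐ[ℂ] ℂ) Q := fun Q => by
      rw [MvPolynomial.aeval_eq_eval]
    have h2 : ((MvPolynomial.aeval (pt (g : Mat n) (Y : Mat n)) : Poly n →ₐ[ℂ] ℂ) ∘
        algebraMap ℂ (Poly n)) = id := by
      funext c
      exact AlgHom.commutes _ c
    rw [translateFun_apply, hF]
    refine Eq.trans ?_ (h1 _).symm
    rw [aeval_pt_comp, Matrix.map_mul, aeval_polyG, aeval_polyY, Matrix.map_map, h2, Matrix.map_id,
      MvPolynomial.aeval_eq_eval]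
    rfl
  · rw [translateFun_apply, translateFun_apply, ← mul_assoc]
    exact hf.2 (h * g) p hp Y Y' hY

/-- Translation of elements of the coordinate ring by an element of the group. -/
def translate (d : Fin n → ℤ) (h : Sp n) : coordRing d →ₐ[ℂ] coordRing d :=
  ((translateFun d h).comp (coordRing d).val).codRestrict (coordRing d)
    fun f => translateFun_mem h f.2

lemma evalAt_translate (h g : Sp n) (Y : commPerp d) (f : coordRing d) :
    evalAt (g, Y) (translate d h f) = evalAt (h * g, Y) f := rfl

lemma translate_mem_entryAlg (h : Sp n) {f : coordRing d} (hf : f ∈ entryAlg d) :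
    translate d h f ∈ entryAlg d := by
  induction hf using Algebra.adjoin_induction with
  | mem x hx =>
    rcases hx with ⟨⟨i, j⟩, rfl⟩ | ⟨i, rfl⟩
    · have h1 : translate d h (conjMat d i j) = ((h : Mat n).map (algebraMap ℂ (coordRing d)) *
          conjMat d * (sadj (h : Mat n)).map (algebraMap ℂ (coordRing d))) i j := by
        refine coordRing_ext fun q => ?_
        obtain ⟨g, Y⟩ := q
        rw [evalAt_translate, evalAt_conjMat]
        have h2 := congrFun (congrFun (Matrix.map_mul (L := (h : Mat n).map
          (algebraMap ℂ (coordRing d)) * conjMat d) (M := (sadj (h : Mat n)).map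
          (algebraMap ℂ (coordRing d))) (f := (evalAt (g, Y) : coordRing d →ₐ[ℂ] ℂ))) i) j
        rw [Matrix.map_apply] at h2
        refine Eq.trans ?_ h2.symm
        rw [Matrix.map_mul, Matrix.map_map, Matrix.map_map]
        have h3 : (conjMat d).map (evalAt (g, Y)) = _ := conjMat_map g Y
        have h4 : ((evalAt (g, Y) : coordRing d →ₐ[ℂ] ℂ) ∘ algebraMap ℂ (coordRing d)) = id := by
          funext c
          exact (evalAt (g, Y)).commutes c
        rw [h3, h4, Matrix.map_id, Matrix.map_id]
        change ((h : Mat n) * (g : Mat n) * (Y : Mat n) * sadj ((h : Mat n) * (g : Mat n))) i j = _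
        rw [sadj_mul]
        simp only [Matrix.mul_assoc]
      change translate d h (conjMat d i j) ∈ _
      rw [h1, Matrix.mul_apply]
      refine sum_mem fun k _ => mul_mem ?_ ((entryAlg d).algebraMap_mem _)
      rw [Matrix.mul_apply]
      exact sum_mem fun l _ => mul_mem ((entryAlg d).algebraMap_mem _)
        (Algebra.subset_adjoin (Or.inl ⟨(l, k), rfl⟩))
    · have h1 : translate d h (diagEntry d i) = diagEntry d i := by
        refine coordRing_ext fun q => ?_
        obtain ⟨g, Y⟩ := q
        rw [evalAt_translate, evalAt_diagEntry, evalAt_diagEntry]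
      rw [h1]
      exact Algebra.subset_adjoin (Or.inr ⟨i, rfl⟩)
  | algebraMap c => rw [AlgHom.commutes]; exact (entryAlg d).algebraMap_mem _
  | add x y _ _ h₁ h₂ => rw [map_add]; exact add_mem h₁ h₂
  | mul x y _ _ h₁ h₂ => rw [map_mul]; exact mul_mem h₁ h₂

end Translation

/-! ### Regular functions as tensors -/

section Tensor

variable {n : ℕ} {d : Fin n → ℤ}

/-- The indices of the coordinates of `G × [𝔭,𝔭]^⊥`, with one more index for the constant `1`. -/
abbrev CoordIdx (n : ℕ) : Type :=
  ((Fin n ⊕ Fin n) × (Fin n ⊕ Fin n)) ⊕ (((Fin n ⊕ Fin n) × (Fin n ⊕ Fin n)) ⊕ Unit)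

/-- The coordinates of `G × [𝔭,𝔭]^⊥` and the constant `1`. -/
def coordFun (d : Fin n → ℤ) : CoordIdx n → Sp n × commPerp d → ℂ :=
  Sum.elim (fun p q => (q.1 : Mat n) p.1 p.2)
    (Sum.elim (fun p q => (q.2 : Mat n) p.1 p.2) fun _ _ => 1)

/-- The matrix by which left multiplication with `h` acts on the coordinates. -/
def coordMat (h : Mat n) : Matrix (CoordIdx n) (CoordIdx n) ℂ :=
  fromBlocks (kronecker h 1) 0 0 1

lemma coordFun_translate (h : Sp n) (a : CoordIdx n) (q : Sp n × commPerp d) :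
    coordFun d a (h * q.1, q.2) = ∑ b, coordMat (h : Mat n) a b * coordFun d b q := by
  rcases a with ⟨i, j⟩ | a
  · have h1 : coordFun d (Sum.inl (i, j)) (h * q.1, q.2) = ((h : Mat n) * (q.1 : Mat n)) i j := rfl
    rw [h1, Fintype.sum_sum_type, Matrix.mul_apply, Fintype.sum_prod_type]
    simp [coordMat, coordFun, Matrix.one_apply]
  · rw [Fintype.sum_sum_type]
    simp only [coordMat, fromBlocks_apply₂₁, fromBlocks_apply₂₂, Matrix.zero_apply, zero_mul,
      Finset.sum_const_zero, zero_add, Matrix.one_apply, ite_mul, one_mul, Finset.sum_ite_eq,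
      Finset.mem_univ, if_true]
    rcases a with a | a <;> rfl

/-- The product of the coordinates with the indices `w 0, …, w (m - 1)`. -/
def wordFun (d : Fin n → ℤ) {m : ℕ} (w : Fin m → CoordIdx n) : Sp n × commPerp d → ℂ :=
  ∏ k, coordFun d (w k)

/-- The function defined by a tensor. -/
def tensorEval (d : Fin n → ℤ) (m : ℕ) :
    EuclideanSpace ℂ (Fin m → CoordIdx n) →ₗ[ℂ] (Sp n × commPerp d → ℂ) :=
  (Fintype.linearCombination ℂ (wordFun d)) ∘ₗ (WithLp.linearEquiv 2 ℂ _).toLinearMap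

lemma tensorEval_apply (m : ℕ) (c : EuclideanSpace ℂ (Fin m → CoordIdx n)) (q) :
    tensorEval d m c q = ∑ w, c w * ∏ k, coordFun d (w k) q := by
  change (Fintype.linearCombination ℂ (wordFun d) (fun w => c w)) q = _
  rw [Fintype.linearCombination_apply, Finset.sum_apply]
  refine Finset.sum_congr rfl fun w _ => ?_
  rw [Pi.smul_apply, smul_eq_mul, wordFun, Finset.prod_apply]

lemma range_tensorEval (d : Fin n → ℤ) (m : ℕ) : LinearMap.range (tensorEval d m) =
    Submodule.span ℂ (Set.range fun w : Fin m → CoordIdx n => wordFun d w) := by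
  rw [tensorEval, LinearMap.range_comp, LinearEquiv.range, Submodule.map_top,
    Fintype.range_linearCombination]

lemma coordFun_mul_mem_range (a : CoordIdx n) {m : ℕ} {f : Sp n × commPerp d → ℂ}
    (hf : f ∈ LinearMap.range (tensorEval d m)) :
    coordFun d a * f ∈ LinearMap.range (tensorEval d (m + 1)) := by
  rw [range_tensorEval] at hf ⊢
  induction hf using Submodule.span_induction with
  | mem x hx =>
    obtain ⟨w, rfl⟩ := hx
    refine Submodule.subset_span ⟨Fin.cons a w, ?_⟩
    simp [wordFun, Fin.prod_univ_succ]
  | zero => rw [mul_zero]; exact zero_mem _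
  | add x y _ _ h₁ h₂ => rw [mul_add]; exact add_mem h₁ h₂
  | smul c x _ h => rw [mul_smul_comm]; exact Submodule.smul_mem _ _ h

lemma range_tensorEval_mono : Monotone fun m => LinearMap.range (tensorEval d m) := by
  refine monotone_nat_of_le_succ fun m f hf => ?_
  have h1 := coordFun_mul_mem_range (Sum.inr (Sum.inr ())) hf
  have h2 : coordFun d (Sum.inr (Sum.inr ())) = 1 := rfl
  rwa [h2, one_mul] at h1

lemma IsRegularFun.exists_tensor {f : Sp n × commPerp d → ℂ} (hf : IsRegularFun d f) :
    ∃ m, f ∈ LinearMap.range (tensorEval d m) := by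
  obtain ⟨F, hF⟩ := hf
  have key : ∀ F : Poly n, ∃ m, (fun q : Sp n × commPerp d =>
      MvPolynomial.eval (pt (q.1 : Mat n) (q.2 : Mat n)) F) ∈ LinearMap.range (tensorEval d m) := by
    intro F
    induction F using MvPolynomial.induction_on with
    | C a =>
      refine ⟨0, WithLp.toLp 2 fun _ => a, ?_⟩
      funext q
      rw [tensorEval_apply]
      simp
    | add p q hp hq =>
      obtain ⟨m₁, h₁⟩ := hp
      obtain ⟨m₂, h₂⟩ := hq
      refine ⟨max m₁ m₂, ?_⟩
      have h := add_mem (range_tensorEval_mono (le_max_left m₁ m₂) h₁)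
        (range_tensorEval_mono (le_max_right m₁ m₂) h₂)
      convert h using 1
      funext q
      exact map_add _ _ _
    | mul_X p i hp =>
      obtain ⟨m, h⟩ := hp
      refine ⟨m + 1, ?_⟩
      have h1 := coordFun_mul_mem_range (Sum.elim Sum.inl (fun i => Sum.inr (Sum.inl i)) i) h
      convert h1 using 1
      funext q
      rw [map_mul, MvPolynomial.eval_X, mul_comm]
      rcases i with i | i <;> rfl
  obtain ⟨m, hm⟩ := key F
  refine ⟨m, ?_⟩
  convert hm using 1
  funext q
  exact hF q.1 q.2

/-- The action of a matrix on tensors. -/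
def tensorMat (m : ℕ) (h : Mat n) : Matrix (Fin m → CoordIdx n) (Fin m → CoordIdx n) ℂ :=
  Matrix.of fun w' w => ∏ k, coordMat h (w k) (w' k)

lemma tensorMat_apply_eq (m : ℕ) (h : Mat n) (c : EuclideanSpace ℂ (Fin m → CoordIdx n)) (w') :
    (Matrix.toEuclideanLin (tensorMat m h) c) w' = ∑ w, (∏ k, coordMat h (w k) (w' k)) * c w := by
  rw [Matrix.ofLp_toLpLin]
  rfl

lemma tensorEval_translate (m : ℕ) (h : Sp n) (c : EuclideanSpace ℂ (Fin m → CoordIdx n)) :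
    tensorEval d m (Matrix.toEuclideanLin (tensorMat m (h : Mat n)) c) =
      translateFun d h (tensorEval d m c) := by
  funext q
  rw [translateFun_apply, tensorEval_apply, tensorEval_apply]
  simp only [coordFun_translate, Fintype.prod_sum, tensorMat_apply_eq, Finset.sum_mul,
    Finset.mul_sum]
  rw [Finset.sum_comm]
  refine Finset.sum_congr rfl fun w _ => Finset.sum_congr rfl fun w' _ => ?_
  rw [Finset.prod_mul_distrib]
  ring

/-- The adjoint of the action of h on tensors is the action of hᴴ, which is again symplectic. This
supplies the hypothesis on adjoints in `le_of_fixed_mem`. -/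
lemma conjTranspose_tensorMat (m : ℕ) (h : Mat n) : (tensorMat m h)ᴴ = tensorMat m hᴴ := by
  have h1 : (coordMat h)ᴴ = coordMat hᴴ := by
    rw [coordMat, fromBlocks_conjTranspose, conjTranspose_one, conjTranspose_zero,
      conjTranspose_zero, kronecker, conjTranspose_kronecker, conjTranspose_one]
    rfl
  ext w' w
  rw [conjTranspose_apply, tensorMat, tensorMat, Matrix.of_apply, Matrix.of_apply, star_prod, ← h1]
  rfl

lemma conjTranspose_mem_symplectic {h : Mat n} (hh : h ∈ symplecticGroup (Fin n) ℂ) :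
    hᴴ ∈ symplecticGroup (Fin n) ℂ := by
  have h1 := SymplecticGroup.transpose_mem hh
  rw [mem_symplectic_iff] at h1 ⊢
  have h2 := congrArg (fun M => M.map (starRingEnd ℂ)) h1
  simp only [Matrix.map_mul, map_sadj, Matrix.map_one _ (map_zero _) (map_one _)] at h2
  exact h2

/-- The number of factors of a word which involve a row of negative weight. -/
def negCount (d : Fin n → ℤ) {m : ℕ} (w : Fin m → CoordIdx n) : ℕ :=
  (Finset.univ.filter fun k => ∃ p, w k = Sum.inl p ∧ wt d p.1 < 0).card

/-- An off-diagonal entry of u leads from a row of negative weight to one of positive weight. So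
each nontrivial coefficient of u strictly lowers the count, and u acts unipotently. -/
lemma negCount_lt {u : Mat n} (hu : IsOppUnip d u) {m : ℕ} {w w' : Fin m → CoordIdx n}
    (hne : w ≠ w') (h : ∏ k, coordMat u (w k) (w' k) ≠ 0) : negCount d w' < negCount d w := by
  have key : ∀ k, w k = w' k ∨ ((∃ p, w k = Sum.inl p ∧ wt d p.1 < 0) ∧
      ¬ ∃ p, w' k = Sum.inl p ∧ wt d p.1 < 0) := by
    intro k
    have hk := Finset.prod_ne_zero_iff.1 h k (Finset.mem_univ k)
    rcases h1 : w k with ⟨i, j⟩ | a <;> rcases h2 : w' k with ⟨i', j'⟩ | a' <;>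
      rw [h1, h2] at hk <;> simp [coordMat, Matrix.one_apply] at hk
    · obtain ⟨rfl, h3⟩ := hk
      by_cases h4 : wt d i < 0 ∧ 0 < wt d i'
      · right
        refine ⟨⟨_, rfl, h4.1⟩, ?_⟩
        rintro ⟨p, hp, hp'⟩
        obtain rfl := Sum.inl.inj hp
        exact absurd h4.2 (not_lt.2 hp'.le)
      · left
        rw [hu _ _ h4] at h3
        have h5 : i = i' := by
          by_contra hne'
          exact h3 (Matrix.one_apply_ne hne')
        rw [h5]
    · left
      rw [hk]
  refine Finset.card_lt_card ⟨fun k hk => ?_, fun hsub => hne ?_⟩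
  · rw [Finset.mem_filter] at hk ⊢
    rcases key k with h1 | h1
    · rw [h1]; exact hk
    · exact absurd hk.2 h1.2
  · funext k
    rcases key k with h1 | h1
    · exact h1
    · exact absurd (Finset.mem_filter.1 (hsub (Finset.mem_filter.2 ⟨Finset.mem_univ _, h1.1⟩))).2 h1.2

lemma coordMat_self {u : Mat n} (hu : IsOppUnip d u) (a : CoordIdx n) : coordMat u a a = 1 := by
  rcases a with ⟨i, j⟩ | a
  · have h1 : u i i = 1 := by
      rw [hu i i (fun h => lt_asymm h.1 h.2), Matrix.one_apply_eq]
    simp [coordMat, h1]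
  · simp [coordMat]

/-- The filtration of the space of tensors by the number of rows of negative weight. -/
def negFiltration (d : Fin n → ℤ) (m k : ℕ) : Submodule ℂ (EuclideanSpace ℂ (Fin m → CoordIdx n)) where
  carrier := {c | ∀ w, k ≤ negCount d w → c w = 0}
  add_mem' := fun ha hb w hw => by simp [ha w hw, hb w hw]
  zero_mem' := fun _ _ => rfl
  smul_mem' := fun c a ha w hw => by simp [ha w hw]

lemma tensorMat_sub_mem {u : Mat n} (hu : IsOppUnip d u) {m k : ℕ}
    {c : EuclideanSpace ℂ (Fin m → CoordIdx n)} (hc : c ∈ negFiltration d m (k + 1)) :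
    Matrix.toEuclideanLin (tensorMat m u) c - c ∈ negFiltration d m k := by
  intro w' hw'
  rw [PiLp.sub_apply, tensorMat_apply_eq, Finset.sum_eq_single w']
  · simp [coordMat_self hu]
  · intro w _ hne
    by_cases h : ∏ k, coordMat u (w k) (w' k) = 0
    · rw [h, zero_mul]
    · rw [hc w (Nat.succ_le_of_lt (lt_of_le_of_lt hw' (negCount_lt hu hne h))), mul_zero]
  · exact fun h => absurd (Finset.mem_univ _) h

/-- For a Siegel parabolic, the coordinate ring of the deformation is generated by the entries of
`g Y g⁻¹` and the diagonal entries of `Y`. -/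
theorem entryAlg_eq_top {r : ℤ} (hr : 0 < r) (hd : ∀ i, |d i| = r) : entryAlg d = ⊤ := by
  refine eq_top_iff.2 fun f _ => ?_
  obtain ⟨m, c, hc⟩ := IsRegularFun.exists_tensor f.2.1
  -- The comparison of the coordinate ring with `entryAlg` is pulled back to a finite-dimensional
  -- space of tensors that represents f.
  let R := (Subalgebra.toSubmodule (coordRing d)).comap (tensorEval d m)
  let S := (Subalgebra.toSubmodule ((entryAlg d).map (coordRing d).val)).comap (tensorEval d m)
  have hRS : R ≤ S := by
    refine le_of_fixed_mem (fun h : Sp n => Matrix.toEuclideanLin (tensorMat m (h : Mat n)))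
      (fun h => ⟨⟨_, conjTranspose_mem_symplectic h.2⟩, ?_⟩) {u | IsOppUnip d (u : Mat n)} R S ?_ ?_ ?_
      (negFiltration d m) ?_ ⟨m + 1, ?_⟩ (fun u hu k v hv => tensorMat_sub_mem hu hv) ?_
    · rw [← Matrix.toEuclideanLin_conjTranspose_eq_adjoint, conjTranspose_tensorMat]
    · rintro v ⟨a, -, ha⟩
      change tensorEval d m v ∈ coordRing d
      rw [← ha]
      exact a.2
    · intro h v hv
      change tensorEval d m _ ∈ coordRing d
      rw [tensorEval_translate]
      exact translateFun_mem h hv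
    · rintro h v ⟨a, ha, hav⟩
      refine ⟨translate d h a, translate_mem_entryAlg h ha, ?_⟩
      rw [tensorEval_translate, ← hav]
      rfl
    · refine eq_bot_iff.2 fun v hv => ?_
      rw [Submodule.mem_bot]
      ext w
      exact hv w (Nat.zero_le _)
    · refine eq_top_iff.2 fun v _ w hw => ?_
      have h1 : negCount d w ≤ m := (Finset.card_filter_le _ _).trans (by simp)
      omega
    · intro v hv hfix
      refine ⟨⟨tensorEval d m v, hv⟩, mem_entryAlg_of_fixed hr hd _ fun u hu g Y => ?_, rfl⟩
      have h1 := congrFun (tensorEval_translate (d := d) m u v) (g, Y)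
      rw [hfix u hu] at h1
      exact h1.symm
  have hcR : c ∈ R := by
    change tensorEval d m c ∈ coordRing d
    rw [hc]
    exact f.2
  obtain ⟨a, ha, hac⟩ := hRS hcR
  have h2 : a = f := Subtype.ext (hac.trans hc)
  rwa [← h2]

end Tensor

/-! ### Weak flatness for Siegel parabolics -/

section Algebra

/-- A quotient ring with a basis over the affine line has fibres of constant dimension. -/
theorem rank_quotient_of_basis {R : Type} [CommRing R] [Algebra ℂ R] {ι : Type} [Fintype ι]
    {I J : Ideal R} {t : R} {τ : ℂ} (hI : I = J ⊔ Ideal.span {t - algebraMap ℂ R τ}) (b : ι → R)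
    (hspan : ∀ f, ∃ p : ι → Polynomial ℂ, f - ∑ i, Polynomial.aeval t (p i) * b i ∈ J)
    (hind : ∀ p : ι → Polynomial ℂ, ∑ i, Polynomial.aeval t (p i) * b i ∈ J → p = 0) :
    Module.rank ℂ (R ⧸ I) = Fintype.card ι ∧ Module.Finite ℂ (R ⧸ I) := by
  let π : R →ₐ[ℂ] R ⧸ I := Ideal.Quotient.mkₐ ℂ I
  have hπ : ∀ x, π x = 0 ↔ x ∈ I := fun x => Ideal.Quotient.eq_zero_iff_mem
  have ht : ∀ p : Polynomial ℂ, π (Polynomial.aeval t p) = algebraMap ℂ _ (p.eval τ) := by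
    intro p
    have h1 : π t = algebraMap ℂ _ τ := by
      rw [← sub_eq_zero, ← π.commutes, ← map_sub, hπ, hI]
      exact Ideal.mem_sup_right (Ideal.subset_span rfl)
    rw [← Polynomial.aeval_algHom_apply, h1, Polynomial.aeval_algebraMap_apply,
      Polynomial.coe_aeval_eq_eval]
  have hli : LinearIndependent ℂ fun i => π (b i) := by
    rw [Fintype.linearIndependent_iff]
    intro c hc
    have h1 : ∑ i, algebraMap ℂ R (c i) * b i ∈ I := by
      rw [← hπ, map_sum, ← hc]
      refine Finset.sum_congr rfl fun i _ => ?_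
      rw [map_mul, AlgHom.commutes, Algebra.smul_def]
    rw [hI] at h1
    obtain ⟨j, hj, k, hk, hjk⟩ := Submodule.mem_sup.1 h1
    obtain ⟨f, rfl⟩ := Ideal.mem_span_singleton'.1 hk
    obtain ⟨q, hq⟩ := hspan f
    -- A relation in the fibre equals (t - τ)f modulo J. Expanding f in the b_i and comparing
    -- coefficients, each constant c_i is divisible by X - τ, so it is zero.
    have h2 := hind (fun i => Polynomial.C (c i) - (Polynomial.X - Polynomial.C τ) * q i) (by
      have h3 : ∑ i, Polynomial.aeval t (Polynomial.C (c i) - (Polynomial.X - Polynomial.C τ) * q i)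
          * b i = j + (t - algebraMap ℂ R τ) * (f - ∑ i, Polynomial.aeval t (q i) * b i) := by
        have h4 : ∑ i, Polynomial.aeval t (Polynomial.C (c i) -
            (Polynomial.X - Polynomial.C τ) * q i) * b i = ∑ i, algebraMap ℂ R (c i) * b i -
            (t - algebraMap ℂ R τ) * ∑ i, Polynomial.aeval t (q i) * b i := by
          rw [Finset.mul_sum, ← Finset.sum_sub_distrib]
          refine Finset.sum_congr rfl fun i _ => ?_
          simp only [map_sub, map_mul, Polynomial.aeval_C, Polynomial.aeval_X]
          ring
        rw [h4, ← hjk]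
        ring
      rw [h3]
      exact add_mem hj (Ideal.mul_mem_left _ _ hq))
    intro i
    have h3 := congrArg (Polynomial.eval τ) (congrFun h2 i)
    simpa using h3
  let B : Module.Basis ι ℂ (R ⧸ I) := Module.Basis.mk hli (by
    intro y _
    obtain ⟨f, rfl⟩ := Ideal.Quotient.mk_surjective y
    obtain ⟨p, hp⟩ := hspan f
    have h1 : π f = ∑ i, (p i).eval τ • π (b i) := by
      rw [← sub_eq_zero]
      have h2 := (hπ _).2 (hI ▸ Ideal.mem_sup_left hp)
      rw [map_sub, map_sum] at h2
      rw [← h2]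
      congr 1
      refine Finset.sum_congr rfl fun i _ => ?_
      rw [map_mul, ht, Algebra.smul_def]
    change π f ∈ _
    rw [h1]
    exact sum_mem fun i _ => Submodule.smul_mem _ _ (Submodule.subset_span ⟨i, rfl⟩))
  exact ⟨rank_eq_card_basis B, Module.Finite.of_basis B⟩

/-- An algebra generated by square roots is spanned by the squarefree products of these roots. -/
theorem mem_span_prod_of_mem_adjoin {Λ B κ : Type*} [CommRing Λ] [CommRing B] [Algebra Λ B]
    [DecidableEq κ] (a : κ → B) (s : κ → Λ) (ha : ∀ i, a i * a i = algebraMap Λ B (s i)) {x : B}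
    (hx : x ∈ Algebra.adjoin Λ (Set.range a)) :
    x ∈ Submodule.span Λ (Set.range fun I : Finset κ => ∏ i ∈ I, a i) := by
  set W := Submodule.span Λ (Set.range fun I : Finset κ => ∏ i ∈ I, a i) with hW
  have h1 : (1 : B) ∈ W := Submodule.subset_span ⟨∅, Finset.prod_empty⟩
  have key : ∀ w ∈ W, x * w ∈ W := by
    induction hx using Algebra.adjoin_induction with
    | mem x hx =>
      obtain ⟨i, rfl⟩ := hx
      intro w hw
      induction hw using Submodule.span_induction with
      | mem x hx =>
        obtain ⟨I, rfl⟩ := hx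
        by_cases hi : i ∈ I
        · change a i * ∏ i ∈ I, a i ∈ W
          rw [← Finset.mul_prod_erase I a hi, ← mul_assoc, ha, ← Algebra.smul_def]
          exact Submodule.smul_mem _ _ (Submodule.subset_span ⟨_, rfl⟩)
        · exact Submodule.subset_span ⟨insert i I, Finset.prod_insert hi⟩
      | zero => rw [mul_zero]; exact zero_mem _
      | add x y _ _ h₁ h₂ => rw [mul_add]; exact add_mem h₁ h₂
      | smul c x _ h => rw [mul_smul_comm]; exact Submodule.smul_mem _ _ h
    | algebraMap c =>
      intro w hw
      rw [← Algebra.smul_def]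
      exact Submodule.smul_mem _ _ hw
    | add x y _ _ h₁ h₂ => exact fun w hw => by rw [add_mul]; exact add_mem (h₁ w hw) (h₂ w hw)
    | mul x y _ _ h₁ h₂ => exact fun w hw => by rw [mul_assoc]; exact h₁ _ (h₂ w hw)
  simpa using key 1 h1

/-- A multilinear polynomial which vanishes at all sign vectors is zero. -/
theorem eq_zero_of_sum_signs {κ : Type*} [Fintype κ] [DecidableEq κ] (a : Finset κ → ℂ)
    (h : ∀ σ : κ → Bool, ∑ I, a I * ∏ i ∈ I, (if σ i then (-1 : ℂ) else 1) = 0) (K : Finset κ) :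
    a K = 0 := by
  -- Orthogonality of the characters of the group of sign vectors.
  have horth : ∀ I : Finset κ, ∑ σ : κ → Bool, (∏ i ∈ I, (if σ i then (-1 : ℂ) else 1)) *
      ∏ i ∈ K, (if σ i then (-1 : ℂ) else 1) = if I = K then 2 ^ Fintype.card κ else 0 := by
    intro I
    have h1 : ∀ σ : κ → Bool, (∏ i ∈ I, (if σ i then (-1 : ℂ) else 1)) *
        ∏ i ∈ K, (if σ i then (-1 : ℂ) else 1) = ∏ i, ((if i ∈ I then if σ i then (-1 : ℂ) else 1
          else 1) * if i ∈ K then if σ i then (-1 : ℂ) else 1 else 1) := by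
      intro σ
      rw [Finset.prod_mul_distrib, Finset.prod_ite_mem, Finset.prod_ite_mem, Finset.univ_inter,
        Finset.univ_inter]
    simp only [h1]
    rw [← Fintype.prod_sum (fun i (e : Bool) => (if i ∈ I then if e then (-1 : ℂ) else 1
      else 1) * if i ∈ K then if e then (-1 : ℂ) else 1 else 1)]
    split_ifs with hIK
    · subst hIK
      rw [Finset.prod_congr rfl (g := fun _ => (2 : ℂ)) fun i _ => by
        by_cases hi : i ∈ I
        · simp only [hi, if_true, Fintype.sum_bool, Bool.false_eq_true, if_false]
          norm_num
        · simp [hi]]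
      simp
    · obtain ⟨i, hi⟩ : ∃ i, ¬ (i ∈ I ↔ i ∈ K) := by
        by_contra! hne
        exact hIK (Finset.ext hne)
      refine Finset.prod_eq_zero (Finset.mem_univ i) ?_
      by_cases hi₁ : i ∈ I <;> by_cases hi₂ : i ∈ K <;> simp_all
  have h2 : ∑ σ : κ → Bool, (∑ I, a I * ∏ i ∈ I, (if σ i then (-1 : ℂ) else 1)) *
      ∏ i ∈ K, (if σ i then (-1 : ℂ) else 1) = 0 :=
    Finset.sum_eq_zero fun σ _ => by rw [h σ, zero_mul]
  simp only [Finset.sum_mul, mul_assoc] at h2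
  rw [Finset.sum_comm] at h2
  simp only [← Finset.mul_sum, horth, mul_ite, mul_zero, Finset.sum_ite_eq', Finset.mem_univ,
    if_true] at h2
  exact (mul_eq_zero.1 h2).resolve_right (pow_ne_zero _ two_ne_zero)

end Algebra

/-! ### A basis of squarefree products over the line through d -/

section Siegel

variable {n : ℕ} {d : Fin n → ℤ}

/-- The torus fixed points over the line through `d` are spanned over this line by the products of
diagonal entries of the conjugate. -/
theorem exists_eq_sum_of_siegel {r : ℤ} (hr : 0 < r) (hd : ∀ i, |d i| = r) (i₀ : Fin n)
    {B : Type*} [CommRing B] [Algebra ℂ B] (π : coordRing d →ₐ[ℂ] B)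
    (hπ : lineIdeal d i₀ ≤ RingHom.ker (π : coordRing d →+* B)) (f : coordRing d) :
    ∃ p : Finset (Fin n) → Polynomial ℂ, π f = ∑ I, Polynomial.aeval (π (lineParam d i₀)) (p I) *
      ∏ i ∈ I, π (conjMat d (Sum.inl i) (Sum.inl i)) := by
  have hker : fixedIdeal d ≤ RingHom.ker (π : coordRing d →+* B) := fun x hx =>
    hπ (Ideal.mem_sup_left hx)
  let : Algebra (Polynomial ℂ) B := (Polynomial.aeval (π (lineParam d i₀))).toRingHom.toAlgebra
  have hsm : ∀ p : Polynomial ℂ, algebraMap (Polynomial ℂ) B p =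
    Polynomial.aeval (π (lineParam d i₀)) p := fun p => rfl
  have hdiag : ∀ i, π (diagEntry d i) = algebraMap (Polynomial ℂ) B
      (Polynomial.C (wt d i : ℂ) * Polynomial.X) := by
    intro i
    rw [hsm, map_mul, Polynomial.aeval_C, Polynomial.aeval_X, ← sub_eq_zero,
      ← π.commutes, ← map_mul, ← map_sub]
    exact hπ (lineParam_sub_mem i)
  have hwt : ∀ i₁ : Fin n, Finset.univ.image (wt d) = {r, -r} := by
    intro i₁
    ext m
    simp only [Finset.mem_image, Finset.mem_univ, true_and, Finset.mem_insert,
      Finset.mem_singleton]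
    constructor
    · rintro ⟨i | i, rfl⟩
      · exact (abs_eq hr.le).1 (hd i)
      · rcases (abs_eq hr.le).1 (hd i) with h | h <;> simp [wt, h]
    · rcases (abs_eq hr.le).1 (hd i₁) with h | h <;> rintro (rfl | rfl)
      · exact ⟨Sum.inl i₁, h⟩
      · exact ⟨Sum.inr i₁, by simp [wt, h]⟩
      · exact ⟨Sum.inr i₁, by simp [wt, h]⟩
      · exact ⟨Sum.inl i₁, h⟩
  set a : Fin n → B := fun i => π (conjMat d (Sum.inl i) (Sum.inl i)) with ha
  -- The weights are only ±r, so the equation of a diagonal entry is a² = r²t².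
  have hsq : ∀ i, a i * a i = algebraMap (Polynomial ℂ) B
      (Polynomial.C ((r : ℂ) * r) * Polynomial.X ^ 2) := by
    intro i
    have h1 := prod_sub_of_fixedIdeal (π : coordRing d →+* B) hker
      (fun m => algebraMap (Polynomial ℂ) B (Polynomial.C (m : ℂ) * Polynomial.X)) hdiag (Sum.inl i)
    rw [hwt i, Finset.prod_pair (by omega)] at h1
    change (a i - _) * (a i - _) = 0 at h1
    simp only [map_mul, Int.cast_neg, map_neg, map_pow] at h1 ⊢
    linear_combination h1
  have hmem : π f ∈ Algebra.adjoin (Polynomial ℂ) (Set.range a) := by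
    have hf : f ∈ entryAlg d := entryAlg_eq_top hr hd ▸ Algebra.mem_top
    induction hf using Algebra.adjoin_induction with
    | mem x hx =>
      rcases hx with ⟨⟨i, j⟩, rfl⟩ | ⟨i, rfl⟩
      · by_cases hij : i = j
        · subst hij
          rcases i with i | i
          · exact Algebra.subset_adjoin ⟨i, rfl⟩
          · have h1 : conjMat d (Sum.inr i) (Sum.inr i) = _ := conjMat_swap (d := d) (Sum.inl i)
            change π (conjMat d (Sum.inr i) (Sum.inr i)) ∈ _
            rw [h1, map_neg]
            exact neg_mem (Algebra.subset_adjoin ⟨i, rfl⟩)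
        · have h0 : π (conjMat d i j) = 0 := hker (conjMat_mem_fixedIdeal hij)
          change π (conjMat d i j) ∈ _
          rw [h0]
          exact zero_mem _
      · rw [hdiag]
        exact Subalgebra.algebraMap_mem _ _
    | algebraMap c =>
      have : π (algebraMap ℂ _ c) = algebraMap (Polynomial ℂ) B (Polynomial.C c) := by
        rw [hsm, Polynomial.aeval_C, π.commutes]
      rw [this]
      exact Subalgebra.algebraMap_mem _ _
    | add x y _ _ h₁ h₂ => rw [map_add]; exact add_mem h₁ h₂
    | mul x y _ _ h₁ h₂ => rw [map_mul]; exact mul_mem h₁ h₂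
  obtain ⟨p, hp⟩ := (Submodule.mem_span_range_iff_exists_fun _).1
    (mem_span_prod_of_mem_adjoin a _ hsq hmem)
  refine ⟨p, hp.symm.trans (Finset.sum_congr rfl fun I _ => ?_)⟩
  rw [Algebra.smul_def]
  rfl

/-- The fixed point of the torus with Weyl group element `σ` over a point of the line through `d`. -/
def weylPoint (d : Fin n → ℤ) (σ : Fin n → Bool) (τ : ℂ) : Sp n × commPerp d :=
  (⟨signSwap ℂ fun i => if σ i then -1 else 1, signSwap_mem _⟩,
    ⟨τ • cartan fun i => (d i : ℂ), mem_commPerp_iff.2 (by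
      have h1 := isComm_cartan d
      refine ⟨?_, fun i j h hij => ?_, fun i j h => ?_⟩
      · rw [sadj_smul, h1.skew, smul_neg]
      · rw [Matrix.smul_apply, h1.zero i j h hij, smul_zero]
      · rw [Matrix.smul_apply, Matrix.smul_apply, h1.diag i j h])⟩)

lemma blockSL_mul {E : Type*} [CommRing E] (a b c e a' b' c' e' : Fin n → E) :
    blockSL a b c e * blockSL a' b' c' e' = blockSL (fun i => a i * a' i + b i * c' i)
      (fun i => a i * b' i + b i * e' i) (fun i => c i * a' i + e i * c' i)
      fun i => c i * b' i + e i * e' i := by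
  simp only [blockSL, fromBlocks_multiply, diagonal_mul_diagonal, diagonal_add]

lemma sadj_blockSL {E : Type*} [CommRing E] (a b c e : Fin n → E) :
    sadj (blockSL a b c e) = blockSL e (-b) (-c) a := by
  simp only [blockSL, sadj_fromBlocks, diagonal_transpose]
  congr 1 <;> exact diagonal_neg _

lemma diagonal_eq_blockSL {E : Type*} [CommRing E] (v : Fin n ⊕ Fin n → E) :
    diagonal v = blockSL (fun i => v (Sum.inl i)) (fun _ => 0) (fun _ => 0)
      fun i => v (Sum.inr i) := by
  rw [blockSL, diagonal_zero, fromBlocks_diagonal]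
  congr 1
  ext (i | i) <;> rfl

lemma signSwap_conj_diagonal (σ : Fin n → Bool) (v : Fin n ⊕ Fin n → ℂ) :
    (signSwap ℂ fun i => if σ i then -1 else 1) * diagonal v *
      sadj (signSwap ℂ fun i => if σ i then -1 else 1) =
      diagonal fun i => if Sum.elim σ σ i then v i.swap else v i := by
  rw [signSwap, sadj_blockSL, diagonal_eq_blockSL, diagonal_eq_blockSL, blockSL_mul, blockSL_mul]
  congr 1 <;> funext i <;> cases h : σ i <;> simp [h]

lemma sadj_signSwap_conj_diagonal (σ : Fin n → Bool) (v : Fin n ⊕ Fin n → ℂ) :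
    sadj (signSwap ℂ fun i => if σ i then -1 else 1) * diagonal v *
      (signSwap ℂ fun i => if σ i then -1 else 1) =
      diagonal fun i => if Sum.elim σ σ i then v i.swap else v i := by
  rw [signSwap, sadj_blockSL, diagonal_eq_blockSL, diagonal_eq_blockSL, blockSL_mul, blockSL_mul]
  congr 1 <;> funext i <;> cases h : σ i <;> simp [h]

lemma evalAt_weylPoint_diagEntry (σ : Fin n → Bool) (τ : ℂ) (i) :
    evalAt (weylPoint d σ τ) (diagEntry d i) = τ * wt d i := by
  rw [weylPoint, evalAt_diagEntry]
  change τ * cartan (fun i => (d i : ℂ)) i i = _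
  rw [cartan_apply_self]

lemma evalAt_weylPoint_lineParam (σ : Fin n → Bool) (τ : ℂ) {i₀ : Fin n} (hi₀ : d i₀ ≠ 0) :
    evalAt (weylPoint d σ τ) (lineParam d i₀) = τ := by
  have h : (d i₀ : ℂ) ≠ 0 := Int.cast_ne_zero.2 hi₀
  rw [lineParam, map_mul, AlgHom.commutes, evalAt_weylPoint_diagEntry]
  change (d i₀ : ℂ)⁻¹ * (τ * (d i₀ : ℂ)) = τ
  field_simp

lemma evalAt_weylPoint_conjMat (σ : Fin n → Bool) (τ : ℂ) (i : Fin n) :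
    evalAt (weylPoint d σ τ) (conjMat d (Sum.inl i) (Sum.inl i)) =
      τ * d i * if σ i then -1 else 1 := by
  rw [weylPoint, evalAt_conjMat]
  change ((signSwap ℂ fun i => if σ i then -1 else 1) * (τ • cartan fun i => (d i : ℂ)) *
    sadj (signSwap ℂ fun i => if σ i then -1 else 1)) _ _ = _
  rw [cartan, Matrix.mul_smul, Matrix.smul_mul, signSwap_conj_diagonal, Matrix.smul_apply,
    diagonal_apply_eq]
  cases h : σ i <;> simp [h]

/-- A torus element moves past the Weyl group representative w to another diagonal element. That one
lies in P and commutes with Y ∈ 𝔥, so the point of G ×^P [𝔭,𝔭]^⊥ is fixed. -/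
lemma evalAt_weylPoint_eq_zero (σ : Fin n → Bool) (τ : ℂ) {i₀ : Fin n} (hi₀ : d i₀ ≠ 0)
    {f : coordRing d} (hf : f ∈ lineIdeal d i₀) : evalAt (weylPoint d σ τ) f = 0 := by
  have key : lineIdeal d i₀ ≤ RingHom.ker (evalAt (weylPoint d σ τ) : coordRing d →+* ℂ) := by
    refine sup_le (Ideal.span_le.2 ?_) (Ideal.span_le.2 ?_)
    · rintro f ⟨t, ht, f', hf'⟩
      change evalAt (weylPoint d σ τ) f = 0
      rw [evalAt_apply, weylPoint, hf', sub_eq_zero]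
      set w : Sp n := ⟨signSwap ℂ fun i => if σ i then -1 else 1, signSwap_mem _⟩ with hw
      obtain ⟨v, hv⟩ : ∃ v, (t : Mat n) = diagonal v := ⟨_, ht.diagonal_diag.symm⟩
      have h1 : ((w⁻¹ * t * w : Sp n) : Mat n) =
          diagonal fun i => if Sum.elim σ σ i then v i.swap else v i := by
        change ((w⁻¹ : Sp n) : Mat n) * (t : Mat n) * (w : Mat n) = _
        rw [coe_inv_eq_sadj, hv]
        exact sadj_signSwap_conj_diagonal σ v
      have h2 : t * w = w * (w⁻¹ * t * w) := by group
      rw [h2]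
      refine f'.2.2 w (w⁻¹ * t * w) (fun i j hij => ?_) _ _ ?_
      · rw [h1, diagonal_apply_ne]
        rintro rfl
        exact lt_irrefl _ hij
      · rw [h1]
        change _ * (τ • cartan _) = (τ • cartan _) * _
        rw [cartan, Matrix.mul_smul, Matrix.smul_mul, diagonal_mul_diagonal, diagonal_mul_diagonal]
        simp only [mul_comm]
    · rintro _ ⟨i, rfl⟩
      change evalAt (weylPoint d σ τ) _ = 0
      rw [map_sub, map_mul, AlgHom.commutes, evalAt_weylPoint_diagEntry,
        evalAt_weylPoint_lineParam _ _ hi₀, sub_eq_zero, mul_comm]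
      rfl
  exact key hf

/-- Evaluation at the 2ⁿ Weyl points over τ gives a multilinear polynomial in the signs, with
coefficients p_I(τ) times a nonzero number if τ ≠ 0. So every p_I vanishes at all τ ≠ 0. -/
theorem eq_zero_of_sum_mem_lineIdeal (hd : ∀ i, d i ≠ 0) (i₀ : Fin n)
    (p : Finset (Fin n) → Polynomial ℂ)
    (hp : ∑ I, Polynomial.aeval (lineParam d i₀) (p I) *
      ∏ i ∈ I, conjMat d (Sum.inl i) (Sum.inl i) ∈ lineIdeal d i₀) : p = 0 := by
  funext K
  refine Polynomial.eq_zero_of_infinite_isRoot _ (Set.Infinite.mono (s := {0}ᶜ) (fun τ hτ => ?_)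
    (Set.finite_singleton (0 : ℂ)).infinite_compl)
  have h1 := eq_zero_of_sum_signs (fun I => (p I).eval τ * ∏ i ∈ I, (τ * d i)) (fun σ => ?_) K
  · exact (mul_eq_zero.1 h1).resolve_right (Finset.prod_ne_zero_iff.2 fun i _ =>
      mul_ne_zero hτ (Int.cast_ne_zero.2 (hd i)))
  · rw [← evalAt_weylPoint_eq_zero σ τ (hd i₀) hp, map_sum]
    refine Finset.sum_congr rfl fun I _ => ?_
    rw [map_mul, ← Polynomial.aeval_algHom_apply, evalAt_weylPoint_lineParam _ _ (hd i₀),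
      Polynomial.coe_aeval_eq_eval, map_prod, mul_assoc, ← Finset.prod_mul_distrib]
    congr 1
    exact Finset.prod_congr rfl fun i _ => (evalAt_weylPoint_conjMat σ τ i).symm

lemma exists_sub_mem_of_forall_quotient {R : Type} [CommRing R] [Algebra ℂ R] {I : Ideal R}
    {ι : Type*} {s : ι → R} {x : R}
    (h : ∀ (B : Type) [CommRing B] [Algebra ℂ B] (π : R →ₐ[ℂ] B),
      I ≤ RingHom.ker (π : R →+* B) → ∃ i, π x = π (s i)) : ∃ i, x - s i ∈ I := by
  obtain ⟨i, hi⟩ := h (R ⧸ I) (Ideal.Quotient.mkₐ ℂ I) (le_ker_mkₐ I)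
  exact ⟨i, Ideal.Quotient.eq.1 hi⟩

/-- For a Siegel parabolic, all the schemes of torus fixed points have the same length. -/
theorem rank_fixedAlg {r : ℤ} (hr : 0 < r) (hd : ∀ i, |d i| = r) (i₀ : Fin n) (η : Char d) :
    Module.rank ℂ (FixedAlg d η) = Fintype.card (Finset (Fin n)) ∧
      Module.Finite ℂ (FixedAlg d η) := by
  have hd0 : ∀ i, d i ≠ 0 := fun i h => by
    have := hd i
    rw [h, abs_zero] at this
    omega
  have hi₀ : (d i₀ : ℂ) ≠ 0 := Int.cast_ne_zero.2 (hd0 i₀)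
  -- All weights are ± the weight of i₀, so a character is determined by one value and is a multiple
  -- of the one defined by d.
  set τ := charDiag η (Sum.inl i₀) / d i₀ with hτ
  have hη : ∀ i, charDiag η i = charDiag (scaledChar d τ) i := by
    intro i
    rw [charDiag_scaledChar]
    have h1 : |wt d i| = |wt d (Sum.inl i₀)| := by
      have h2 : |wt d (Sum.inl i₀)| = r := hd i₀
      rw [h2]
      rcases i with i | i
      · exact hd i
      · exact (abs_neg _).trans (hd i)
    have h0 : wt d (Sum.inl i₀) = d i₀ := rfl
    rcases abs_eq_abs.1 h1 with h | h
    · rw [charDiag_eq η h, h, h0, hτ]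
      field_simp
    · rw [← wt_swap] at h
      rw [charDiag_eq η h, charDiag_swap, h, wt_swap, h0, hτ]
      push_cast
      field_simp
  have hI : fibreIdeal d η ⊔ fixedIdeal d =
      lineIdeal d i₀ ⊔ Ideal.span {lineParam d i₀ - algebraMap ℂ (coordRing d) τ} := by
    rw [← fibreIdeal_sup_fixedIdeal (hd0 i₀), fibreIdeal_eq, fibreIdeal_eq]
    simp only [hη]
  refine rank_quotient_of_basis hI (fun I : Finset (Fin n) =>
    ∏ i ∈ I, conjMat d (Sum.inl i) (Sum.inl i)) (fun f => ?_) (eq_zero_of_sum_mem_lineIdeal hd0 i₀)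
  refine exists_sub_mem_of_forall_quotient fun B _ _ π hπ => ?_
  obtain ⟨p, hp⟩ := exists_eq_sum_of_siegel hr hd i₀ π hπ f
  refine ⟨p, hp.trans ?_⟩
  rw [map_sum]
  refine Finset.sum_congr rfl fun I _ => ?_
  rw [map_mul, map_prod, Polynomial.aeval_algHom_apply]

/-- The deformation attached to a Siegel parabolic is weakly flat. -/
theorem weakFlat_of_siegel {r : ℤ} (hr : 0 < r) (hd : ∀ i, |d i| = r) :
    (∀ η : Char d, Module.Finite ℂ (FixedAlg d η)) ∧ WeakFlat d := by
  -- For n = 0 there is no index i₀ to define the parameter of the line, but all objects are finite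
  -- and there is only one character.
  rcases isEmpty_or_nonempty (Fin n) with hn | ⟨⟨i₀⟩⟩
  · refine ⟨fun η => ?_, fun η η₀ => ?_⟩
    · have h1 : Finite (Sp n × commPerp d) := by infer_instance
      have h2 : Module.Finite ℂ (Subalgebra.toSubmodule (coordRing d)) := inferInstance
      have h3 : Module.Finite ℂ (coordRing d) := h2
      exact Module.Finite.of_surjective (Ideal.Quotient.mkₐ ℂ _).toLinearMap
        (Ideal.Quotient.mkₐ_surjective ℂ _)
    · have h : η = η₀ := by
        refine LieHom.ext fun Z => ?_
        rw [Subsingleton.elim Z 0, map_zero, map_zero]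
      rw [h]
  · exact ⟨fun η => (rank_fixedAlg hr hd i₀ η).2, fun η η₀ =>
      (rank_fixedAlg hr hd i₀ η).1.trans (rank_fixedAlg hr hd i₀ η₀).1.symm⟩

end Siegel

end SpFlat

end

/-! ### The theorem -/

theorem mainTheorem4 (n : ℕ) (d : Fin n → ℤ) :
    -- `𝔩 = 𝔤𝔩(n)`
    ((∃ r : ℤ, 0 < r ∧ ∀ i, |d i| = r) →
      (∀ η : SpFlat.Char d, Module.Finite ℂ (SpFlat.FixedAlg d η)) ∧ SpFlat.WeakFlat d) ∧
    -- `𝔩 = 𝔰𝔭(2a) × ∏ 𝔤𝔩(b_i)` with `a > 0`, a proper subalgebra of `𝔤`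
    ((∃ i, d i = 0) → (∃ i, d i ≠ 0) → ∀ e : SpFlat.Mat n, SpFlat.IsRichardson d e →
      (SpFlat.IsBirational d e → SpFlat.HasNormalClosure e → ¬ SpFlat.WeakFlat d) ∧
      ∀ x : Fin n → ℂ, SpFlat.IsGeneric d x →
        ∀ S : Finset (Fin n), S.card = (Finset.univ.filter fun i => d i ≠ 0).card + 1 →
          (∏ i ∈ S, (MvPolynomial.X i : MvPolynomial (Fin n) ℂ)) ∈
              SpFlat.gr (SpFlat.cartanIdeal (SpFlat.orbit (SpFlat.cartan x))) ∧
            (∏ i ∈ S, (MvPolynomial.X i : MvPolynomial (Fin n) ℂ)) ∉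
              SpFlat.cartanIdeal (SpFlat.orbit e)) := by
  refine ⟨fun ⟨r, hr, hd⟩ => SpFlat.weakFlat_of_siegel hr hd, ?_⟩
  rintro ⟨i₀, h₀⟩ ⟨i₁, h₁⟩ e he
  refine ⟨fun hbir hnorm => ?_, fun x hx S hS => ⟨?_, ?_⟩⟩
  -- A set of c + 1 indices exists because d i₀ = 0 makes c < n.
  · obtain ⟨S, -, hS⟩ := Finset.exists_subset_card_eq (s := (Finset.univ : Finset (Fin n)))
      (n := (Finset.univ.filter fun i => d i ≠ 0).card + 1) (Finset.card_lt_card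
        (Finset.filter_ssubset.2 ⟨i₀, Finset.mem_univ _, not_not.2 h₀⟩))
    exact SpFlat.not_weakFlat he.1 hbir hnorm h₁ S (hS ▸ Nat.lt_succ_self _)
      (SpFlat.prod_X_notMem_cartanIdeal he (SpFlat.indicator_mem_saturation h₀ h₁ S hS))
  · refine SpFlat.prod_X_mem_gr (SpFlat.prod_X_mem_cartanIdeal x S ?_)
    rw [hS]
    refine Nat.lt_succ_of_le (Finset.card_le_card fun i hi => ?_)
    rw [Finset.mem_filter] at hi ⊢
    exact ⟨hi.1, fun h => hi.2 (hx.eq_zero h)⟩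
  · exact SpFlat.prod_X_notMem_cartanIdeal he (SpFlat.indicator_mem_saturation h₀ h₁ S hS)
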